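/- **Setting.** Let $\Phi\colon\mathbb R\to[0,\infty[$ with $\Phi\in L^\infty_{\mathrm{loc}}(\mathbb R)$ and $\Phi(\alpha)=0$ for $\alpha\le 0$; let $l>-\frac12$ and $L_0\ge0$. The microscopic equation of state is $\varphi(E,L)=\Phi\bigl(1-\frac{E}{E_0}\bigr)(L-L_0)_+^l$ (with $(L-L_0)_+^l:=0$ for $L\le L_0$), where $E_0>0$ is a cut-off energy. With $c_l=\int_0^1\frac{s^l}{\sqrt{1-s}}ds$ and $d_l=\int_0^1 s^l\sqrt{1-s}\,ds$ put $$G(r,y)=2\pi c_l r^{2l}e^{3y}\int_0^{1-e^{-y}\sqrt{1+L_0/r^2}}\Phi(\alpha)(1-\alpha)^2\Bigl(e^{2y}(1-\alpha)^2-1-\tfrac{L_0}{r^2}\Bigr)^{l+\frac12}d\alpha,$$ $$H(r,y)=2\pi d_l r^{2l}e^{y}\int_0^{1-e^{-y}\sqrt{1+L_0/r^2}}\Phi(\alpha)\Bigl(e^{2y}(1-\alpha)^2-1-\tfrac{L_0}{r^2}\Bigr)^{l+\frac32}d\alpha$$ if $e^{-y}\sqrt{1+L_0/r^2}<1$, and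 $G=H=0$ otherwise. Below, $M\ge0$ is the mass of the central black hole ($M=0$: singularity-free case) and $r>2M$. Steady states of the spherically symmetric, asymptotically flat Einstein–Vlasov system in Schwarzschild coordinates $ds^2=-e^{2\mu}dt^2+e^{2\lambda}dr^2+r^2d\omega^2$ are obtained from solutions $y$ of $$y'(r)=-\frac1{1-\frac2r(M+m(r))}\Bigl(\frac{M+m(r)}{r^2}+4\pi r\,p(r)\Bigr),\qquad m(r)=4\pi\int_{2M}^r s^2\rho(s)\,ds,\qquad 2(M+m(r))<r,\tag{1}$$ by $E_0=\exp(\lim_{r\to\infty}y(r))$, $\mu=\ln E_0-y$, $e^{-2\lambda}=1-\frac2r(M+m)$. The particle energy is $E(r,w,L)=e^{\mu(r)}\sqrt{1+w^2+\frac L{r^2}}$, where $w$ is the radial momentum and $L$ the squared angular momentum. *(A) Shells around a black hole.* Let $M>0$, let $\Phi>0$ on some interval $]0,\alpha_0[$, and let $\Psi^0_L(r)=\sqrt{1-\frac{2M}r}\sqrt{1+\frac L{r^2}}$. Let $L_0>12M^2$, let $s^0<r^0$ be the two zeros of $(\Psi^0_{L_0})'$ in $]2M,\infty[$, let $E^0\in\,]\Psi^0_{L_0}(r^0),\min\{1,\Psi^0_{L_0}(s^0)\}[$,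 and let $R_{\min}\in\,]s^0,r^0[$ with $\Psi^0_{L_0}(R_{\min})=E^0$. Put $r_0=s^0$, let $\eta_0>0$ with $r_0+\eta_0<R_{\min}$, and let $0\le\chi\in C^\infty(\mathbb R)$ with $\chi=0$ on $]-\infty,0]$ and $\chi=1$ on $[\eta_0,\infty[$. For $\delta>0$ let $y^\delta\in C^1(]2M,\infty[)$ be the solution of (1) with $\rho=\delta\chi(r-r_0)G(r,y^\delta(r))$, $p=\delta\chi(r-r_0)H(r,y^\delta(r))$ and $y^\delta(4M)=\ln(\sqrt2\,E^0)$ that agrees with the vacuum solution $\ln E^0-\frac12\ln(1-\frac{2M}r)$ for $2M<r\le4M$. The steady state is $f^\delta=\delta\chi(r-r_0)\varphi(E,L)$, with cut-off energy $E_0=E^\delta$. *(B) Singularity-free isotropic steady states.* Let $M=0$, $l=L_0=0$, and suppose there are $c_1,c_2,\alpha_0>0$ and $0\le k<\frac32$ such that $c_1\alpha^k\le\Phi(\alpha)\le c_2\alpha^k$ for $\alpha\in\,]0,\alpha_0]$. Let $y_0>0$, and let $y\in C^1([0,\infty[)$ solve (1) for $r>0$ with $\rho=G(r,y(r))$, $p=H(r,y(r))$,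 $y(0)=y_0$ and $\lim_{r\to\infty}y(r)<0$. The steady state is $f=\varphi(E,L)$, with cut-off energy $E_0\in\,]0,1[$. **Single-well structure and period function.** For a steady state $f$ of either kind let $\Psi_L(r)=e^{\mu(r)}\sqrt{1+\frac L{r^2}}$ and $I_L=\{r>2M:\Psi_L(r)<E_0,\ \rho(r)>0\}$. The steady state has *single-well structure* if for every $L>0$ with $L\ge L_0$ and $I_L\ne\emptyset$ there is a unique $r_L\in I_L$ with $\Psi_L'(r_L)=0$. In that case let $$\tilde\Omega^{EL}_0=\{(E(r,w,L),L): f(r,w,L)>0,\ L>0,\ E(r,w,L)>\Psi_L(r_L)\},$$ let $r_-(E,L)<r_L<r_+(E,L)$ be the radii in $I_L$ with $\Psi_L(r_\pm(E,L))=E$, and define the radial period function on $\tilde\Omega_0^{EL}$ by $$T(E,L)=2\int_{r_-(E,L)}^{r_+(E,L)}e^{\lambda(r)-\mu(r)}\frac{E}{\sqrt{E^2-\Psi_L(r)^2}}\,dr .$$ **Statement.** 1. In the situation (A), with all data except $\delta$ fixed, there is $\delta_0>0$ such that for every $0<\delta\le\delta_0$ the steady state $f^\delta$ has single-well structure, $r_\pm(E,L)$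 exist uniquely and the integral defining $T(E,L)$ converges for all $(E,L)\in\tilde\Omega_0^{EL}$, and there are constants $0<c\le C$ (which may depend on $\delta$) with $c\le T\le C$ on $\tilde\Omega_0^{EL}$. 2. In the situation (B), if $\frac{2m(r)}r\le\frac13$ for all $r>0$, then the steady state has single-well structure, $r_\pm(E,L)$ exist uniquely and the integral defining $T(E,L)$ converges for all $(E,L)\in\tilde\Omega_0^{EL}$, and there are constants $0<c\le C$ with $c\le T\le C$ on $\tilde\Omega_0^{EL}$. -/

import Mathlib

namespace EinsteinVlasov

/-! ### The microscopic equation of state -/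

/-- The function `Φ` maps into `[0, ∞)`, is locally essentially bounded and vanishes on `(-∞, 0]`. -/
structure BasicAnsatz (Φ : ℝ → ℝ) : Prop where
  nonneg : ∀ α, 0 ≤ Φ α
  locBounded : ∀ R : ℝ,
    MeasureTheory.MemLp Φ ⊤ (MeasureTheory.volume.restrict (Set.Icc (-R) R))
  vanish : ∀ α, α ≤ 0 → Φ α = 0

/-- Two-sided power bounds for `Φ` at the cut-off, with an exponent `0 ≤ k < l + 3/2`. -/
def PowerLike (Φ : ℝ → ℝ) (l : ℝ) : Prop :=
  ∃ c₁ c₂ α₀ k : ℝ, 0 < c₁ ∧ 0 < c₂ ∧ 0 < α₀ ∧ 0 ≤ k ∧ k < l + 3 / 2 ∧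
    ∀ α ∈ Set.Ioc 0 α₀, c₁ * α ^ k ≤ Φ α ∧ Φ α ≤ c₂ * α ^ k

/-- `Φ` is positive on some interval `(0, α₀)`. -/
def PositiveAtCutoff (Φ : ℝ → ℝ) : Prop :=
  ∃ α₀ : ℝ, 0 < α₀ ∧ ∀ α ∈ Set.Ioo 0 α₀, 0 < Φ α

/-- The microscopic equation of state `φ(E, L) = Φ(1 - E/E₀) (L - L₀)₊ ^ l`. -/
noncomputable def microState (Φ : ℝ → ℝ) (l L₀ E₀ E L : ℝ) : ℝ :=
  Φ (1 - E / E₀) * (if L₀ < L then (L - L₀) ^ l else 0)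

/-- `c_l = ∫₀¹ s^l (1 - s)^(-1/2) ds`. -/
noncomputable def cConst (l : ℝ) : ℝ := ∫ s in (0 : ℝ)..1, s ^ l / Real.sqrt (1 - s)

/-- `d_l = ∫₀¹ s^l (1 - s)^(1/2) ds`. -/
noncomputable def dConst (l : ℝ) : ℝ := ∫ s in (0 : ℝ)..1, s ^ l * Real.sqrt (1 - s)

/-- The energy density `G(r, y)` of the ansatz as a function of the radius and of
`y = log E₀ - μ`. -/
noncomputable def densityG (Φ : ℝ → ℝ) (l L₀ r y : ℝ) : ℝ :=
  if Real.exp (-y) * Real.sqrt (1 + L₀ / r ^ 2) < 1 then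
    2 * Real.pi * cConst l * r ^ (2 * l) * Real.exp (3 * y) *
      ∫ α in (0 : ℝ)..(1 - Real.exp (-y) * Real.sqrt (1 + L₀ / r ^ 2)),
        Φ α * (1 - α) ^ 2 *
          (Real.exp (2 * y) * (1 - α) ^ 2 - 1 - L₀ / r ^ 2) ^ (l + 1 / 2)
  else 0

/-- The radial pressure `H(r, y)` of the ansatz as a function of the radius and of
`y = log E₀ - μ`. -/
noncomputable def pressureH (Φ : ℝ → ℝ) (l L₀ r y : ℝ) : ℝ :=
  if Real.exp (-y) * Real.sqrt (1 + L₀ / r ^ 2) < 1 then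
    2 * Real.pi * dConst l * r ^ (2 * l) * Real.exp y *
      ∫ α in (0 : ℝ)..(1 - Real.exp (-y) * Real.sqrt (1 + L₀ / r ^ 2)),
        Φ α * (Real.exp (2 * y) * (1 - α) ^ 2 - 1 - L₀ / r ^ 2) ^ (l + 3 / 2)
  else 0

/-- The energy `e^μ √(1 + w² + L/r²)` of a particle at radius `r` with radial momentum `w` and
squared angular momentum `L`. -/
noncomputable def particleEnergy (μ : ℝ → ℝ) (r w L : ℝ) : ℝ :=
  Real.exp (μ r) * Real.sqrt (1 + w ^ 2 + L / r ^ 2)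

/-! ### Effective potential, single-well structure and period function -/

/-- The quantities carried by a static solution: mass `M` of the central black hole (`M = 0` in
the singularity-free case), lower bound `L₀` on the angular momentum, cut-off energy `E₀`, metric
coefficients `μ` and `lam`, density `ρ` and phase space density `f = f(r, w, L)`.
The radial domain is `r > 2M`. This is only a record; the static solutions are built below. -/
structure StaticData where
  M : ℝ
  L₀ : ℝ
  E₀ : ℝ
  μ : ℝ → ℝ
  lam : ℝ → ℝ
  ρ : ℝ → ℝ
  f : ℝ → ℝ → ℝ → ℝ

namespace StaticData

variable (S : StaticData)

/-- The effective potential `Ψ_L(r) = e^μ(r) √(1 + L/r²)`. -/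
noncomputable def effPot (L r : ℝ) : ℝ := Real.exp (S.μ r) * Real.sqrt (1 + L / r ^ 2)

/-- `I_L = {Ψ_L < E₀} ∩ {ρ > 0}`. -/
def wellSet (L : ℝ) : Set ℝ := {r | 2 * S.M < r ∧ S.effPot L r < S.E₀ ∧ 0 < S.ρ r}

/-- Single-well structure: whenever `L > 0`, `L ≥ L₀` and `I_L` is non-empty, `Ψ_L` has exactly one
critical point in `I_L`. -/
def SingleWell : Prop :=
  ∀ L : ℝ, 0 < L → S.L₀ ≤ L → (S.wellSet L).Nonempty →
    ∃! r : ℝ, r ∈ S.wellSet L ∧ HasDerivAt (S.effPot L) 0 r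

/-- `r_L`, the critical point of `Ψ_L` in `I_L` (the set is a singleton under single-well
structure). -/
noncomputable def rCrit (L : ℝ) : ℝ :=
  sInf {r | r ∈ S.wellSet L ∧ HasDerivAt (S.effPot L) 0 r}

/-- The radii `r < r_L` in `I_L` with `Ψ_L(r) = E`. -/
def innerTurning (E L : ℝ) : Set ℝ := {r | r ∈ S.wellSet L ∧ r < S.rCrit L ∧ S.effPot L r = E}

/-- The radii `r > r_L` in `I_L` with `Ψ_L(r) = E`. -/
def outerTurning (E L : ℝ) : Set ℝ := {r | r ∈ S.wellSet L ∧ S.rCrit L < r ∧ S.effPot L r = E}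

/-- `r_-(E, L)`, the element of `innerTurning E L` when that set is a singleton. -/
noncomputable def rMinus (E L : ℝ) : ℝ := sInf (S.innerTurning E L)

/-- `r_+(E, L)`, the element of `outerTurning E L` when that set is a singleton. -/
noncomputable def rPlus (E L : ℝ) : ℝ := sInf (S.outerTurning E L)

/-- `Ω₀ = {f > 0}`, the interior of the steady state support in coordinates `(r, w, L)`. -/
def support : Set (ℝ × ℝ × ℝ) :=
  {x | 2 * S.M < x.1 ∧ 0 ≤ x.2.2 ∧ 0 < S.f x.1 x.2.1 x.2.2}

/-- The set of all `(E(r, w, L), L)` with `(r, w, L) ∈ Ω₀`, `L > 0` and `E(r, w, L) > Ψ_L(r_L)`. -/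
def actionSet : Set (ℝ × ℝ) :=
  {z | ∃ r w L : ℝ, (r, w, L) ∈ S.support ∧ 0 < L ∧
    S.effPot L (S.rCrit L) < particleEnergy S.μ r w L ∧ z = (particleEnergy S.μ r w L, L)}

/-- The integrand `e^(lam - μ) E / √(E² - Ψ_L²)` of the period function. -/
noncomputable def periodIntegrand (E L r : ℝ) : ℝ :=
  Real.exp (S.lam r - S.μ r) * (E / Real.sqrt (E ^ 2 - S.effPot L r ^ 2))

/-- The radial period function
`T(E, L) = 2 ∫_{r_-(E, L)}^{r_+(E, L)} e^(lam - μ) E / √(E² - Ψ_L²) dr`. -/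
noncomputable def period (E L : ℝ) : ℝ :=
  2 * ∫ r in S.rMinus E L..S.rPlus E L, S.periodIntegrand E L r

/-- On `actionSet` the radii `r_±(E, L)` exist uniquely and the integral defining `T` converges. -/
def PeriodWellDefined : Prop :=
  ∀ E L : ℝ, (E, L) ∈ S.actionSet →
    (∃! r : ℝ, r ∈ S.innerTurning E L) ∧ (∃! r : ℝ, r ∈ S.outerTurning E L) ∧
      IntervalIntegrable (S.periodIntegrand E L) MeasureTheory.volume (S.rMinus E L) (S.rPlus E L)

/-- `T` is bounded and bounded away from zero on `actionSet`. -/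
def PeriodBounded : Prop :=
  ∃ c C : ℝ, 0 < c ∧ ∀ E L : ℝ, (E, L) ∈ S.actionSet → c ≤ S.period E L ∧ S.period E L ≤ C

end StaticData

/-! ### Singularity-free steady states -/

/-- The quasi-local mass `m(r) = 4π ∫₀^r s² G(s, y(s)) ds`. -/
noncomputable def regularMass (Φ : ℝ → ℝ) (l L₀ : ℝ) (y : ℝ → ℝ) (r : ℝ) : ℝ :=
  4 * Real.pi * ∫ s in (0 : ℝ)..r, s ^ 2 * densityG Φ l L₀ s (y s)

/-- `y ∈ C¹([0, ∞))` solves the reduced static Einstein-Vlasov equation with `y(0) = y₀`, and its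
limit at infinity is `log E₀ < 0`. -/
structure IsRegularSolution (Φ : ℝ → ℝ) (l L₀ y₀ E₀ : ℝ) (y : ℝ → ℝ) : Prop where
  smooth : ContDiffOn ℝ 1 y (Set.Ici 0)
  initial : y 0 = y₀
  noHorizon : ∀ r : ℝ, 0 < r → 2 * regularMass Φ l L₀ y r < r
  ode : ∀ r : ℝ, 0 < r → HasDerivAt y
    (-(1 / (1 - 2 / r * regularMass Φ l L₀ y r)) *
      (regularMass Φ l L₀ y r / r ^ 2 + 4 * Real.pi * r * pressureH Φ l L₀ r (y r))) r
  cutoff_pos : 0 < E₀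
  cutoff_lt_one : E₀ < 1
  limit : Filter.Tendsto y Filter.atTop (nhds (Real.log E₀))

/-- The singularity-free steady state given by a solution `y`: `μ = log E₀ - y`,
`e^(-2 lam) = 1 - 2m/r`, `ρ = G(r, y)`, `f = φ(E, L)`. -/
noncomputable def regularState (Φ : ℝ → ℝ) (l L₀ E₀ : ℝ) (y : ℝ → ℝ) : StaticData where
  M := 0
  L₀ := L₀
  E₀ := E₀
  μ := fun r => Real.log E₀ - y r
  lam := fun r => -(1 / 2) * Real.log (1 - 2 / r * regularMass Φ l L₀ y r)
  ρ := fun r => densityG Φ l L₀ r (y r)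
  f := fun r w L =>
    microState Φ l L₀ E₀ (particleEnergy (fun r => Real.log E₀ - y r) r w L) L

/-! ### Matter shells around a Schwarzschild black hole -/

/-- The effective potential `√(1 - 2M/r) √(1 + L/r²)` of the Schwarzschild spacetime of mass `M`. -/
noncomputable def schwarzschildPot (M L r : ℝ) : ℝ :=
  Real.sqrt (1 - 2 * M / r) * Real.sqrt (1 + L / r ^ 2)

/-- The parameters of a family of shells. For `L₀ > 12M²` the numbers `r₀ < rL` are the two critical
points of the Schwarzschild effective potential for `L₀` (a maximum and a minimum), the intermediate
energy `e₀` lies strictly between the value at `rL` and the minimum of `1` and the value at `r₀`,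
`Rmin` is the radius between `r₀` and `rL` at which the potential equals `e₀`, and `χ` is a smooth
cut-off function that vanishes on `(-∞, 0]` and equals `1` on `[η₀, ∞)`, where
`r₀ + η₀ < Rmin`. -/
structure ShellParameters (M L₀ r₀ rL e₀ Rmin η₀ : ℝ) (χ : ℝ → ℝ) : Prop where
  mass_pos : 0 < M
  L₀_large : 12 * M ^ 2 < L₀
  r₀_outside : 2 * M < r₀
  r₀_lt_rL : r₀ < rL
  r₀_crit : HasDerivAt (schwarzschildPot M L₀) 0 r₀
  rL_crit : HasDerivAt (schwarzschildPot M L₀) 0 rL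
  e₀_lower : schwarzschildPot M L₀ rL < e₀
  e₀_upper : e₀ < min 1 (schwarzschildPot M L₀ r₀)
  r₀_lt_Rmin : r₀ < Rmin
  Rmin_lt_rL : Rmin < rL
  Rmin_energy : schwarzschildPot M L₀ Rmin = e₀
  η₀_pos : 0 < η₀
  η₀_small : r₀ + η₀ < Rmin
  χ_smooth : ContDiff ℝ (⊤ : ℕ∞) χ
  χ_nonneg : ∀ s, 0 ≤ χ s
  χ_zero : ∀ s, s ≤ 0 → χ s = 0
  χ_one : ∀ s, η₀ ≤ s → χ s = 1

/-- `ρ(r) = δ χ(r - r₀) G(r, y(r))`. -/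
noncomputable def shellDensity (Φ : ℝ → ℝ) (l L₀ r₀ : ℝ) (χ : ℝ → ℝ) (δ : ℝ) (y : ℝ → ℝ)
    (r : ℝ) : ℝ :=
  δ * χ (r - r₀) * densityG Φ l L₀ r (y r)

/-- `p(r) = δ χ(r - r₀) H(r, y(r))`. -/
noncomputable def shellPressure (Φ : ℝ → ℝ) (l L₀ r₀ : ℝ) (χ : ℝ → ℝ) (δ : ℝ) (y : ℝ → ℝ)
    (r : ℝ) : ℝ :=
  δ * χ (r - r₀) * pressureH Φ l L₀ r (y r)

/-- The mass `M + m(r)`, `m(r) = 4π ∫_{2M}^r s² ρ(s) ds`, of the black hole and of the matter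
inside radius `r`. -/
noncomputable def shellMass (M : ℝ) (Φ : ℝ → ℝ) (l L₀ r₀ : ℝ) (χ : ℝ → ℝ) (δ : ℝ) (y : ℝ → ℝ)
    (r : ℝ) : ℝ :=
  M + 4 * Real.pi * ∫ s in (2 * M)..r, s ^ 2 * shellDensity Φ l L₀ r₀ χ δ y s

/-- `y ∈ C¹((2M, ∞))` solves the reduced static Einstein-Vlasov equation for the shell with
parameter `δ`, and its limit at infinity is `log Eδ`. The initial value is
`y(4M) = log (√2 e₀)`; the solution meant is the one that is the Schwarzschild one up to `4M`. -/
structure IsShellSolution (M : ℝ) (Φ : ℝ → ℝ) (l L₀ r₀ e₀ : ℝ) (χ : ℝ → ℝ) (δ Eδ : ℝ)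
    (y : ℝ → ℝ) : Prop where
  smooth : ContDiffOn ℝ 1 y (Set.Ioi (2 * M))
  initial : y (4 * M) = Real.log (Real.sqrt 2 * e₀)
  inner : ∀ r ∈ Set.Ioc (2 * M) (4 * M),
    y r = Real.log e₀ - 1 / 2 * Real.log (1 - 2 * M / r)
  noHorizon : ∀ r : ℝ, 2 * M < r → 2 * shellMass M Φ l L₀ r₀ χ δ y r < r
  ode : ∀ r : ℝ, 2 * M < r → HasDerivAt y
    (-(1 / (1 - 2 / r * shellMass M Φ l L₀ r₀ χ δ y r)) *
      (shellMass M Φ l L₀ r₀ χ δ y r / r ^ 2 +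
        4 * Real.pi * r * shellPressure Φ l L₀ r₀ χ δ y r)) r
  cutoff_pos : 0 < Eδ
  limit : Filter.Tendsto y Filter.atTop (nhds (Real.log Eδ))

/-- The shell given by a solution `y`: `μ = log Eδ - y`, `e^(-2 lam) = 1 - 2(M + m)/r`,
`ρ = δ χ(r - r₀) G(r, y)`, `f = δ χ(r - r₀) φ(E, L)`. -/
noncomputable def shellState (M : ℝ) (Φ : ℝ → ℝ) (l L₀ r₀ : ℝ) (χ : ℝ → ℝ) (δ Eδ : ℝ)
    (y : ℝ → ℝ) : StaticData where
  M := M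
  L₀ := L₀
  E₀ := Eδ
  μ := fun r => Real.log Eδ - y r
  lam := fun r => -(1 / 2) * Real.log (1 - 2 / r * shellMass M Φ l L₀ r₀ χ δ y r)
  ρ := shellDensity Φ l L₀ r₀ χ δ y
  f := fun r w L => δ * χ (r - r₀) *
    microState Φ l L₀ Eδ (particleEnergy (fun r => Real.log Eδ - y r) r w L) L

end EinsteinVlasov

namespace EinsteinVlasov
open Set MeasureTheory

/-! ### Integrals with inverse square root singularities -/

/-! The period is the integral of `e^(λ-μ) E / √(E² - Ψ_L²)` between two zeros of the radicand, so
it is controlled as soon as all wells are quadratic with constants independent of `E` and `L`. To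
express this, multiply by a positive weight: `D = k (E² - Ψ_L²)` should satisfy `D' = -r h W`, with
`h` between positive constants and `W'` between positive multiples of `r` (`WellProfile`). Then `D`
increases up to the zero of `W` and decreases after it, which yields exactly two turning points. If
`x` is the zero of `W`, then on each side of `x` the function `D` lies between constant multiples of
`d² - (r² - x²)²`, where `d` is the distance in the variable `r²` from `x` to the turning point.
Since `∫ r / √(d² - (r² - x²)²) dr = π/4` on each side for every `d`, the period has two-sided
bounds in terms of the constants alone (`WellProfile.integral_mem`, `IsWell.period_mem`,
`conclusion_of_isWell`).

Isotropic states: the weight `r² e^(2y) / E₀²` gives `D = ε² r² e^(2y) - r² - L` with `ε = E / E₀`,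
hence `h = 2` and `W = 1 - ε² N`, `N = e^(2y) (1 - a)`, `a = r μ'`. The angular momentum drops out
of `D'`, so the constants survive the limit `L → 0`, in which the wells reach the centre. What
remains is that `N` decreases at a rate comparable to `r`. The bound `2m/r ≤ 1/3` enters twice: it
excludes photon spheres, `a < 1` (`no_photon_sphere`), and it makes `3 - 2/(1 - 2m/r)` nonnegative
(`deficit_ge`, `exists_N_bounds`).

Shells: the weight is `1`. In vacuum the slope of the potential has the sign of `M r² - L r + 3 M
L`; after division by `r - r₀` this has derivative at least `M` for every `L ≥ L₀`. Comparison with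
vacuum confines the matter to a fixed interval to the right of `r₀` (`exp_two_mul_le`,
`eq_zero_of_notMem`). There the density, the pressure, its derivative and the added mass are `O(δ)`,
so the derivative stays above `M/2` for small `δ` (`exists_wellSlope_bounds`). -/

lemma intervalIntegral_div_sqrt_sub_sq {u v s d : ℝ} (hu : 0 ≤ u) (huv : u ≤ v) (hd : 0 < d)
    (h₁ : s - d ≤ u ^ 2) (h₂ : v ^ 2 ≤ s + d) :
    IntervalIntegrable (fun r => r / √(d ^ 2 - (r ^ 2 - s) ^ 2)) volume u v ∧
      ∫ r in u..v, r / √(d ^ 2 - (r ^ 2 - s) ^ 2) =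
        Real.arcsin ((v ^ 2 - s) / d) / 2 - Real.arcsin ((u ^ 2 - s) / d) / 2 := by
  have hcont : ContinuousOn (fun r : ℝ => Real.arcsin ((r ^ 2 - s) / d) / 2) (Icc u v) := by
    have := Real.continuous_arcsin
    fun_prop
  have hderiv : ∀ r ∈ Ioo u v, HasDerivAt (fun r : ℝ => Real.arcsin ((r ^ 2 - s) / d) / 2)
      (r / √(d ^ 2 - (r ^ 2 - s) ^ 2)) r := by
    intro r hr
    have hur : u ^ 2 < r ^ 2 := by nlinarith [hr.1]
    have hrv : r ^ 2 < v ^ 2 := by nlinarith [hr.1, hr.2]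
    have hlt : (r ^ 2 - s) / d < 1 := by rw [div_lt_one hd]; linarith
    have hgt : -1 < (r ^ 2 - s) / d := by rw [lt_div_iff₀ hd]; linarith
    have hin : HasDerivAt (fun r : ℝ => (r ^ 2 - s) / d) (2 * r / d) r := by
      simpa using ((hasDerivAt_pow 2 r).sub_const s).div_const d
    have := ((Real.hasDerivAt_arcsin hgt.ne' hlt.ne).comp r hin).div_const 2
    refine this.congr_deriv ?_
    have e : d ^ 2 - (r ^ 2 - s) ^ 2 = d ^ 2 * (1 - ((r ^ 2 - s) / d) ^ 2) := by
      field_simp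
    have hp : 0 < 1 - ((r ^ 2 - s) / d) ^ 2 := by nlinarith
    rw [e, Real.sqrt_mul (sq_nonneg d), Real.sqrt_sq hd.le]
    have := Real.sqrt_pos.2 hp
    field_simp
  -- The integrand is the nonnegative derivative of a continuous function, so integrability up to
  -- the singular end points is automatic.
  have hint : IntervalIntegrable (fun r => r / √(d ^ 2 - (r ^ 2 - s) ^ 2)) volume u v := by
    apply intervalIntegral.intervalIntegrable_deriv_of_nonneg
    · rwa [uIcc_of_le huv]
    · rwa [min_eq_left huv, max_eq_right huv]
    · rw [min_eq_left huv, max_eq_right huv]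
      intro r hr
      have : 0 ≤ r := hu.trans hr.1.le
      positivity
  exact ⟨hint, intervalIntegral.integral_eq_sub_of_hasDerivAt_of_le huv hcont hderiv hint⟩

/-- Comparison with the explicit integrand. In the applications `s` is the square of one end point
and `s ± d` the square of the other, so the difference of the arcsine terms is `π/4` whatever `d`
is. -/
lemma intervalIntegral_div_sqrt_mem {u v s d c₁ c₂ g₁ g₂ : ℝ} {D g f : ℝ → ℝ}
    (hu : 0 ≤ u) (huv : u ≤ v) (hd : 0 < d) (h₁ : s - d ≤ u ^ 2) (h₂ : v ^ 2 ≤ s + d)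
    (hc₁ : 0 < c₁) (hc₂ : 0 < c₂) (hg₁ : 0 < g₁)
    (hD₁ : ∀ r ∈ Ioo u v, c₁ * (d ^ 2 - (r ^ 2 - s) ^ 2) ≤ D r)
    (hD₂ : ∀ r ∈ Ioo u v, D r ≤ c₂ * (d ^ 2 - (r ^ 2 - s) ^ 2))
    (hg : ∀ r ∈ Ioo u v, g₁ * r ≤ g r ∧ g r ≤ g₂ * r)
    (hf : ∀ r ∈ Ioo u v, f r = g r / √(D r)) (hcont : ContinuousOn f (Ioo u v)) :
    IntervalIntegrable f volume u v ∧
      g₁ / √c₂ * (Real.arcsin ((v ^ 2 - s) / d) / 2 - Real.arcsin ((u ^ 2 - s) / d) / 2) ≤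
        ∫ r in u..v, f r ∧
      ∫ r in u..v, f r ≤
        g₂ / √c₁ * (Real.arcsin ((v ^ 2 - s) / d) / 2 - Real.arcsin ((u ^ 2 - s) / d) / 2) := by
  obtain ⟨hi, hv⟩ := intervalIntegral_div_sqrt_sub_sq hu huv hd h₁ h₂
  have key : ∀ r ∈ Ioo u v,
      g₁ / √c₂ * (r / √(d ^ 2 - (r ^ 2 - s) ^ 2)) ≤ f r ∧
      f r ≤ g₂ / √c₁ * (r / √(d ^ 2 - (r ^ 2 - s) ^ 2)) := by
    intro r hr
    have hr0 : 0 < r := hu.trans_lt hr.1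
    have hur : u ^ 2 < r ^ 2 := by nlinarith [hr.1]
    have hrv : r ^ 2 < v ^ 2 := by nlinarith [hr.1, hr.2]
    have hp : 0 < d ^ 2 - (r ^ 2 - s) ^ 2 := by nlinarith
    have hDp : 0 < D r := (mul_pos hc₁ hp).trans_le (hD₁ r hr)
    obtain ⟨hg1, hg2⟩ := hg r hr
    have hg0 : 0 < g r := (mul_pos hg₁ hr0).trans_le hg1
    rw [hf r hr, div_mul_div_comm, div_mul_div_comm, ← Real.sqrt_mul hc₁.le,
      ← Real.sqrt_mul hc₂.le]
    constructor
    · exact div_le_div₀ hg0.le hg1 (Real.sqrt_pos.2 hDp) (Real.sqrt_le_sqrt (hD₂ r hr))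
    · exact div_le_div₀ (hg0.le.trans hg2) hg2 (Real.sqrt_pos.2 (mul_pos hc₁ hp))
        (Real.sqrt_le_sqrt (hD₁ r hr))
  have hfi : IntervalIntegrable f volume u v := by
    have hgi := hi.const_mul (g₂ / √c₁)
    rw [intervalIntegrable_iff_integrableOn_Ioo_of_le huv] at hgi ⊢
    refine Integrable.mono' hgi (hcont.aestronglyMeasurable measurableSet_Ioo) ?_
    refine (ae_restrict_iff' measurableSet_Ioo).2 (Filter.Eventually.of_forall fun r hr => ?_)
    have hr0 : 0 < r := hu.trans_lt hr.1
    rw [Real.norm_of_nonneg (le_trans (by positivity) (key r hr).1)]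
    exact (key r hr).2
  refine ⟨hfi, ?_, ?_⟩
  · rw [← hv, ← intervalIntegral.integral_const_mul]
    exact intervalIntegral.integral_mono_on_of_le_Ioo huv (hi.const_mul _) hfi
      fun r hr => (key r hr).1
  · rw [← hv, ← intervalIntegral.integral_const_mul]
    exact intervalIntegral.integral_mono_on_of_le_Ioo huv hfi (hi.const_mul _)
      fun r hr => (key r hr).2

/-! ### Functions with a quadratic maximum -/

/-- `D` is a function on `[a, b]` with derivative `-r h W`, where `h` lies between positive
constants and `W` increases at a rate comparable to that of `r²`. -/
structure WellProfile (a b c C h₁ h₂ : ℝ) (D h W W' : ℝ → ℝ) : Prop where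
  left_pos : 0 < a
  lt : a < b
  c_pos : 0 < c
  h_pos : 0 < h₁
  cont : ContinuousOn D (Icc a b)
  deriv : ∀ r ∈ Ioo a b, HasDerivAt D (-(r * h r * W r)) r
  h_mem : ∀ r ∈ Ioo a b, h₁ ≤ h r ∧ h r ≤ h₂
  W_deriv : ∀ r ∈ Ioo a b, HasDerivAt W (W' r) r
  W_mem : ∀ r ∈ Ioo a b, c * r ≤ W' r ∧ W' r ≤ C * r

namespace WellProfile

variable {a b c C h₁ h₂ : ℝ} {D h W W' : ℝ → ℝ}

/-- `W - κ r² / 2` has derivative `W' - κ r`, which has a sign for `κ = c` and for `κ = C`. -/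
lemma W_sub_mem (P : WellProfile a b c C h₁ h₂ D h W W') {x y : ℝ} (hx : x ∈ Ioo a b)
    (hy : y ∈ Ioo a b) (hxy : x ≤ y) :
    c / 2 * (y ^ 2 - x ^ 2) ≤ W y - W x ∧ W y - W x ≤ C / 2 * (y ^ 2 - x ^ 2) := by
  have sub : Icc x y ⊆ Ioo a b := fun r hr => ⟨hx.1.trans_le hr.1, hr.2.trans_lt hy.2⟩
  have hd : ∀ κ : ℝ, ∀ r ∈ Icc x y,
      HasDerivAt (fun r => W r - κ / 2 * r ^ 2) (W' r - κ * r) r := by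
    intro κ r hr
    have := (P.W_deriv r (sub hr)).fun_sub ((hasDerivAt_pow 2 r).const_mul (κ / 2))
    refine this.congr_deriv ?_
    norm_num; ring
  constructor
  · have : MonotoneOn (fun r => W r - c / 2 * r ^ 2) (Icc x y) := by
      refine monotoneOn_of_deriv_nonneg (convex_Icc x y)
        (fun r hr => (hd c r hr).continuousAt.continuousWithinAt)
        (fun r hr => (hd c r (interior_subset hr)).differentiableAt.differentiableWithinAt)
        fun r hr => ?_
      rw [(hd c r (interior_subset hr)).deriv]
      linarith [(P.W_mem r (sub (interior_subset hr))).1]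
    have := this (left_mem_Icc.2 hxy) (right_mem_Icc.2 hxy) hxy
    simp only at this
    linarith
  · have : AntitoneOn (fun r => W r - C / 2 * r ^ 2) (Icc x y) := by
      refine antitoneOn_of_deriv_nonpos (convex_Icc x y)
        (fun r hr => (hd C r hr).continuousAt.continuousWithinAt)
        (fun r hr => (hd C r (interior_subset hr)).differentiableAt.differentiableWithinAt)
        fun r hr => ?_
      rw [(hd C r (interior_subset hr)).deriv]
      linarith [(P.W_mem r (sub (interior_subset hr))).2]
    have := this (left_mem_Icc.2 hxy) (right_mem_Icc.2 hxy) hxy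
    simp only at this
    linarith

/-- The rate constants are ordered. -/
lemma c_le_C (P : WellProfile a b c C h₁ h₂ D h W W') : c ≤ C := by
  have hm : (a + b) / 2 ∈ Ioo a b := ⟨by linarith [P.lt], by linarith [P.lt]⟩
  have := P.W_mem _ hm
  have h0 : 0 < (a + b) / 2 := P.left_pos.trans hm.1
  exact le_of_mul_le_mul_right (this.1.trans this.2) h0

lemma h₁_le_h₂ (P : WellProfile a b c C h₁ h₂ D h W W') : h₁ ≤ h₂ := by
  have hm : (a + b) / 2 ∈ Ioo a b := ⟨by linarith [P.lt], by linarith [P.lt]⟩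
  exact (P.h_mem _ hm).1.trans (P.h_mem _ hm).2

/-- `W` is negative to the left of its zero, hence `D' = -r h W` is positive there. -/
lemma strictMonoOn_left (P : WellProfile a b c C h₁ h₂ D h W W') {x : ℝ} (hx : x ∈ Ioo a b)
    (hW : W x = 0) : StrictMonoOn D (Icc a x) := by
  refine strictMonoOn_of_deriv_pos (convex_Icc a x)
    (P.cont.mono (Icc_subset_Icc_right hx.2.le)) fun r hr => ?_
  rw [interior_Icc] at hr
  have hr' : r ∈ Ioo a b := ⟨hr.1, hr.2.trans hx.2⟩
  have hr0 : 0 < r := P.left_pos.trans hr.1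
  rw [(P.deriv r hr').deriv]
  have h1 := (P.W_sub_mem hr' hx hr.2.le).1
  have h2 : 0 < x ^ 2 - r ^ 2 := by nlinarith [hr.2]
  have h3 : 0 < h r := P.h_pos.trans_le (P.h_mem r hr').1
  have h4 : W r < 0 := by nlinarith [mul_pos P.c_pos h2]
  have := mul_pos (mul_pos hr0 h3) (neg_pos.2 h4)
  linarith

lemma strictAntiOn_right (P : WellProfile a b c C h₁ h₂ D h W W') {x : ℝ} (hx : x ∈ Ioo a b)
    (hW : W x = 0) : StrictAntiOn D (Icc x b) := by
  refine strictAntiOn_of_deriv_neg (convex_Icc x b)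
    (P.cont.mono (Icc_subset_Icc_left hx.1.le)) fun r hr => ?_
  rw [interior_Icc] at hr
  have hr' : r ∈ Ioo a b := ⟨hx.1.trans hr.1, hr.2⟩
  have hx0 : 0 < x := P.left_pos.trans hx.1
  have hr0 : 0 < r := hx0.trans hr.1
  rw [(P.deriv r hr').deriv]
  have h1 := (P.W_sub_mem hx hr' hr.1.le).1
  have h2 : 0 < r ^ 2 - x ^ 2 := by nlinarith [hr.1]
  have h3 : 0 < h r := P.h_pos.trans_le (P.h_mem r hr').1
  have h4 : 0 < W r := by nlinarith [mul_pos P.c_pos h2]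
  have := mul_pos (mul_pos hr0 h3) h4
  linarith

/-- A critical point of `D` is its strict maximum. -/
lemma lt_of_ne (P : WellProfile a b c C h₁ h₂ D h W W') {x y : ℝ} (hx : x ∈ Ioo a b)
    (hW : W x = 0) (hy : y ∈ Icc a b) (hxy : y ≠ x) : D y < D x := by
  rcases lt_or_gt_of_ne hxy with hlt | hgt
  · exact P.strictMonoOn_left hx hW ⟨hy.1, hlt.le⟩ (right_mem_Icc.2 hx.1.le) hlt
  · exact P.strictAntiOn_right hx hW (left_mem_Icc.2 hx.2.le) ⟨hgt.le, hy.2⟩ hgt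

lemma W_eq_zero (P : WellProfile a b c C h₁ h₂ D h W W') {x : ℝ} (hx : x ∈ Ioo a b)
    (hD : HasDerivAt D 0 x) : W x = 0 := by
  have hz := (P.deriv x hx).unique hD
  have hx0 : x ≠ 0 := (P.left_pos.trans hx.1).ne'
  have h3 : h x ≠ 0 := (P.h_pos.trans_le (P.h_mem x hx).1).ne'
  rw [neg_eq_zero, mul_eq_zero, mul_eq_zero] at hz
  tauto

/-- If `D` is negative at the end points and positive somewhere, then it has exactly two zeros
and one critical point. -/
lemma exists_zeros (P : WellProfile a b c C h₁ h₂ D h W W') (ha : D a < 0) (hb : D b < 0)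
    {x₀ : ℝ} (hx₀ : x₀ ∈ Ioo a b) (hpos : 0 < D x₀) :
    ∃ u x v : ℝ, a < u ∧ u < x ∧ x < v ∧ v < b ∧ W x = 0 ∧ D u = 0 ∧ D v = 0 ∧
      u < x₀ ∧ x₀ < v ∧ (∀ r ∈ Icc a b, 0 < D r ↔ r ∈ Ioo u v) ∧
      (∀ r ∈ Icc a b, D r = 0 → r = u ∨ r = v) := by
  obtain ⟨x, hxI, hmax⟩ := isCompact_Icc.exists_isMaxOn (nonempty_Icc.2 P.lt.le) P.cont
  have hDx : 0 < D x := hpos.trans_le (hmax (Ioo_subset_Icc_self hx₀))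
  have hx : x ∈ Ioo a b := by
    refine ⟨lt_of_le_of_ne hxI.1 ?_, lt_of_le_of_ne hxI.2 ?_⟩
    · rintro rfl; linarith
    · rintro rfl; linarith
  have hloc : IsLocalMax D x := hmax.isLocalMax (Icc_mem_nhds hx.1 hx.2)
  have hW : W x = 0 := by
    refine P.W_eq_zero hx ?_
    have := hloc.hasDerivAt_eq_zero (P.deriv x hx)
    simpa [this] using P.deriv x hx
  have hmono := P.strictMonoOn_left hx hW
  have hanti := P.strictAntiOn_right hx hW
  obtain ⟨u, hu, hDu⟩ := intermediate_value_Ioo hx.1.le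
    (P.cont.mono (Icc_subset_Icc_right hx.2.le)) (show (0 : ℝ) ∈ Ioo (D a) (D x) from ⟨ha, hDx⟩)
  obtain ⟨v, hv, hDv⟩ := intermediate_value_Ioo' hx.2.le
    (P.cont.mono (Icc_subset_Icc_left hx.1.le)) (show (0 : ℝ) ∈ Ioo (D b) (D x) from ⟨hb, hDx⟩)
  have hiff : ∀ r ∈ Icc a b, 0 < D r ↔ r ∈ Ioo u v := by
    intro r hr
    rcases le_total r x with hrx | hrx
    · rw [← hDu, hmono.lt_iff_lt ⟨hu.1.le, hu.2.le⟩ ⟨hr.1, hrx⟩]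
      exact ⟨fun h => ⟨h, hrx.trans_lt hv.1⟩, fun h => h.1⟩
    · rw [← hDv, hanti.lt_iff_gt ⟨hv.1.le, hv.2.le⟩ ⟨hrx, hr.2⟩]
      exact ⟨fun h => ⟨hu.2.trans_le hrx, h⟩, fun h => h.2⟩
  have h0 := (hiff x₀ (Ioo_subset_Icc_self hx₀)).1 hpos
  refine ⟨u, x, v, hu.1, hu.2, hv.1, hv.2, hW, hDu, hDv, h0.1, h0.2, hiff, ?_⟩
  intro r hr hDr
  rcases le_total r x with hrx | hrx
  · left
    exact hmono.injOn ⟨hr.1, hrx⟩ ⟨hu.1.le, hu.2.le⟩ (hDr.trans hDu.symm)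
  · right
    exact hanti.injOn ⟨hrx, hr.2⟩ ⟨hv.1.le, hv.2.le⟩ (hDr.trans hDv.symm)

/-- The comparison function behind the quadratic bounds: if `s` is the square of the zero of `W`,
the bracket has a fixed sign on each side for `κ = h₁ c` and for `κ = h₂ C`. The factor `1/8` arises
from integrating `κ/2 · r (r² - s)`. -/
lemma hasDerivAt_add_sq (P : WellProfile a b c C h₁ h₂ D h W W') (κ s : ℝ) {r : ℝ}
    (hr : r ∈ Ioo a b) :
    HasDerivAt (fun r => D r + κ / 8 * (r ^ 2 - s) ^ 2)
      (r * (κ / 2 * (r ^ 2 - s) - h r * W r)) r := by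
  have h1 : HasDerivAt (fun r : ℝ => (r ^ 2 - s) ^ 2) (2 * (r ^ 2 - s) * (2 * r)) r := by
    simpa using ((hasDerivAt_pow 2 r).sub_const s).fun_pow 2
  refine ((P.deriv r hr).fun_add (h1.const_mul (κ / 8))).congr_deriv ?_
  ring

/-- Integrate `h₁ c / 2 · (r² - x²) ≤ h W ≤ h₂ C / 2 · (r² - x²)` from `r` to the zero `v` of `D`.
Anchoring at the zero rather than at the maximum produces the radicand of the explicit integral. -/
lemma mem_right (P : WellProfile a b c C h₁ h₂ D h W W') {x v : ℝ} (hx : x ∈ Ioo a b)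
    (hW : W x = 0) (hxv : x < v) (hv : v < b) (hDv : D v = 0) {r : ℝ} (hr : r ∈ Icc x v) :
    h₁ * c / 8 * ((v ^ 2 - x ^ 2) ^ 2 - (r ^ 2 - x ^ 2) ^ 2) ≤ D r ∧
      D r ≤ h₂ * C / 8 * ((v ^ 2 - x ^ 2) ^ 2 - (r ^ 2 - x ^ 2) ^ 2) := by
  have sub : Icc x v ⊆ Ioo a b := fun r hr => ⟨hx.1.trans_le hr.1, hr.2.trans_lt hv⟩
  have hW' : ∀ r ∈ Icc x v, 0 < r ∧ h₁ * c / 2 * (r ^ 2 - x ^ 2) ≤ h r * W r ∧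
      h r * W r ≤ h₂ * C / 2 * (r ^ 2 - x ^ 2) := by
    intro r hr
    have h1 := P.W_sub_mem hx (sub hr) hr.1
    rw [hW, sub_zero] at h1
    have h2 := P.h_mem r (sub hr)
    have hx0 : 0 < x := P.left_pos.trans hx.1
    have h3 : 0 ≤ r ^ 2 - x ^ 2 := by nlinarith [hr.1]
    have h4 : 0 ≤ W r := le_trans (by have := P.c_pos; positivity) h1.1
    refine ⟨hx0.trans_le hr.1, ?_, ?_⟩
    · have := mul_le_mul h2.1 h1.1 (by have := P.c_pos; positivity) (P.h_pos.le.trans h2.1)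
      linarith
    · have := mul_le_mul h2.2 h1.2 h4 (P.h_pos.le.trans (h2.1.trans h2.2))
      linarith
  constructor
  · have : AntitoneOn (fun r => D r + h₁ * c / 8 * (r ^ 2 - x ^ 2) ^ 2) (Icc x v) := by
      refine antitoneOn_of_deriv_nonpos (convex_Icc x v)
        (fun r hr => (P.hasDerivAt_add_sq _ _ (sub hr)).continuousAt.continuousWithinAt)
        (fun r hr => (P.hasDerivAt_add_sq _ _
          (sub (interior_subset hr))).differentiableAt.differentiableWithinAt)
        fun r hr => ?_
      have hr := interior_subset hr
      rw [(P.hasDerivAt_add_sq _ _ (sub hr)).deriv]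
      exact mul_nonpos_of_nonneg_of_nonpos (hW' r hr).1.le (by linarith [(hW' r hr).2.1])
    have := this hr (right_mem_Icc.2 hxv.le) hr.2
    simp only [hDv] at this
    linarith
  · have : MonotoneOn (fun r => D r + h₂ * C / 8 * (r ^ 2 - x ^ 2) ^ 2) (Icc x v) := by
      refine monotoneOn_of_deriv_nonneg (convex_Icc x v)
        (fun r hr => (P.hasDerivAt_add_sq _ _ (sub hr)).continuousAt.continuousWithinAt)
        (fun r hr => (P.hasDerivAt_add_sq _ _
          (sub (interior_subset hr))).differentiableAt.differentiableWithinAt)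
        fun r hr => ?_
      have hr := interior_subset hr
      rw [(P.hasDerivAt_add_sq _ _ (sub hr)).deriv]
      exact mul_nonneg (hW' r hr).1.le (by linarith [(hW' r hr).2.2])
    have := this hr (right_mem_Icc.2 hxv.le) hr.2
    simp only [hDv] at this
    linarith

/-- Mirror image of `mem_right`, anchored at the zero `u`, with `-W` in the role of `W`. -/
lemma mem_left (P : WellProfile a b c C h₁ h₂ D h W W') {u x : ℝ} (hx : x ∈ Ioo a b)
    (hW : W x = 0) (hux : u < x) (hu : a < u) (hDu : D u = 0) {r : ℝ} (hr : r ∈ Icc u x) :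
    h₁ * c / 8 * ((x ^ 2 - u ^ 2) ^ 2 - (r ^ 2 - x ^ 2) ^ 2) ≤ D r ∧
      D r ≤ h₂ * C / 8 * ((x ^ 2 - u ^ 2) ^ 2 - (r ^ 2 - x ^ 2) ^ 2) := by
  have sub : Icc u x ⊆ Ioo a b := fun r hr => ⟨hu.trans_le hr.1, hr.2.trans_lt hx.2⟩
  have hW' : ∀ r ∈ Icc u x, 0 < r ∧ h₁ * c / 2 * (x ^ 2 - r ^ 2) ≤ h r * -W r ∧
      h r * -W r ≤ h₂ * C / 2 * (x ^ 2 - r ^ 2) := by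
    intro r hr
    have h1 := P.W_sub_mem (sub hr) hx hr.2
    rw [hW, zero_sub] at h1
    have h2 := P.h_mem r (sub hr)
    have hr0 : 0 < r := P.left_pos.trans (sub hr).1
    have h3 : 0 ≤ x ^ 2 - r ^ 2 := by nlinarith [hr.2]
    have h4 : 0 ≤ -W r := le_trans (by have := P.c_pos; positivity) h1.1
    refine ⟨hr0, ?_, ?_⟩
    · have := mul_le_mul h2.1 h1.1 (by have := P.c_pos; positivity) (P.h_pos.le.trans h2.1)
      linarith
    · have := mul_le_mul h2.2 h1.2 h4 (P.h_pos.le.trans (h2.1.trans h2.2))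
      linarith
  constructor
  · have : MonotoneOn (fun r => D r + h₁ * c / 8 * (r ^ 2 - x ^ 2) ^ 2) (Icc u x) := by
      refine monotoneOn_of_deriv_nonneg (convex_Icc u x)
        (fun r hr => (P.hasDerivAt_add_sq _ _ (sub hr)).continuousAt.continuousWithinAt)
        (fun r hr => (P.hasDerivAt_add_sq _ _
          (sub (interior_subset hr))).differentiableAt.differentiableWithinAt)
        fun r hr => ?_
      have hr := interior_subset hr
      rw [(P.hasDerivAt_add_sq _ _ (sub hr)).deriv]
      exact mul_nonneg (hW' r hr).1.le (by linarith [(hW' r hr).2.1])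
    have := this (left_mem_Icc.2 hux.le) hr hr.1
    simp only [hDu] at this
    linarith
  · have : AntitoneOn (fun r => D r + h₂ * C / 8 * (r ^ 2 - x ^ 2) ^ 2) (Icc u x) := by
      refine antitoneOn_of_deriv_nonpos (convex_Icc u x)
        (fun r hr => (P.hasDerivAt_add_sq _ _ (sub hr)).continuousAt.continuousWithinAt)
        (fun r hr => (P.hasDerivAt_add_sq _ _
          (sub (interior_subset hr))).differentiableAt.differentiableWithinAt)
        fun r hr => ?_
      have hr := interior_subset hr
      rw [(P.hasDerivAt_add_sq _ _ (sub hr)).deriv]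
      exact mul_nonpos_of_nonneg_of_nonpos (hW' r hr).1.le (by linarith [(hW' r hr).2.2])
    have := this (left_mem_Icc.2 hux.le) hr hr.1
    simp only [hDu] at this
    linarith

/-- Two-sided bounds for the integral of `g / √D` between the zeros of `D`. -/
lemma integral_mem (P : WellProfile a b c C h₁ h₂ D h W W') {u x v : ℝ} (hu : a < u)
    (hux : u < x) (hxv : x < v) (hv : v < b) (hW : W x = 0) (hDu : D u = 0) (hDv : D v = 0)
    {g₁ g₂ : ℝ} {g f : ℝ → ℝ} (hg₁ : 0 < g₁)
    (hg : ∀ r ∈ Ioo u v, g₁ * r ≤ g r ∧ g r ≤ g₂ * r)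
    (hf : ∀ r ∈ Ioo u v, f r = g r / √(D r)) (hcont : ContinuousOn f (Ioo u v)) :
    IntervalIntegrable f volume u v ∧
      g₁ / √(h₂ * C / 8) * (Real.pi / 2) ≤ ∫ r in u..v, f r ∧
      ∫ r in u..v, f r ≤ g₂ / √(h₁ * c / 8) * (Real.pi / 2) := by
  have hx : x ∈ Ioo a b := ⟨hu.trans hux, hxv.trans hv⟩
  have hu0 : 0 < u := P.left_pos.trans hu
  have hx0 : 0 < x := hu0.trans hux
  have hc := P.c_pos
  have hh := P.h_pos
  have hC := hc.trans_le P.c_le_C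
  have hh2 := hh.trans_le P.h₁_le_h₂
  have d1 : 0 < x ^ 2 - u ^ 2 := by nlinarith
  have d2 : 0 < v ^ 2 - x ^ 2 := by nlinarith
  have s1 : Ioo u x ⊆ Ioo u v := Ioo_subset_Ioo_right hxv.le
  have s2 : Ioo x v ⊆ Ioo u v := Ioo_subset_Ioo_left hux.le
  -- The two halves are compared with different half-widths, `x² - u²` and `v² - x²`; each
  -- contributes `π/4`, so the asymmetry of the well is irrelevant.
  obtain ⟨i1, l1, r1⟩ := intervalIntegral_div_sqrt_mem (s := x ^ 2) (c₁ := h₁ * c / 8)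
    (c₂ := h₂ * C / 8) hu0.le hux.le d1 (by linarith) (by linarith) (by positivity)
    (by positivity) hg₁
    (fun r hr => (P.mem_left hx hW hux hu hDu (Ioo_subset_Icc_self hr)).1)
    (fun r hr => (P.mem_left hx hW hux hu hDu (Ioo_subset_Icc_self hr)).2)
    (fun r hr => hg r (s1 hr)) (fun r hr => hf r (s1 hr)) (hcont.mono s1)
  obtain ⟨i2, l2, r2⟩ := intervalIntegral_div_sqrt_mem (s := x ^ 2) (c₁ := h₁ * c / 8)
    (c₂ := h₂ * C / 8) hx0.le hxv.le d2 (by linarith) (by linarith) (by positivity)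
    (by positivity) hg₁
    (fun r hr => (P.mem_right hx hW hxv hv hDv (Ioo_subset_Icc_self hr)).1)
    (fun r hr => (P.mem_right hx hW hxv hv hDv (Ioo_subset_Icc_self hr)).2)
    (fun r hr => hg r (s2 hr)) (fun r hr => hf r (s2 hr)) (hcont.mono s2)
  have e1 : (u ^ 2 - x ^ 2) / (x ^ 2 - u ^ 2) = -1 := by
    rw [div_eq_iff d1.ne']; ring
  rw [e1, sub_self, zero_div, Real.arcsin_zero, Real.arcsin_neg_one] at l1 r1
  rw [div_self d2.ne', sub_self, zero_div, Real.arcsin_zero, Real.arcsin_one] at l2 r2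
  rw [← intervalIntegral.integral_add_adjacent_intervals i1 i2]
  exact ⟨i1.trans i2, by linarith, by linarith⟩

end WellProfile

/-! ### Wells of the effective potential and the period function -/

namespace StaticData

variable (S : StaticData)

lemma effPot_pos {L : ℝ} (hL : 0 < L) (r : ℝ) : 0 < S.effPot L r := by
  unfold effPot; positivity

lemma effPot_sq {L : ℝ} (hL : 0 < L) (r : ℝ) :
    S.effPot L r ^ 2 = Real.exp (S.μ r) ^ 2 * (1 + L / r ^ 2) := by
  unfold effPot
  rw [mul_pow, Real.sq_sqrt (by positivity)]

lemma effPot_differentiableAt {L r : ℝ} (hL : 0 < L) (hr : r ≠ 0)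
    (hμ : DifferentiableAt ℝ S.μ r) : DifferentiableAt ℝ (S.effPot L) r := by
  have h1 : 1 + L / r ^ 2 ≠ 0 := by positivity
  have h2 : r ^ 2 ≠ 0 := pow_ne_zero 2 hr
  unfold effPot
  have h3 : DifferentiableAt ℝ (fun r : ℝ => L / r ^ 2) r :=
    (differentiableAt_const L).fun_div (differentiableAt_pow 2) h2
  exact hμ.exp.mul ((h3.const_add 1).sqrt h1)

lemma effPot_continuousOn {L a b : ℝ} (ha : 0 < a) (hμ : ContinuousOn S.μ (Icc a b)) :
    ContinuousOn (S.effPot L) (Icc a b) := by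
  have h0 : ∀ r ∈ Icc a b, r ^ 2 ≠ 0 := fun r hr => pow_ne_zero 2 (ha.trans_le hr.1).ne'
  unfold effPot
  exact hμ.rexp.mul ((continuousOn_const.add
    (continuousOn_const.div (continuousOn_id.pow 2) h0)).sqrt)

/-- A well of `Ψ_L` on `[a, b]` such that, for all admissible energies, a positive multiple of
`E² - Ψ_L²` has a quadratic maximum with uniform constants. -/
structure IsWell (L a b c C h₁ h₂ g₁ g₂ : ℝ) : Prop where
  left_pos : 0 < a
  lt : a < b
  mem_iff : ∀ r, r ∈ S.wellSet L ↔ r ∈ Ioo a b ∧ S.effPot L r < S.E₀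
  le_left : S.E₀ ≤ S.effPot L a
  le_right : S.E₀ ≤ S.effPot L b
  μ_cont : ContinuousOn S.μ (Icc a b)
  lam_cont : ContinuousOn S.lam (Icc a b)
  μ_diff : ∀ r ∈ Ioo a b, DifferentiableAt ℝ S.μ r
  profile : ∀ E, E < S.E₀ → (∃ r ∈ Ioo a b, S.effPot L r ≤ E) →
    ∃ k h W W' : ℝ → ℝ, (∀ r ∈ Icc a b, 0 < k r) ∧
      (∀ r ∈ Ioo a b, DifferentiableAt ℝ k r) ∧
      WellProfile a b c C h₁ h₂ (fun r => k r * (E ^ 2 - S.effPot L r ^ 2)) h W W' ∧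
      ∀ r ∈ Ioo a b, g₁ * r ≤ Real.exp (S.lam r - S.μ r) * E * √(k r) ∧
        Real.exp (S.lam r - S.μ r) * E * √(k r) ≤ g₂ * r

variable {S} {L a b c C h₁ h₂ g₁ g₂ : ℝ}

/-- A critical point inside the well is a strict minimum of the effective potential. -/
lemma IsWell.effPot_lt (w : S.IsWell L a b c C h₁ h₂ g₁ g₂) (hL : 0 < L) {x y : ℝ}
    (hx : x ∈ S.wellSet L) (hd : HasDerivAt (S.effPot L) 0 x) (hy : y ∈ S.wellSet L)
    (hxy : y ≠ x) : S.effPot L x < S.effPot L y := by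
  obtain ⟨hxI, hxE⟩ := (w.mem_iff x).1 hx
  obtain ⟨hyI, -⟩ := (w.mem_iff y).1 hy
  -- The profile is taken at the energy `E = Ψ_L(x)`: then `E² - Ψ_L²` and its derivative both
  -- vanish at `x`, so `x` is critical for the weighted function too, whatever the derivative of
  -- `k`.
  obtain ⟨k, h, W, W', hk, hkd, P, -⟩ := w.profile _ hxE ⟨x, hxI, le_rfl⟩
  have hD : HasDerivAt (fun r => k r * (S.effPot L x ^ 2 - S.effPot L r ^ 2)) 0 x := by
    refine ((hkd x hxI).hasDerivAt.fun_mul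
      ((hasDerivAt_const x (S.effPot L x ^ 2)).fun_sub (hd.fun_pow 2))).congr_deriv ?_
    simp
  have h1 := P.lt_of_ne hxI (P.W_eq_zero hxI hD) (Ioo_subset_Icc_self hyI) hxy
  simp only [sub_self, mul_zero] at h1
  have h2 : S.effPot L x ^ 2 - S.effPot L y ^ 2 < 0 := by
    by_contra! hcon
    exact absurd (mul_nonneg (hk y (Ioo_subset_Icc_self hyI)).le hcon) (not_le.2 h1)
  exact lt_of_pow_lt_pow_left₀ 2 (S.effPot_pos hL y).le (by linarith)

/-- The minimum of `Ψ_L` over `[a, b]` lies below `E₀`, hence in the interior. Two critical points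
in the well would each have a strictly smaller value than the other. -/
lemma IsWell.existsUnique_crit (w : S.IsWell L a b c C h₁ h₂ g₁ g₂) (hL : 0 < L)
    (hne : (S.wellSet L).Nonempty) :
    ∃! r : ℝ, r ∈ S.wellSet L ∧ HasDerivAt (S.effPot L) 0 r := by
  obtain ⟨y, hy⟩ := hne
  obtain ⟨hyI, hyE⟩ := (w.mem_iff y).1 hy
  obtain ⟨x, hxI, hmin⟩ := isCompact_Icc.exists_isMinOn (nonempty_Icc.2 w.lt.le)
    (S.effPot_continuousOn (L := L) w.left_pos w.μ_cont)
  have hxE : S.effPot L x < S.E₀ := (hmin (Ioo_subset_Icc_self hyI)).trans_lt hyE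
  have hx : x ∈ Ioo a b := by
    refine ⟨lt_of_le_of_ne hxI.1 ?_, lt_of_le_of_ne hxI.2 ?_⟩
    · rintro rfl; exact absurd w.le_left (not_le.2 hxE)
    · rintro rfl; exact absurd w.le_right (not_le.2 hxE)
  have hdiff := (S.effPot_differentiableAt hL (w.left_pos.trans hx.1).ne' (w.μ_diff x hx)).hasDerivAt
  have hd : HasDerivAt (S.effPot L) 0 x := by
    have := (hmin.isLocalMin (Icc_mem_nhds hx.1 hx.2)).hasDerivAt_eq_zero hdiff
    rwa [this] at hdiff
  have hxw := (w.mem_iff x).2 ⟨hx, hxE⟩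
  refine ⟨x, ⟨hxw, hd⟩, ?_⟩
  rintro z ⟨hz, hzd⟩
  by_contra hne
  exact lt_asymm (w.effPot_lt hL hxw hd hz hne) (w.effPot_lt hL hz hzd hxw (Ne.symm hne))

lemma IsWell.rCrit_mem (w : S.IsWell L a b c C h₁ h₂ g₁ g₂) (hL : 0 < L)
    (hne : (S.wellSet L).Nonempty) : S.rCrit L ∈ S.wellSet L := by
  obtain ⟨x, hx, huniq⟩ := w.existsUnique_crit hL hne
  have : {r | r ∈ S.wellSet L ∧ HasDerivAt (S.effPot L) 0 r} = {x} := by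
    ext r
    exact ⟨fun h => huniq r h, fun h => by rw [mem_singleton_iff.1 h]; exact hx⟩
  unfold rCrit
  rw [this, csInf_singleton]
  exact hx.1

/-- The turning points exist uniquely, and the period integral converges and is bounded in terms
of the constants of the well. -/
lemma IsWell.period_mem (w : S.IsWell L a b c C h₁ h₂ g₁ g₂) (hL : 0 < L) (hg₁ : 0 < g₁)
    (hne : (S.wellSet L).Nonempty) {E : ℝ} (hE : E < S.E₀)
    (hcrit : S.effPot L (S.rCrit L) < E) :
    ((∃! r : ℝ, r ∈ S.innerTurning E L) ∧ (∃! r : ℝ, r ∈ S.outerTurning E L) ∧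
      IntervalIntegrable (S.periodIntegrand E L) volume (S.rMinus E L) (S.rPlus E L)) ∧
    g₁ / √(h₂ * C / 8) * Real.pi ≤ S.period E L ∧
      S.period E L ≤ g₂ / √(h₁ * c / 8) * Real.pi := by
  set x := S.rCrit L with hxdef
  have hxw : x ∈ S.wellSet L := w.rCrit_mem hL hne
  obtain ⟨hx, -⟩ := (w.mem_iff x).1 hxw
  obtain ⟨k, h, W, W', hk, hkd, P, hwt⟩ := w.profile E hE ⟨x, hx, hcrit.le⟩
  have hE0 : 0 < E := (S.effPot_pos hL x).trans hcrit
  have pos_iff : ∀ r ∈ Icc a b,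
      0 < k r * (E ^ 2 - S.effPot L r ^ 2) ↔ S.effPot L r < E := by
    intro r hr
    rw [mul_pos_iff_of_pos_left (hk r hr), sub_pos]
    exact pow_lt_pow_iff_left₀ (S.effPot_pos hL r).le hE0.le two_ne_zero
  have zero_iff : ∀ r ∈ Icc a b,
      k r * (E ^ 2 - S.effPot L r ^ 2) = 0 ↔ S.effPot L r = E := by
    intro r hr
    rw [mul_eq_zero, or_iff_right (hk r hr).ne', sub_eq_zero, eq_comm]
    exact pow_left_inj₀ (S.effPot_pos hL r).le hE0.le two_ne_zero
  have neg_of : ∀ r ∈ Icc a b, S.E₀ ≤ S.effPot L r →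
      k r * (E ^ 2 - S.effPot L r ^ 2) < 0 := by
    intro r hr hle
    refine mul_neg_of_pos_of_neg (hk r hr) (sub_neg.2 ?_)
    exact pow_lt_pow_left₀ (hE.trans_le hle) hE0.le two_ne_zero
  have hla := left_mem_Icc.2 w.lt.le
  have hrb := right_mem_Icc.2 w.lt.le
  -- The point `z` maximises `k (E² - Ψ_L²)` and need not equal `rCrit`, because `k` need not be
  -- constant. Inner and outer turning points are told apart only through `u < rCrit < v`, which
  -- follows from positivity at `rCrit`.
  obtain ⟨u, z, v, hau, huz, hzv, hvb, hWz, hDu, hDv, hux, hxv, hiff, hzero⟩ :=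
    P.exists_zeros (neg_of a hla w.le_left) (neg_of b hrb w.le_right) hx
      ((pos_iff x (Ioo_subset_Icc_self hx)).2 hcrit)
  have huI : u ∈ Ioo a b := ⟨hau, hux.trans hx.2⟩
  have hvI : v ∈ Ioo a b := ⟨hx.1.trans hxv, hvb⟩
  have hΨu := (zero_iff u (Ioo_subset_Icc_self huI)).1 hDu
  have hΨv := (zero_iff v (Ioo_subset_Icc_self hvI)).1 hDv
  have hin : S.innerTurning E L = {u} := by
    ext r
    constructor
    · rintro ⟨hr, hrx, hrE⟩
      have hrI := Ioo_subset_Icc_self ((w.mem_iff r).1 hr).1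
      rcases hzero r hrI ((zero_iff r hrI).2 hrE) with rfl | rfl
      · rfl
      · exact absurd hrx (not_lt.2 hxv.le)
    · rintro rfl
      exact ⟨(w.mem_iff _).2 ⟨huI, hΨu ▸ hE⟩, hux, hΨu⟩
  have hout : S.outerTurning E L = {v} := by
    ext r
    constructor
    · rintro ⟨hr, hrx, hrE⟩
      have hrI := Ioo_subset_Icc_self ((w.mem_iff r).1 hr).1
      rcases hzero r hrI ((zero_iff r hrI).2 hrE) with rfl | rfl
      · exact absurd hrx (not_lt.2 hux.le)
      · rfl
    · rintro rfl
      exact ⟨(w.mem_iff _).2 ⟨hvI, hΨv ▸ hE⟩, hxv, hΨv⟩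
  have hm : S.rMinus E L = u := by unfold rMinus; rw [hin, csInf_singleton]
  have hp : S.rPlus E L = v := by unfold rPlus; rw [hout, csInf_singleton]
  have sub : Ioo u v ⊆ Ioo a b := fun r hr => ⟨hau.trans hr.1, hr.2.trans hvb⟩
  -- The factor `√k` cancels, so the weight costs nothing in the period integral.
  have hf : ∀ r ∈ Ioo u v, S.periodIntegrand E L r =
      (Real.exp (S.lam r - S.μ r) * E * √(k r)) / √(k r * (E ^ 2 - S.effPot L r ^ 2)) := by
    intro r hr
    have hkr := hk r (Ioo_subset_Icc_self (sub hr))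
    have h1 := Real.sqrt_pos.2 hkr
    unfold periodIntegrand
    rw [Real.sqrt_mul hkr.le]
    rw [mul_comm (√(k r)) (√(E ^ 2 - S.effPot L r ^ 2)), mul_div_mul_right _ _ h1.ne',
      mul_div_assoc]
  have hcont : ContinuousOn (S.periodIntegrand E L) (Ioo u v) := by
    have hΨ := (S.effPot_continuousOn (L := L) w.left_pos w.μ_cont).mono
      (sub.trans Ioo_subset_Icc_self)
    have hμ := w.μ_cont.mono (sub.trans Ioo_subset_Icc_self)
    have hl := w.lam_cont.mono (sub.trans Ioo_subset_Icc_self)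
    unfold periodIntegrand
    refine (hl.sub hμ).rexp.mul (continuousOn_const.div
      (continuousOn_const.sub (hΨ.pow 2)).sqrt fun r hr => ?_)
    have hrI := Ioo_subset_Icc_self (sub hr)
    have h1 := (hiff r hrI).2 hr
    exact (Real.sqrt_pos.2 (pos_of_mul_pos_right h1 (hk r hrI).le)).ne'
  obtain ⟨hi, hlo, hup⟩ := P.integral_mem hau huz hzv hvb hWz hDu hDv hg₁
    (fun r hr => hwt r (sub hr)) hf hcont
  unfold period
  rw [hin, hout, hm, hp]
  refine ⟨⟨⟨u, rfl, fun _ h => h⟩, ⟨v, rfl, fun _ h => h⟩, hi⟩, by linarith, by linarith⟩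

/-- A static state all of whose wells have uniform constants has single-well structure, and its
period function is well defined, bounded and bounded away from zero. -/
theorem conclusion_of_isWell (S : StaticData) (c C h₁ h₂ g₁ g₂ : ℝ) (hC : 0 < C) (hh₂ : 0 < h₂)
    (hg₁ : 0 < g₁)
    (hact : ∀ E L : ℝ, (E, L) ∈ S.actionSet → S.L₀ ≤ L ∧ E < S.E₀ ∧ (S.wellSet L).Nonempty)
    (hwell : ∀ L : ℝ, 0 < L → S.L₀ ≤ L → (S.wellSet L).Nonempty →
      ∃ a b : ℝ, S.IsWell L a b c C h₁ h₂ g₁ g₂) :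
    S.SingleWell ∧ S.PeriodWellDefined ∧ S.PeriodBounded := by
  have key : ∀ E L : ℝ, (E, L) ∈ S.actionSet → 0 < L ∧ S.effPot L (S.rCrit L) < E := by
    rintro E L ⟨r, w, L', -, hL, hE, heq⟩
    obtain ⟨rfl, rfl⟩ := Prod.mk.inj heq
    exact ⟨hL, hE⟩
  have main : ∀ E L : ℝ, (E, L) ∈ S.actionSet →
      ((∃! r : ℝ, r ∈ S.innerTurning E L) ∧ (∃! r : ℝ, r ∈ S.outerTurning E L) ∧
        IntervalIntegrable (S.periodIntegrand E L) volume (S.rMinus E L) (S.rPlus E L)) ∧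
      g₁ / √(h₂ * C / 8) * Real.pi ≤ S.period E L ∧
        S.period E L ≤ g₂ / √(h₁ * c / 8) * Real.pi := by
    intro E L h
    obtain ⟨hL, hcrit⟩ := key E L h
    obtain ⟨hL₀, hE, hne⟩ := hact E L h
    obtain ⟨a, b, w⟩ := hwell L hL hL₀ hne
    exact w.period_mem hL hg₁ hne hE hcrit
  refine ⟨fun L hL hL₀ hne => ?_, fun E L h => (main E L h).1,
    g₁ / √(h₂ * C / 8) * Real.pi, g₂ / √(h₁ * c / 8) * Real.pi, by positivity,
    fun E L h => (main E L h).2⟩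
  obtain ⟨a, b, w⟩ := hwell L hL hL₀ hne
  exact w.existsUnique_crit hL hne

end StaticData

/-! ### Moments of the positive part of a quadratic function -/

/-- `∫₀¹ θ(α) (A (1 - α)² - B)₊^q dα`. -/
noncomputable def powerMoment (θ : ℝ → ℝ) (q A B : ℝ) : ℝ :=
  ∫ α in (0 : ℝ)..1, θ α * max (A * (1 - α) ^ 2 - B) 0 ^ q

lemma continuous_posPart_rpow {q : ℝ} (hq : 0 ≤ q) (A B : ℝ) :
    Continuous fun α : ℝ => max (A * (1 - α) ^ 2 - B) 0 ^ q :=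
  ((by fun_prop : Continuous fun α : ℝ => max (A * (1 - α) ^ 2 - B) 0)).rpow_const
    fun _ => Or.inr hq

lemma intervalIntegrable_powerMoment {θ : ℝ → ℝ} (hθ : IntervalIntegrable θ volume 0 1) {q : ℝ}
    (hq : 0 ≤ q) (A B : ℝ) :
    IntervalIntegrable (fun α => θ α * max (A * (1 - α) ^ 2 - B) 0 ^ q) volume 0 1 :=
  hθ.mul_continuousOn (continuous_posPart_rpow hq A B).continuousOn

lemma posPart_le {A B α : ℝ} (hA : 0 ≤ A) (hB : 0 ≤ B) (hα : α ∈ Icc (0 : ℝ) 1) :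
    max (A * (1 - α) ^ 2 - B) 0 ≤ A := by
  refine max_le ?_ hA
  have : (1 - α) ^ 2 ≤ 1 := by nlinarith [hα.1, hα.2]
  nlinarith

lemma abs_powerMoment_le {θ : ℝ → ℝ} (hθ : IntervalIntegrable θ volume 0 1) {q A B : ℝ}
    (hq : 0 ≤ q) (hA : 0 ≤ A) (hB : 0 ≤ B) :
    |powerMoment θ q A B| ≤ A ^ q * ∫ α in (0 : ℝ)..1, |θ α| := by
  unfold powerMoment
  rw [← intervalIntegral.integral_const_mul]
  refine (intervalIntegral.abs_integral_le_integral_abs zero_le_one).trans ?_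
  refine intervalIntegral.integral_mono_on zero_le_one
    (intervalIntegrable_powerMoment hθ hq A B).abs (hθ.abs.const_mul _) fun α hα => ?_
  rw [abs_mul, mul_comm, abs_of_nonneg (Real.rpow_nonneg (le_max_right _ _) _)]
  exact mul_le_mul_of_nonneg_right
    (Real.rpow_le_rpow (le_max_right _ _) (posPart_le hA hB hα) hq) (abs_nonneg _)

lemma powerMoment_nonneg {θ : ℝ → ℝ} (hθ : ∀ α, 0 ≤ θ α) (q A B : ℝ) :
    0 ≤ powerMoment θ q A B :=
  intervalIntegral.integral_nonneg zero_le_one fun α _ =>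
    mul_nonneg (hθ α) (Real.rpow_nonneg (le_max_right _ _) _)

lemma powerMoment_eq_zero (θ : ℝ → ℝ) {q A B : ℝ} (hq : q ≠ 0) (hA : 0 ≤ A) (hAB : A ≤ B) :
    powerMoment θ q A B = 0 := by
  unfold powerMoment
  rw [intervalIntegral.integral_of_le zero_le_one]
  refine setIntegral_eq_zero_of_forall_eq_zero fun α hα => ?_
  have : A * (1 - α) ^ 2 - B ≤ 0 := by
    have : (1 - α) ^ 2 ≤ 1 := by nlinarith [hα.1, hα.2]
    nlinarith
  rw [max_eq_right this, Real.zero_rpow hq, mul_zero]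

lemma powerMoment_pos {θ : ℝ → ℝ} (hθ : IntervalIntegrable θ volume 0 1) (hnn : ∀ α, 0 ≤ θ α)
    {α₀ : ℝ} (hα₀ : 0 < α₀) (hpos : ∀ α ∈ Ioo 0 α₀, 0 < θ α) {q A B : ℝ} (hq : 0 ≤ q)
    (hA : 0 < A) (hAB : B < A) : 0 < powerMoment θ q A B := by
  have hi := intervalIntegrable_powerMoment hθ hq A B
  unfold powerMoment
  rw [intervalIntegral.integral_of_le zero_le_one]
  rw [intervalIntegrable_iff_integrableOn_Ioc_of_le zero_le_one] at hi
  rw [setIntegral_pos_iff_support_of_nonneg_ae (Filter.Eventually.of_forall fun α =>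
    mul_nonneg (hnn α) (Real.rpow_nonneg (le_max_right _ _) _)) hi]
  -- Since `(1 - α)² ≥ 1 - 2α`, the base `A (1 - α)² - B` is positive for `α < (A - B) / (2A)`.
  set ε := min (min α₀ 1) ((A - B) / (2 * A)) with hε
  have hε0 : 0 < ε := by
    refine lt_min (lt_min hα₀ one_pos) (div_pos (by linarith) (by linarith))
  have hsub : Ioo 0 ε ⊆ Function.support (fun α => θ α * max (A * (1 - α) ^ 2 - B) 0 ^ q) ∩
      Ioc 0 1 := by
    intro α hα
    have h1 : ε ≤ α₀ := (min_le_left _ _).trans (min_le_left _ _)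
    have h2 : ε ≤ 1 := (min_le_left _ _).trans (min_le_right _ _)
    have h3 : α < (A - B) / (2 * A) := hα.2.trans_le (min_le_right _ _)
    rw [lt_div_iff₀ (by linarith)] at h3
    have h4 : 0 < A * (1 - α) ^ 2 - B := by nlinarith [mul_pos hA (pow_pos hα.1 2)]
    refine ⟨?_, hα.1, hα.2.le.trans h2⟩
    rw [Function.mem_support, max_eq_left h4.le]
    exact (mul_pos (hpos α ⟨hα.1, hα.2.trans_le h1⟩) (Real.rpow_pos_of_pos h4 q)).ne'
  refine lt_of_lt_of_le ?_ (measure_mono hsub)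
  rw [Real.volume_Ioo]
  simpa using hε0

/-- With the positive part on a fixed interval the parameters enter only the integrand, so dominated
convergence suffices and no moving end point has to be treated. -/
lemma continuousAt_powerMoment {θ : ℝ → ℝ} (hθ : IntervalIntegrable θ volume 0 1) {q : ℝ}
    (hq : 0 ≤ q) {A B : ℝ → ℝ} {r : ℝ} (hA : ContinuousAt A r) (hB : ContinuousAt B r) :
    ContinuousAt (fun x => powerMoment θ q (A x) (B x)) r := by
  unfold powerMoment
  have hb : ∀ᶠ x in nhds r, |A x| < |A r| + 1 ∧ |B x| < |B r| + 1 :=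
    (hA.abs.eventually_lt_const (by simp)).and (hB.abs.eventually_lt_const (by simp))
  refine intervalIntegral.continuousAt_of_dominated_interval
    (bound := fun α => |θ α| * (|A r| + 1 + (|B r| + 1)) ^ q) ?_ ?_ ?_ ?_
  · exact Filter.Eventually.of_forall fun x => by
      have := (intervalIntegrable_powerMoment hθ hq (A x) (B x)).aestronglyMeasurable
      rwa [uIoc_of_le zero_le_one]
  · filter_upwards [hb] with x hx
    refine Filter.Eventually.of_forall fun α hα => ?_
    rw [uIoc_of_le zero_le_one] at hα
    rw [norm_mul, Real.norm_eq_abs, Real.norm_of_nonneg (Real.rpow_nonneg (le_max_right _ _) _)]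
    refine mul_le_mul_of_nonneg_left (Real.rpow_le_rpow (le_max_right _ _) ?_ hq) (abs_nonneg _)
    refine max_le ?_ (by positivity)
    have : (1 - α) ^ 2 ≤ 1 := by nlinarith [hα.1, hα.2]
    have h1 : A x * (1 - α) ^ 2 ≤ |A x| * 1 :=
      mul_le_mul (le_abs_self _) this (sq_nonneg _) (abs_nonneg _)
    linarith [neg_abs_le (B x), hx.1, hx.2]
  · exact hθ.abs.mul_const _
  · refine Filter.Eventually.of_forall fun α _ => ?_
    exact continuousAt_const.mul ((((hA.mul continuousAt_const).sub hB).max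
      continuousAt_const).rpow_const (Or.inr hq))

lemma hasDerivAt_max_rpow {q : ℝ} (hq : 1 < q) (x : ℝ) :
    HasDerivAt (fun x : ℝ => max x 0 ^ q) (q * max x 0 ^ (q - 1)) x := by
  have hq0 : q ≠ 0 := by positivity
  rcases lt_trichotomy x 0 with hx | rfl | hx
  · rw [max_eq_right hx.le, Real.zero_rpow (by linarith), mul_zero]
    refine (hasDerivAt_const x (0 : ℝ)).congr_of_eventuallyEq ?_
    filter_upwards [Iio_mem_nhds hx] with y hy
    rw [max_eq_right (le_of_lt hy), Real.zero_rpow hq0]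
  · rw [max_self, Real.zero_rpow (by linarith), mul_zero, ← hasDerivWithinAt_univ,
      ← Iic_union_Ici (a := (0 : ℝ))]
    refine HasDerivWithinAt.union ?_ ?_
    · refine (hasDerivWithinAt_const (0 : ℝ) (Iic 0) (0 : ℝ)).congr ?_ ?_
      · intro y hy
        rw [max_eq_right hy, Real.zero_rpow hq0]
      · rw [max_self, Real.zero_rpow hq0]
    · have h := (Real.hasDerivAt_rpow_const (x := 0) (p := q) (Or.inr hq.le)).hasDerivWithinAt
        (s := Ici 0)
      rw [Real.zero_rpow (by linarith), mul_zero] at h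
      refine h.congr ?_ ?_
      · intro y hy
        rw [max_eq_left hy]
      · rw [max_self]
  · rw [max_eq_left hx.le]
    refine (Real.hasDerivAt_rpow_const (Or.inl hx.ne')).congr_of_eventuallyEq ?_
    filter_upwards [Ioi_mem_nhds hx] with y hy
    rw [max_eq_left (le_of_lt hy)]

/-- For `q > 1` the function `x₊^q` is `C¹`, so one may differentiate under the integral; the weight
`θ` need only be integrable. The inner derivative of `A (1 - α)² - B` produces the weight `θ (1 -
α)²`, which is the one in the density. -/
lemma hasDerivAt_powerMoment {θ : ℝ → ℝ} (hθ : IntervalIntegrable θ volume 0 1) {q : ℝ}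
    (hq : 1 < q) {A B A' B' : ℝ → ℝ} {r : ℝ} (hA : ∀ᶠ x in nhds r, HasDerivAt A (A' x) x)
    (hB : ∀ᶠ x in nhds r, HasDerivAt B (B' x) x) (hA' : ContinuousAt A' r)
    (hB' : ContinuousAt B' r) :
    HasDerivAt (fun x => powerMoment θ q (A x) (B x))
      (q * (A' r * powerMoment (fun α => θ α * (1 - α) ^ 2) (q - 1) (A r) (B r) -
        B' r * powerMoment θ (q - 1) (A r) (B r))) r := by
  have hAc : ContinuousAt A r := hA.self_of_nhds.continuousAt
  have hBc : ContinuousAt B r := hB.self_of_nhds.continuousAt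
  have hq0 : 0 ≤ q := by linarith
  have hq1 : 0 ≤ q - 1 := by linarith
  have hb : ∀ᶠ x in nhds r, HasDerivAt A (A' x) x ∧ HasDerivAt B (B' x) x ∧
      (|A x| < |A r| + 1 ∧ |B x| < |B r| + 1) ∧ (|A' x| < |A' r| + 1 ∧ |B' x| < |B' r| + 1) :=
    hA.and <| hB.and <|
      ((hAc.abs.eventually_lt_const (by simp)).and (hBc.abs.eventually_lt_const (by simp))).and <|
      (hA'.abs.eventually_lt_const (by simp)).and (hB'.abs.eventually_lt_const (by simp))
  -- On this neighbourhood `A`, `B` and their derivatives exceed their values at `r` by at most `1`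
  -- in modulus, which gives a dominating function independent of `x`.
  set s := {x | HasDerivAt A (A' x) x ∧ HasDerivAt B (B' x) x ∧
      (|A x| < |A r| + 1 ∧ |B x| < |B r| + 1) ∧ (|A' x| < |A' r| + 1 ∧ |B' x| < |B' r| + 1)}
    with hs
  have hθ2 : IntervalIntegrable (fun α => θ α * (1 - α) ^ 2) volume 0 1 :=
    hθ.mul_continuousOn (by fun_prop)
  have key := intervalIntegral.hasDerivAt_integral_of_dominated_loc_of_deriv_le
    (μ := volume) (a := 0) (b := 1) (s := s) (x₀ := r)
    (F := fun x α => θ α * max (A x * (1 - α) ^ 2 - B x) 0 ^ q)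
    (F' := fun x α => θ α * (q * max (A x * (1 - α) ^ 2 - B x) 0 ^ (q - 1) *
      (A' x * (1 - α) ^ 2 - B' x)))
    (bound := fun α => |θ α| * (q * (|A r| + 1 + (|B r| + 1)) ^ (q - 1) *
      (|A' r| + 1 + (|B' r| + 1)))) hb ?_ ?_ ?_ ?_ ?_ ?_
  · have h2 := key.2
    unfold powerMoment
    refine h2.congr_deriv ?_
    rw [← intervalIntegral.integral_const_mul, ← intervalIntegral.integral_const_mul,
      ← intervalIntegral.integral_sub, ← intervalIntegral.integral_const_mul]
    · refine intervalIntegral.integral_congr fun α _ => ?_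
      ring
    · exact (intervalIntegrable_powerMoment hθ2 hq1 _ _).const_mul _
    · exact (intervalIntegrable_powerMoment hθ hq1 _ _).const_mul _
  · exact Filter.Eventually.of_forall fun x => by
      have := (intervalIntegrable_powerMoment hθ hq0 (A x) (B x)).aestronglyMeasurable
      rwa [uIoc_of_le zero_le_one]
  · exact intervalIntegrable_powerMoment hθ hq0 _ _
  · have : IntervalIntegrable (fun α => θ α * (q * max (A r * (1 - α) ^ 2 - B r) 0 ^ (q - 1) *
      (A' r * (1 - α) ^ 2 - B' r))) volume 0 1 := by
      refine hθ.mul_continuousOn (Continuous.continuousOn ?_)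
      exact (continuous_const.mul (continuous_posPart_rpow hq1 _ _)).mul (by fun_prop)
    rw [uIoc_of_le zero_le_one]
    exact this.aestronglyMeasurable
  · refine Filter.Eventually.of_forall fun α hα x hx => ?_
    rw [uIoc_of_le zero_le_one] at hα
    obtain ⟨-, -, ⟨h1, h2⟩, h3, h4⟩ := hx
    have h5 : (1 - α) ^ 2 ≤ 1 := by nlinarith [hα.1, hα.2]
    rw [norm_mul, norm_mul, norm_mul, Real.norm_eq_abs, Real.norm_of_nonneg hq0,
      Real.norm_of_nonneg (Real.rpow_nonneg (le_max_right _ _) _), Real.norm_eq_abs]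
    refine mul_le_mul_of_nonneg_left ?_ (abs_nonneg _)
    refine mul_le_mul ?_ ?_ (abs_nonneg _) (by positivity)
    · refine mul_le_mul_of_nonneg_left (Real.rpow_le_rpow (le_max_right _ _) ?_ hq1) hq0
      refine max_le ?_ (by positivity)
      have h1 : A x * (1 - α) ^ 2 ≤ |A x| * 1 :=
        mul_le_mul (le_abs_self _) h5 (sq_nonneg _) (abs_nonneg _)
      linarith [neg_abs_le (B x)]
    · refine (abs_sub _ _).trans ?_
      rw [abs_mul, abs_of_nonneg (sq_nonneg (1 - α))]
      have h1 : |A' x| * (1 - α) ^ 2 ≤ |A' x| * 1 :=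
        mul_le_mul_of_nonneg_left h5 (abs_nonneg _)
      linarith
  · exact hθ.abs.mul_const _
  · refine Filter.Eventually.of_forall fun α _ x hx => ?_
    exact (((hasDerivAt_max_rpow hq _).comp x
      ((hx.1.mul_const _).fun_sub hx.2.1)).const_mul (θ α))

/-! ### The ansatz functions as moments -/

lemma BasicAnsatz.intervalIntegrable {Φ : ℝ → ℝ} (h : BasicAnsatz Φ) :
    IntervalIntegrable Φ volume 0 1 := by
  rw [intervalIntegrable_iff_integrableOn_Ioc_of_le zero_le_one]
  have h1 : IntegrableOn Φ (Icc (-1) 1) volume := (h.locBounded 1).integrable le_top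
  exact h1.mono_set fun x hx => ⟨by linarith [hx.1], hx.2⟩

lemma BasicAnsatz.intervalIntegrable_mul_sq {Φ : ℝ → ℝ} (h : BasicAnsatz Φ) :
    IntervalIntegrable (fun α => Φ α * (1 - α) ^ 2) volume 0 1 :=
  h.intervalIntegrable.mul_continuousOn (by fun_prop)

lemma exp_neg_mul_sqrt_lt_one_iff {y B : ℝ} (hB : 0 ≤ B) :
    Real.exp (-y) * √B < 1 ↔ B < Real.exp (2 * y) := by
  rw [Real.exp_neg, inv_mul_lt_one₀ (Real.exp_pos y), Real.sqrt_lt hB (Real.exp_pos y).le, two_mul,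
    Real.exp_add, sq]

/-- The upper limit `1 - e^(-y) √B` is exactly where `e^(2y) (1 - α)² = B`; beyond it the positive
part vanishes. -/
lemma integral_eq_powerMoment {θ : ℝ → ℝ} (hθ : IntervalIntegrable θ volume 0 1) {q y B : ℝ}
    (hq : 0 < q) (hB : 0 ≤ B) (hlt : Real.exp (-y) * √B < 1) :
    ∫ α in (0 : ℝ)..(1 - Real.exp (-y) * √B), θ α * (Real.exp (2 * y) * (1 - α) ^ 2 - B) ^ q =
      powerMoment θ q (Real.exp (2 * y)) B := by
  set t := Real.exp (-y) * √B with ht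
  have ht0 : 0 ≤ t := by positivity
  have htB : Real.exp (2 * y) * t ^ 2 = B := by
    rw [ht, mul_pow, Real.sq_sqrt hB, ← mul_assoc, ← Real.exp_nat_mul, ← Real.exp_add]
    norm_num
  have hi := intervalIntegrable_powerMoment hθ hq.le (Real.exp (2 * y)) B
  have hm : (1 - t) ∈ uIcc (0 : ℝ) 1 := by
    rw [uIcc_of_le zero_le_one]; exact ⟨by linarith, by linarith⟩
  unfold powerMoment
  rw [← intervalIntegral.integral_add_adjacent_intervals
    (hi.mono_set (uIcc_subset_uIcc left_mem_uIcc hm))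
    (hi.mono_set (uIcc_subset_uIcc hm right_mem_uIcc))]
  have h2 : ∫ α in (1 - t)..1, θ α * max (Real.exp (2 * y) * (1 - α) ^ 2 - B) 0 ^ q = 0 := by
    rw [intervalIntegral.integral_of_le (by linarith)]
    refine setIntegral_eq_zero_of_forall_eq_zero fun α hα => ?_
    have : Real.exp (2 * y) * (1 - α) ^ 2 - B ≤ 0 := by
      rw [← htB, ← mul_sub]
      exact mul_nonpos_of_nonneg_of_nonpos (Real.exp_pos _).le (by nlinarith [hα.1, hα.2])
    rw [max_eq_right this, Real.zero_rpow hq.ne', mul_zero]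
  rw [h2, add_zero]
  refine intervalIntegral.integral_congr fun α hα => ?_
  rw [uIcc_of_le (by linarith)] at hα
  have : 0 ≤ Real.exp (2 * y) * (1 - α) ^ 2 - B := by
    rw [← htB, ← mul_sub]
    exact mul_nonneg (Real.exp_pos _).le (by nlinarith [hα.1, hα.2])
  simp only [max_eq_left this]

/-- Removes the case distinction, since the moment vanishes by itself where there is no matter. -/
lemma densityG_eq {Φ : ℝ → ℝ} (hΦ : BasicAnsatz Φ) {l L₀ : ℝ} (hl : -(1 / 2) < l) (hL₀ : 0 ≤ L₀)
    (r y : ℝ) :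
    densityG Φ l L₀ r y = 2 * Real.pi * cConst l * r ^ (2 * l) * Real.exp (3 * y) *
      powerMoment (fun α => Φ α * (1 - α) ^ 2) (l + 1 / 2) (Real.exp (2 * y))
        (1 + L₀ / r ^ 2) := by
  have hB : 0 ≤ 1 + L₀ / r ^ 2 := by positivity
  unfold densityG
  split_ifs with h
  · rw [← integral_eq_powerMoment hΦ.intervalIntegrable_mul_sq (by linarith) hB h]
    simp only [sub_sub]
  · rw [exp_neg_mul_sqrt_lt_one_iff hB] at h
    rw [powerMoment_eq_zero _ (by linarith) (Real.exp_pos _).le (not_lt.1 h), mul_zero]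

lemma pressureH_eq {Φ : ℝ → ℝ} (hΦ : BasicAnsatz Φ) {l L₀ : ℝ} (hl : -(1 / 2) < l) (hL₀ : 0 ≤ L₀)
    (r y : ℝ) :
    pressureH Φ l L₀ r y = 2 * Real.pi * dConst l * r ^ (2 * l) * Real.exp y *
      powerMoment Φ (l + 3 / 2) (Real.exp (2 * y)) (1 + L₀ / r ^ 2) := by
  have hB : 0 ≤ 1 + L₀ / r ^ 2 := by positivity
  unfold pressureH
  split_ifs with h
  · rw [← integral_eq_powerMoment hΦ.intervalIntegrable (by linarith) hB h]
    simp only [sub_sub]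
  · rw [exp_neg_mul_sqrt_lt_one_iff hB] at h
    rw [powerMoment_eq_zero _ (by linarith) (Real.exp_pos _).le (not_lt.1 h), mul_zero]

/-- A divergent integral would have the default value `0`, so integrability is needed; it comes from
the Beta integral with parameters `l + 1` and `1/2`. -/
lemma cConst_pos {l : ℝ} (hl : -(1 / 2) < l) : 0 < cConst l := by
  have h := Complex.betaIntegral_convergent (u := ((l + 1 : ℝ) : ℂ)) (v := ((1 / 2 : ℝ) : ℂ))
    (by rw [Complex.ofReal_re]; linarith) (by rw [Complex.ofReal_re]; norm_num)
  have h2 : IntervalIntegrable (fun s : ℝ => s ^ l / √(1 - s)) volume 0 1 := by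
    have h3 := h.norm
    rw [intervalIntegrable_iff_integrableOn_Ioo_of_le zero_le_one] at h3 ⊢
    refine h3.congr_fun (fun s hs => ?_) measurableSet_Ioo
    have hs1 : 0 < 1 - s := by linarith [hs.2]
    have e1 : (1 : ℂ) - (s : ℂ) = ((1 - s : ℝ) : ℂ) := by push_cast; ring
    simp only [norm_mul, e1]
    rw [Complex.norm_cpow_eq_rpow_re_of_pos hs.1, Complex.norm_cpow_eq_rpow_re_of_pos hs1]
    have e2 : (((l + 1 : ℝ) : ℂ) - 1).re = l := by simp
    have e3 : (((1 / 2 : ℝ) : ℂ) - 1).re = -(1 / 2) := by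
      rw [Complex.sub_re, Complex.ofReal_re, Complex.one_re]; norm_num
    rw [e2, e3, Real.rpow_neg hs1.le, ← Real.sqrt_eq_rpow, div_eq_mul_inv]
  refine intervalIntegral.intervalIntegral_pos_of_pos_on h2 (fun s hs => ?_) one_pos
  have hs1 : 0 < 1 - s := by linarith [hs.2]
  exact div_pos (Real.rpow_pos_of_pos hs.1 l) (Real.sqrt_pos.2 hs1)

lemma dConst_nonneg (l : ℝ) : 0 ≤ dConst l :=
  intervalIntegral.integral_nonneg zero_le_one fun _ hs =>
    mul_nonneg (Real.rpow_nonneg hs.1 l) (Real.sqrt_nonneg _)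

lemma dConst_zero : dConst 0 = 2 / 3 := by
  unfold dConst
  simp only [Real.rpow_zero, one_mul, Real.sqrt_eq_rpow]
  rw [intervalIntegral.integral_comp_sub_left (fun s : ℝ => s ^ (1 / 2 : ℝ)) 1,
    integral_rpow (Or.inl (by norm_num))]
  norm_num

lemma cConst_zero : cConst 0 = 2 := by
  unfold cConst
  have : ∀ s ∈ uIcc (0 : ℝ) 1, s ^ (0 : ℝ) / √(1 - s) = (1 - s) ^ (-(1 / 2) : ℝ) := by
    intro s hs
    rw [uIcc_of_le zero_le_one] at hs
    rw [Real.rpow_zero, Real.sqrt_eq_rpow, Real.rpow_neg (by linarith [hs.2]), one_div]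
  rw [intervalIntegral.integral_congr this,
    intervalIntegral.integral_comp_sub_left (fun s : ℝ => s ^ (-(1 / 2) : ℝ)) 1,
    integral_rpow (Or.inl (by norm_num))]
  norm_num

lemma densityG_nonneg {Φ : ℝ → ℝ} (hΦ : BasicAnsatz Φ) {l L₀ : ℝ} (hl : -(1 / 2) < l)
    (hL₀ : 0 ≤ L₀) {r : ℝ} (hr : 0 ≤ r) (y : ℝ) : 0 ≤ densityG Φ l L₀ r y := by
  rw [densityG_eq hΦ hl hL₀]
  have h1 := cConst_pos hl
  have h2 := powerMoment_nonneg (θ := fun α => Φ α * (1 - α) ^ 2)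
    (fun α => mul_nonneg (hΦ.nonneg α) (sq_nonneg _)) (l + 1 / 2) (Real.exp (2 * y))
    (1 + L₀ / r ^ 2)
  have h3 := Real.rpow_nonneg hr (2 * l)
  positivity

lemma pressureH_nonneg {Φ : ℝ → ℝ} (hΦ : BasicAnsatz Φ) {l L₀ : ℝ} (hl : -(1 / 2) < l)
    (hL₀ : 0 ≤ L₀) {r : ℝ} (hr : 0 ≤ r) (y : ℝ) : 0 ≤ pressureH Φ l L₀ r y := by
  rw [pressureH_eq hΦ hl hL₀]
  have h1 := dConst_nonneg l
  have h2 := powerMoment_nonneg hΦ.nonneg (l + 3 / 2) (Real.exp (2 * y)) (1 + L₀ / r ^ 2)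
  have h3 := Real.rpow_nonneg hr (2 * l)
  positivity

lemma densityG_eq_zero {Φ : ℝ → ℝ} {l L₀ r y : ℝ}
    (h : 1 ≤ Real.exp (-y) * √(1 + L₀ / r ^ 2)) : densityG Φ l L₀ r y = 0 :=
  if_neg (not_lt.2 h)

lemma pressureH_eq_zero {Φ : ℝ → ℝ} {l L₀ r y : ℝ}
    (h : 1 ≤ Real.exp (-y) * √(1 + L₀ / r ^ 2)) : pressureH Φ l L₀ r y = 0 :=
  if_neg (not_lt.2 h)

lemma densityG_pos {Φ : ℝ → ℝ} (hΦ : BasicAnsatz Φ) (hpos : PositiveAtCutoff Φ) {l L₀ : ℝ}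
    (hl : -(1 / 2) < l) (hL₀ : 0 ≤ L₀) {r y : ℝ} (hr : 0 < r ^ (2 * l))
    (h : Real.exp (-y) * √(1 + L₀ / r ^ 2) < 1) : 0 < densityG Φ l L₀ r y := by
  rw [densityG_eq hΦ hl hL₀]
  obtain ⟨α₀, hα₀, hΦ0⟩ := hpos
  rw [exp_neg_mul_sqrt_lt_one_iff (by positivity)] at h
  have h1 := cConst_pos hl
  have h2 := powerMoment_pos hΦ.intervalIntegrable_mul_sq
    (fun α => mul_nonneg (hΦ.nonneg α) (sq_nonneg _)) (α₀ := min α₀ 1) (lt_min hα₀ one_pos)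
    (fun α hα => mul_pos (hΦ0 α ⟨hα.1, hα.2.trans_le (min_le_left _ _)⟩)
      (pow_pos (by linarith [hα.2.trans_le (min_le_right α₀ 1)]) 2))
    (q := l + 1 / 2) (by linarith) (Real.exp_pos (2 * y)) h
  positivity

/-! ### Isotropic static solutions with small compactness -/

/-- The radial functions of an isotropic static solution with matter in the ball of radius `R` and
`2m/r ≤ 1/3`: `y = log E₀ - μ`, the mass `m`, the density `ρ`, the pressure `p`, and `a = r μ'`. -/
structure IsotropicBall (R : ℝ) (y m ρ p a : ℝ → ℝ) : Prop where
  R_pos : 0 < R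
  a_eq : ∀ r, 0 < r → a r = (m r / r + 4 * Real.pi * r ^ 2 * p r) / (1 - 2 * (m r / r))
  y_deriv : ∀ r, 0 < r → HasDerivAt y (-(a r / r)) r
  m_deriv : ∀ r, 0 < r → HasDerivAt m (4 * Real.pi * r ^ 2 * ρ r) r
  p_deriv : ∀ r, 0 < r → HasDerivAt p (-((p r + ρ r) * (a r / r))) r
  compactness : ∀ r, 0 < r → m r / r ≤ 1 / 6
  m_pos : ∀ r, 0 < r → 0 < m r
  p_nonneg : ∀ r, 0 ≤ p r
  ρ_cont : ContinuousOn ρ (Icc 0 R)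
  ρ_pos : ∀ r ∈ Ico 0 R, 0 < ρ r
  ρ_R : ρ R = 0
  p_R : p R = 0
  p_bdd : ∃ K, ∀ r ∈ Ioc 0 R, p r ≤ K
  m_bdd : ∃ K, ∀ r ∈ Ioc 0 R, m r / r ≤ K * r ^ 2

namespace IsotropicBall

variable {R : ℝ} {y m ρ p a : ℝ → ℝ}

/-- Together with `q_deriv` this is the dimensionless form of the structure equations: with `u =
m/r`, `q = 4πr²p`, `s = 4πr²ρ` they read `r u' = s - u` and `r q' = 2q - (q + s) a`. -/
lemma u_deriv (S : IsotropicBall R y m ρ p a) {r : ℝ} (hr : 0 < r) :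
    HasDerivAt (fun r => m r / r) ((4 * Real.pi * r ^ 2 * ρ r - m r / r) / r) r := by
  refine ((S.m_deriv r hr).fun_div (hasDerivAt_id r) hr.ne').congr_deriv ?_
  simp only [id]
  field_simp

lemma q_deriv (S : IsotropicBall R y m ρ p a) {r : ℝ} (hr : 0 < r) :
    HasDerivAt (fun r => 4 * Real.pi * r ^ 2 * p r)
      ((2 * (4 * Real.pi * r ^ 2 * p r) -
        (4 * Real.pi * r ^ 2 * p r + 4 * Real.pi * r ^ 2 * ρ r) * a r) / r) r := by
  refine (((hasDerivAt_pow 2 r).const_mul (4 * Real.pi)).fun_mul (S.p_deriv r hr)).congr_deriv ?_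
  field_simp
  norm_num
  ring

/-- Equality would make `R` a local maximum of `m/r`, but the derivative there is `-(m/r)/R < 0`
because `ρ` vanishes at `R`. Strictness is needed at the boundary, where the density contributes
nothing to the concavity estimate. -/
lemma compactness_R (S : IsotropicBall R y m ρ p a) : m R / R < 1 / 6 := by
  refine lt_of_le_of_ne (S.compactness R S.R_pos) fun heq => ?_
  have hmax : IsLocalMax (fun r => m r / r) R := by
    filter_upwards [Ioi_mem_nhds S.R_pos] with r hr
    rw [heq]
    exact S.compactness r hr
  have h := hmax.hasDerivAt_eq_zero (S.u_deriv S.R_pos)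
  have h1 := div_pos (S.m_pos R S.R_pos) S.R_pos
  rw [S.ρ_R, div_eq_zero_iff] at h
  rcases h with h | h
  · linarith
  · exact S.R_pos.ne' h

/-- There is no photon sphere: `r μ' < 1`. -/
lemma no_photon_sphere (S : IsotropicBall R y m ρ p a) {r : ℝ} (hr : r ∈ Ioo 0 R) :
    4 * Real.pi * r ^ 2 * p r + 3 * (m r / r) < 1 := by
  by_contra! hcon
  set z : ℝ → ℝ := fun r => 4 * Real.pi * r ^ 2 * p r + 3 * (m r / r) with hz
  have hzd : ∀ r, 0 < r → HasDerivAt z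
      ((2 * (4 * Real.pi * r ^ 2 * p r) -
        (4 * Real.pi * r ^ 2 * p r + 4 * Real.pi * r ^ 2 * ρ r) * a r) / r +
        3 * ((4 * Real.pi * r ^ 2 * ρ r - m r / r) / r)) r :=
    fun r hr => (S.q_deriv hr).fun_add ((S.u_deriv hr).const_mul 3)
  have hzc : ContinuousOn z (Icc r R) := fun x hx =>
    (hzd x (hr.1.trans_le hx.1)).continuousAt.continuousWithinAt
  have hzR : z R < 1 := by
    simp only [hz, S.p_R]
    linarith [S.compactness_R]
  -- `x` is the last radius in `[r, R]` at which `z ≥ 1`. It will turn out that `z` is strictly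
  -- increasing there, contradicting `z < 1` on `(x, R)`.
  obtain ⟨x, ⟨hx, hzx⟩, hgreat⟩ := (isCompact_Icc.of_isClosed_subset
    (hzc.preimage_isClosed_of_isClosed isClosed_Icc (isClosed_Ici (a := (1 : ℝ))))
    inter_subset_left).exists_isGreatest ⟨r, left_mem_Icc.2 hr.2.le, hcon⟩
  have hx0 : 0 < x := hr.1.trans_le hx.1
  have hxR : x < R := lt_of_le_of_ne hx.2 (by rintro rfl; exact absurd hzx (not_le.2 hzR))
  have hafter : ∀ t ∈ Ioo x R, z t < 1 := by
    intro t ht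
    by_contra! h
    exact absurd (hgreat ⟨⟨hx.1.trans ht.1.le, ht.2.le⟩, h⟩) (not_le.2 ht.1)
  have hz1 : z x = 1 := by
    refine le_antisymm ?_ hzx
    have hc : ContinuousWithinAt z (Ioi x) x := (hzd x hx0).continuousAt.continuousWithinAt
    refine le_of_tendsto hc ?_
    filter_upwards [Ioo_mem_nhdsGT hxR] with t ht using (hafter t ht).le
  have hu : m x / x ≤ 1 / 6 := S.compactness x hx0
  have hs : 0 < 4 * Real.pi * x ^ 2 * ρ x := by
    have := S.ρ_pos x ⟨hx0.le, hxR⟩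
    have := Real.pi_pos
    positivity
  have ha : a x = 1 := by
    rw [S.a_eq x hx0, div_eq_one_iff_eq (by linarith)]
    simp only [hz] at hz1
    linarith
  -- With `a = 1` and `q = 1 - 3u` one gets `x z'(x) = q + 2s - 3u = 1 - 6u + 2s`, positive since `u
  -- ≤ 1/6` and `s > 0`.
  have hpos : 0 < (2 * (4 * Real.pi * x ^ 2 * p x) -
        (4 * Real.pi * x ^ 2 * p x + 4 * Real.pi * x ^ 2 * ρ x) * a x) / x +
        3 * ((4 * Real.pi * x ^ 2 * ρ x - m x / x) / x) := by
    rw [ha, ← mul_div_assoc, ← add_div]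
    refine div_pos ?_ hx0
    simp only [hz] at hz1
    linarith
  have hslope := (hasDerivWithinAt_iff_tendsto_slope' (notMem_Ioi.2 le_rfl)).1
    ((hzd x hx0).hasDerivWithinAt (s := Ioi x))
  have hev := hslope.eventually (lt_mem_nhds hpos)
  have hmem : ∀ᶠ t in nhdsWithin x (Ioi x), t ∈ Ioo x R := Ioo_mem_nhdsGT hxR
  obtain ⟨t, ht1, ht2⟩ := (hev.and hmem).exists
  rw [slope_def_field, hz1] at ht1
  have := (div_pos_iff_of_pos_right (sub_pos.2 ht2.1)).1 ht1
  linarith [hafter t ht2]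

/-- The inequality `a < 1` means `u + q < 1 - 2u`, that is `q + 3u < 1`. -/
lemma a_mem (S : IsotropicBall R y m ρ p a) {r : ℝ} (hr : r ∈ Ioo 0 R) : 0 ≤ a r ∧ a r < 1 := by
  have h1 := S.no_photon_sphere hr
  have h2 := S.compactness r hr.1
  have h3 := div_pos (S.m_pos r hr.1) hr.1
  have h4 : 0 ≤ 4 * Real.pi * r ^ 2 * p r := by
    have := S.p_nonneg r
    have := Real.pi_pos
    positivity
  rw [S.a_eq r hr.1]
  have h5 : 0 < 1 - 2 * (m r / r) := by linarith
  exact ⟨div_nonneg (by linarith) h5.le, (div_lt_one h5).2 (by linarith)⟩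

/-- The quantity that controls the concavity of `r² e^{2y}` as a function of `r²`. -/
lemma N_deriv (S : IsotropicBall R y m ρ p a) {r : ℝ} (hr : 0 < r) :
    HasDerivAt (fun r => Real.exp (2 * y r) * (1 - a r))
      (-(Real.exp (2 * y r) / (1 - 2 * (m r / r)) / r *
        (4 * Real.pi * r ^ 2 * ρ r * (1 + a r) + 4 * Real.pi * r ^ 2 * p r * (6 - 3 * a r) +
          3 * (m r / r) - 2 * a r))) r := by
  have hv : 0 < 1 - 2 * (m r / r) := by linarith [S.compactness r hr]
  have hev : a =ᶠ[nhds r]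
      fun r => (m r / r + 4 * Real.pi * r ^ 2 * p r) / (1 - 2 * (m r / r)) := by
    filter_upwards [Ioi_mem_nhds hr] with x hx using S.a_eq x hx
  have had := ((((S.u_deriv hr).fun_add (S.q_deriv hr)).fun_div
    (((S.u_deriv hr).const_mul 2).const_sub 1) hv.ne').congr_of_eventuallyEq hev)
  have hyd := ((S.y_deriv r hr).const_mul 2).exp
  refine (hyd.fun_mul (had.const_sub 1)).congr_deriv ?_
  have ha := S.a_eq r hr
  generalize a r = A at *
  generalize m r / r = u at *
  generalize 4 * Real.pi * r ^ 2 * p r = q at *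
  generalize 4 * Real.pi * r ^ 2 * ρ r = s at *
  -- Solving the definition of `a` for `q` reduces the claim to a rational identity.
  have hq : q = A * (1 - 2 * u) - u := by
    rw [ha, div_mul_cancel₀ _ hv.ne']; ring
  subst hq
  have hv' := hv.ne'
  field_simp
  ring

/-- With `t = 1/(1 - 2u)` and `a = (u + q) t`, the difference of the two sides is `s a + q (3 (1 -
a) + (3 - 2t))`. It is nonnegative because `a < 1` and because `u ≤ 1/6` gives `t ≤ 3/2`. -/
lemma deficit_ge (S : IsotropicBall R y m ρ p a) {r : ℝ} (hr : r ∈ Ioo 0 R) :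
    4 * Real.pi * r ^ 2 * ρ r + m r / r * (3 - 2 / (1 - 2 * (m r / r))) ≤
      4 * Real.pi * r ^ 2 * ρ r * (1 + a r) + 4 * Real.pi * r ^ 2 * p r * (6 - 3 * a r) +
          3 * (m r / r) - 2 * a r := by
  obtain ⟨ha0, ha1⟩ := S.a_mem hr
  have hu := S.compactness r hr.1
  have hv : 0 < 1 - 2 * (m r / r) := by linarith
  have hs : 0 ≤ 4 * Real.pi * r ^ 2 * ρ r := by
    have := S.ρ_pos r ⟨hr.1.le, hr.2⟩
    have := Real.pi_pos
    positivity
  have hq : 0 ≤ 4 * Real.pi * r ^ 2 * p r := by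
    have := S.p_nonneg r
    have := Real.pi_pos
    positivity
  have ha := S.a_eq r hr.1
  have ht : 1 / (1 - 2 * (m r / r)) ≤ 3 / 2 := by
    rw [div_le_iff₀ hv]; linarith
  generalize a r = A at *
  generalize m r / r = u at *
  generalize 4 * Real.pi * r ^ 2 * p r = q at *
  generalize 4 * Real.pi * r ^ 2 * ρ r = s at *
  have e : A = u * (1 / (1 - 2 * u)) + q * (1 / (1 - 2 * u)) := by rw [ha]; ring
  have e2 : 2 / (1 - 2 * u) = 2 * (1 / (1 - 2 * u)) := by ring
  rw [e2]
  generalize 1 / (1 - 2 * u) = t at *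
  have h1 := mul_nonneg hs ha0
  have h2 := mul_nonneg hq (sub_nonneg.2 ht)
  have h3 := mul_nonneg hq (sub_nonneg.2 ha1.le)
  nlinarith

/-- `r² e^{2y}` is uniformly concave as a function of `r²`. -/
lemma exists_N_bounds (S : IsotropicBall R y m ρ p a) {y₀ : ℝ}
    (hy : ∀ r ∈ Ioo 0 R, 0 ≤ y r ∧ y r ≤ y₀) :
    ∃ (c C : ℝ) (N' : ℝ → ℝ), 0 < c ∧ 0 < C ∧ ∀ r ∈ Ioo 0 R,
      HasDerivAt (fun r => Real.exp (2 * y r) * (1 - a r)) (-N' r) r ∧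
        c * r ≤ N' r ∧ N' r ≤ C * r := by
  have hR := S.R_pos
  have hpi := Real.pi_pos
  obtain ⟨Kρ, hKρ⟩ := isCompact_Icc.exists_bound_of_continuousOn S.ρ_cont
  obtain ⟨Kp, hKp⟩ := S.p_bdd
  obtain ⟨Km, hKm⟩ := S.m_bdd
  -- `r² Y` is the lower bound of `deficit_ge`. On `[0, R/2]` positivity of `Y` comes from the
  -- density alone; on `[R/2, R]` `Y` is continuous and positive, at `R` thanks to the mass term and
  -- the strict bound `compactness_R`.
  set Y : ℝ → ℝ := fun r =>
    4 * Real.pi * ρ r + m r / r / r ^ 2 * (3 - 2 / (1 - 2 * (m r / r))) with hY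
  have hv : ∀ r, 0 < r → 0 < 1 - 2 * (m r / r) := fun r hr => by linarith [S.compactness r hr]
  have hYc : ContinuousOn Y (Icc (R / 2) R) := by
    have hsub : ∀ r ∈ Icc (R / 2) R, 0 < r := fun r hr => by linarith [hr.1]
    have hu : ContinuousOn (fun r => m r / r) (Icc (R / 2) R) := fun r hr =>
      (S.u_deriv (hsub r hr)).continuousAt.continuousWithinAt
    have hρ := S.ρ_cont.mono (Icc_subset_Icc_left (by linarith : (0 : ℝ) ≤ R / 2))
    refine (continuousOn_const.mul hρ).add ((hu.div (continuousOn_id.pow 2)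
      fun r hr => pow_ne_zero 2 (hsub r hr).ne').mul (continuousOn_const.sub
      (continuousOn_const.div (continuousOn_const.sub (continuousOn_const.mul hu))
      fun r hr => (hv r (hsub r hr)).ne')))
  have hY2 : ∀ r, 0 < r → 0 ≤ m r / r / r ^ 2 * (3 - 2 / (1 - 2 * (m r / r))) := by
    intro r hr
    have h1 := S.m_pos r hr
    have h2 : 2 / (1 - 2 * (m r / r)) ≤ 3 := by
      rw [div_le_iff₀ (hv r hr)]; linarith [S.compactness r hr]
    exact mul_nonneg (by positivity) (by linarith)
  have hYpos : ∀ r ∈ Icc (R / 2) R, 0 < Y r := by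
    intro r hr
    have hr0 : 0 < r := by linarith [hr.1]
    rcases hr.2.lt_or_eq with hlt | rfl
    · have := S.ρ_pos r ⟨hr0.le, hlt⟩
      exact add_pos_of_pos_of_nonneg (by positivity) (hY2 r hr0)
    · simp only [hY, S.ρ_R, mul_zero, zero_add]
      have h1 := S.m_pos r hr0
      have h2 : 2 / (1 - 2 * (m r / r)) < 3 := by
        rw [div_lt_iff₀ (hv r hr0)]; linarith [S.compactness_R]
      exact mul_pos (by positivity) (by linarith)
  obtain ⟨x₁, hx₁, hmin₁⟩ := isCompact_Icc.exists_isMinOn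
    (nonempty_Icc.2 (by linarith : R / 2 ≤ R)) hYc
  obtain ⟨x₂, hx₂, hmin₂⟩ := isCompact_Icc.exists_isMinOn
    (nonempty_Icc.2 (by linarith : 0 ≤ R / 2))
    (S.ρ_cont.mono (Icc_subset_Icc_right (by linarith : R / 2 ≤ R)))
  have hρ₂ : 0 < ρ x₂ := S.ρ_pos x₂ ⟨hx₂.1, by linarith [hx₂.2]⟩
  have hYlow : ∀ r ∈ Ioo 0 R, min (Y x₁) (4 * Real.pi * ρ x₂) ≤ Y r := by
    intro r hr
    rcases le_total r (R / 2) with h | h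
    · refine (min_le_right _ _).trans ?_
      have h1 : ρ x₂ ≤ ρ r := hmin₂ ⟨hr.1.le, h⟩
      have h2 : 4 * Real.pi * ρ x₂ ≤ 4 * Real.pi * ρ r :=
        mul_le_mul_of_nonneg_left h1 (by positivity)
      have := hY2 r hr.1
      simp only [hY]
      linarith
    · exact (min_le_left _ _).trans (hmin₁ ⟨h, hr.2.le⟩)
  have hKp0 : 0 ≤ Kp := (S.p_nonneg _).trans (hKp R ⟨hR, le_rfl⟩)
  have hKρ0 : 0 ≤ Kρ := (norm_nonneg _).trans (hKρ R ⟨hR.le, le_rfl⟩)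
  have hKm0 : 0 < Km := by
    have h1 := hKm R ⟨hR, le_rfl⟩
    have h2 := div_pos (S.m_pos R hR) hR
    exact pos_of_mul_pos_left (h2.trans_le h1) (by positivity)
  -- The lower constant uses `e^(2y) / (1 - 2u) ≥ 1`. The upper one uses `e^(2y) / (1 - 2u) ≤ (3/2)
  -- e^(2y₀)` together with `s (1 + a) ≤ 2s`, `q (6 - 3a) ≤ 6q` and `u ≤ Km r²`.
  refine ⟨min (Y x₁) (4 * Real.pi * ρ x₂),
    Real.exp (2 * y₀) * (3 / 2) * (8 * Real.pi * Kρ + 24 * Real.pi * Kp + 3 * Km),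
    fun r => Real.exp (2 * y r) / (1 - 2 * (m r / r)) / r *
        (4 * Real.pi * r ^ 2 * ρ r * (1 + a r) + 4 * Real.pi * r ^ 2 * p r * (6 - 3 * a r) +
          3 * (m r / r) - 2 * a r),
    lt_min (hYpos x₁ hx₁) (by positivity), by positivity, fun r hr => ⟨S.N_deriv hr.1, ?_, ?_⟩⟩
  · have h1 := S.deficit_ge hr
    have h2 : r ^ 2 * Y r =
        4 * Real.pi * r ^ 2 * ρ r + m r / r * (3 - 2 / (1 - 2 * (m r / r))) := by
      have := hr.1.ne'
      simp only [hY]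
      generalize 3 - 2 / (1 - 2 * (m r / r)) = w
      field_simp
    have h3 : 1 / r ≤ Real.exp (2 * y r) / (1 - 2 * (m r / r)) / r := by
      refine div_le_div_of_nonneg_right ?_ hr.1.le
      rw [le_div_iff₀ (hv r hr.1)]
      have := Real.one_le_exp (by linarith [(hy r hr).1] : 0 ≤ 2 * y r)
      linarith [div_pos (S.m_pos r hr.1) hr.1]
    have h4 : 0 ≤ Y r := le_trans (le_min (hYpos x₁ hx₁).le (by positivity)) (hYlow r hr)
    calc min (Y x₁) (4 * Real.pi * ρ x₂) * r ≤ Y r * r :=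
          mul_le_mul_of_nonneg_right (hYlow r hr) hr.1.le
      _ = 1 / r * (r ^ 2 * Y r) := by have := hr.1.ne'; field_simp
      _ ≤ _ := mul_le_mul h3 (h2 ▸ h1) (mul_nonneg (sq_nonneg r) h4)
          (le_trans (one_div_nonneg.2 hr.1.le) h3)
  · obtain ⟨ha0, ha1⟩ := S.a_mem hr
    have hrI : r ∈ Ioc 0 R := ⟨hr.1, hr.2.le⟩
    have hρ0 := (S.ρ_pos r ⟨hr.1.le, hr.2⟩).le
    have hρ1 : ρ r ≤ Kρ := (le_abs_self _).trans (hKρ r ⟨hr.1.le, hr.2.le⟩)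
    have hp0 := S.p_nonneg r
    have b1 : 4 * Real.pi * r ^ 2 * ρ r * (1 + a r) ≤ 4 * Real.pi * r ^ 2 * Kρ * 2 := by
      refine mul_le_mul (mul_le_mul_of_nonneg_left hρ1 (by positivity)) (by linarith)
        (by linarith) (by positivity)
    have b2 : 4 * Real.pi * r ^ 2 * p r * (6 - 3 * a r) ≤ 4 * Real.pi * r ^ 2 * Kp * 6 := by
      refine mul_le_mul (mul_le_mul_of_nonneg_left (hKp r hrI) (by positivity)) (by linarith)
        (by linarith) (by positivity)
    have b3 := hKm r hrI
    have b4 : Real.exp (2 * y r) / (1 - 2 * (m r / r)) / r ≤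
        Real.exp (2 * y₀) * (3 / 2) / r := by
      refine div_le_div_of_nonneg_right ?_ hr.1.le
      rw [div_le_iff₀ (hv r hr.1)]
      have e1 := Real.exp_le_exp.2 (by linarith [(hy r hr).2] : 2 * y r ≤ 2 * y₀)
      have e2 : 1 ≤ 3 / 2 * (1 - 2 * (m r / r)) := by linarith [S.compactness r hr.1]
      calc Real.exp (2 * y r) ≤ Real.exp (2 * y₀) * 1 := by linarith
        _ ≤ Real.exp (2 * y₀) * (3 / 2 * (1 - 2 * (m r / r))) :=
          mul_le_mul_of_nonneg_left e2 (Real.exp_pos _).le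
        _ = _ := by ring
    calc _ ≤ Real.exp (2 * y r) / (1 - 2 * (m r / r)) / r *
            (r ^ 2 * (8 * Real.pi * Kρ + 24 * Real.pi * Kp + 3 * Km)) := by
          refine mul_le_mul_of_nonneg_left (by linarith) ?_
          have := hv r hr.1
          have := hr.1
          positivity
      _ ≤ Real.exp (2 * y₀) * (3 / 2) / r *
            (r ^ 2 * (8 * Real.pi * Kρ + 24 * Real.pi * Kp + 3 * Km)) :=
          mul_le_mul_of_nonneg_right b4 (by positivity)
      _ = _ := by have := hr.1.ne'; field_simp

end IsotropicBall

/-! ### Singularity-free isotropic steady states -/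

/-- The isotropic density as a function of `y`. -/
noncomputable def isoDensity (Φ : ℝ → ℝ) (v : ℝ) : ℝ := densityG Φ 0 0 1 v

/-- The isotropic pressure as a function of `y`. -/
noncomputable def isoPressure (Φ : ℝ → ℝ) (v : ℝ) : ℝ := pressureH Φ 0 0 1 v

lemma densityG_iso (Φ : ℝ → ℝ) (r v : ℝ) : densityG Φ 0 0 r v = isoDensity Φ v := by
  simp [isoDensity, densityG]

lemma pressureH_iso (Φ : ℝ → ℝ) (r v : ℝ) : pressureH Φ 0 0 r v = isoPressure Φ v := by
  simp [isoPressure, pressureH]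

lemma isoDensity_eq {Φ : ℝ → ℝ} (hΦ : BasicAnsatz Φ) (v : ℝ) :
    isoDensity Φ v = 4 * Real.pi * Real.exp (3 * v) *
      powerMoment (fun α => Φ α * (1 - α) ^ 2) (1 / 2) (Real.exp (2 * v)) 1 := by
  rw [isoDensity, densityG_eq hΦ (by norm_num) le_rfl, cConst_zero]
  simp only [mul_zero, Real.rpow_zero, zero_add, zero_div, add_zero]
  ring

lemma isoPressure_eq {Φ : ℝ → ℝ} (hΦ : BasicAnsatz Φ) (v : ℝ) :
    isoPressure Φ v = 4 * Real.pi / 3 * Real.exp v *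
      powerMoment Φ (3 / 2) (Real.exp (2 * v)) 1 := by
  rw [isoPressure, pressureH_eq hΦ (by norm_num) le_rfl, dConst_zero]
  simp only [mul_zero, Real.rpow_zero, zero_add, zero_div, add_zero]
  ring

lemma isoDensity_nonneg {Φ : ℝ → ℝ} (hΦ : BasicAnsatz Φ) (v : ℝ) : 0 ≤ isoDensity Φ v :=
  densityG_nonneg hΦ (by norm_num) le_rfl zero_le_one v

lemma isoPressure_nonneg {Φ : ℝ → ℝ} (hΦ : BasicAnsatz Φ) (v : ℝ) : 0 ≤ isoPressure Φ v :=
  pressureH_nonneg hΦ (by norm_num) le_rfl zero_le_one v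

lemma isoDensity_pos {Φ : ℝ → ℝ} (hΦ : BasicAnsatz Φ) (hpos : PositiveAtCutoff Φ) {v : ℝ}
    (hv : 0 < v) : 0 < isoDensity Φ v :=
  densityG_pos hΦ hpos (by norm_num) le_rfl (by simp) (by simpa using hv)

lemma isoDensity_eq_zero {Φ : ℝ → ℝ} {v : ℝ} (hv : v ≤ 0) : isoDensity Φ v = 0 :=
  densityG_eq_zero (by simpa using hv)

lemma isoPressure_eq_zero {Φ : ℝ → ℝ} {v : ℝ} (hv : v ≤ 0) : isoPressure Φ v = 0 :=
  pressureH_eq_zero (by simpa using hv)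

lemma continuous_isoDensity {Φ : ℝ → ℝ} (hΦ : BasicAnsatz Φ) : Continuous (isoDensity Φ) := by
  rw [funext (isoDensity_eq hΦ)]
  refine Continuous.mul (by fun_prop) (continuous_iff_continuousAt.2 fun v => ?_)
  exact continuousAt_powerMoment hΦ.intervalIntegrable_mul_sq (by norm_num)
    (A := fun v => Real.exp (2 * v)) (B := fun _ => 1) (by fun_prop) continuousAt_const

/-- The factor `e^v` reproduces the pressure; lowering the exponent from `3/2` to `1/2` in the
moment gives the density. Composed with `y' = -a/r` this is the Tolman-Oppenheimer-Volkoff equation.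
-/
lemma hasDerivAt_isoPressure {Φ : ℝ → ℝ} (hΦ : BasicAnsatz Φ) (v : ℝ) :
    HasDerivAt (isoPressure Φ) (isoPressure Φ v + isoDensity Φ v) v := by
  have hA : ∀ x, HasDerivAt (fun v : ℝ => Real.exp (2 * v)) (2 * Real.exp (2 * x)) x := by
    intro x
    have := ((hasDerivAt_id x).const_mul 2).exp
    refine this.congr_deriv ?_
    simp [mul_comm]
  have h := hasDerivAt_powerMoment (q := 3 / 2) hΦ.intervalIntegrable (by norm_num)
    (A := fun v => Real.exp (2 * v)) (B := fun _ => 1) (A' := fun v => 2 * Real.exp (2 * v))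
    (B' := fun _ => 0) (r := v) (Filter.Eventually.of_forall hA)
    (Filter.Eventually.of_forall fun x => hasDerivAt_const x 1) (by fun_prop) continuousAt_const
  rw [isoPressure_eq hΦ v, isoDensity_eq hΦ v, funext (isoPressure_eq hΦ)]
  refine (((Real.hasDerivAt_exp v).const_mul (4 * Real.pi / 3)).fun_mul h).congr_deriv ?_
  have e : Real.exp (3 * v) = Real.exp v * Real.exp (2 * v) := by
    rw [← Real.exp_add]; ring_nf
  rw [e]
  norm_num
  ring

lemma PowerLike.positiveAtCutoff {Φ : ℝ → ℝ} {l : ℝ} (h : PowerLike Φ l) :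
    PositiveAtCutoff Φ := by
  obtain ⟨c₁, c₂, α₀, k, hc₁, -, hα₀, -, -, hb⟩ := h
  exact ⟨α₀, hα₀, fun α hα => (mul_pos hc₁ (Real.rpow_pos_of_pos hα.1 k)).trans_le
    (hb α ⟨hα.1, hα.2.le⟩).1⟩

lemma regularMass_iso (Φ y : ℝ → ℝ) (r : ℝ) :
    regularMass Φ 0 0 y r = 4 * Real.pi * ∫ s in (0 : ℝ)..r, s ^ 2 * isoDensity Φ (y s) := by
  simp only [regularMass, densityG_iso]

namespace IsRegularSolution

variable {Φ y : ℝ → ℝ} {y₀ E₀ : ℝ}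

lemma continuousOn_source (h : IsRegularSolution Φ 0 0 y₀ E₀ y) (hΦ : BasicAnsatz Φ) :
    ContinuousOn (fun s => s ^ 2 * isoDensity Φ (y s)) (Ici 0) :=
  (continuousOn_id.pow 2).mul
    ((continuous_isoDensity hΦ).comp_continuousOn h.smooth.continuousOn)

lemma mass_deriv (h : IsRegularSolution Φ 0 0 y₀ E₀ y) (hΦ : BasicAnsatz Φ) {r : ℝ}
    (hr : 0 < r) :
    HasDerivAt (regularMass Φ 0 0 y) (4 * Real.pi * r ^ 2 * isoDensity Φ (y r)) r := by
  have hc := h.continuousOn_source hΦ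
  have hc' : ContinuousOn (fun s => s ^ 2 * isoDensity Φ (y s)) (Ioi 0) := hc.mono Ioi_subset_Ici_self
  rw [funext (regularMass_iso Φ y)]
  refine ((intervalIntegral.integral_hasDerivAt_right ?_ ?_ ?_).const_mul
    (4 * Real.pi)).congr_deriv (by ring)
  · refine (hc.mono ?_).intervalIntegrable
    rw [uIcc_of_le hr.le]
    exact fun x hx => hx.1
  · exact hc'.stronglyMeasurableAtFilter isOpen_Ioi _ hr
  · exact hc'.continuousAt (Ioi_mem_nhds hr)

/-- The density is positive near the centre because `y(0) = y₀ > 0`. -/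
lemma mass_pos (h : IsRegularSolution Φ 0 0 y₀ E₀ y) (hΦ : BasicAnsatz Φ)
    (hpos : PositiveAtCutoff Φ) (hy₀ : 0 < y₀) {r : ℝ} (hr : 0 < r) :
    0 < regularMass Φ 0 0 y r := by
  rw [regularMass_iso]
  refine mul_pos (by positivity) (intervalIntegral.integral_pos hr
    ((h.continuousOn_source hΦ).mono fun x hx => hx.1)
    (fun s _ => mul_nonneg (sq_nonneg s) (isoDensity_nonneg hΦ _)) ?_)
  have hc : ContinuousWithinAt y (Ioi 0) 0 :=
    (h.smooth.continuousOn 0 self_mem_Ici).mono Ioi_subset_Ici_self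
  have h1 : ∀ᶠ s in nhdsWithin 0 (Ioi 0), 0 < y s := hc.eventually (lt_mem_nhds (by rwa [h.initial]))
  have h2 : ∀ᶠ s in nhdsWithin (0 : ℝ) (Ioi 0), s ∈ Ioo 0 r := Ioo_mem_nhdsGT hr
  obtain ⟨s, hs1, hs2⟩ := (h1.and h2).exists
  exact ⟨s, Ioo_subset_Icc_self hs2, mul_pos (pow_pos hs2.1 2) (isoDensity_pos hΦ hpos hs1)⟩

lemma y_deriv (h : IsRegularSolution Φ 0 0 y₀ E₀ y) {r : ℝ} (hr : 0 < r) :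
    HasDerivAt y (-((regularMass Φ 0 0 y r / r + 4 * Real.pi * r ^ 2 * isoPressure Φ (y r)) /
      (1 - 2 * (regularMass Φ 0 0 y r / r)) / r)) r := by
  refine (h.ode r hr).congr_deriv ?_
  rw [pressureH_iso]
  have e : 1 - 2 / r * regularMass Φ 0 0 y r = 1 - 2 * (regularMass Φ 0 0 y r / r) := by ring
  rw [e]
  have : regularMass Φ 0 0 y r / r ^ 2 + 4 * Real.pi * r * isoPressure Φ (y r) =
      (regularMass Φ 0 0 y r / r + 4 * Real.pi * r ^ 2 * isoPressure Φ (y r)) / r := by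
    field_simp
  rw [this]
  ring

lemma one_sub_pos (h : IsRegularSolution Φ 0 0 y₀ E₀ y) {r : ℝ} (hr : 0 < r) :
    0 < 1 - 2 * (regularMass Φ 0 0 y r / r) := by
  rw [sub_pos, ← mul_div_assoc, div_lt_one hr]
  exact h.noHorizon r hr

lemma strictAntiOn (h : IsRegularSolution Φ 0 0 y₀ E₀ y) (hΦ : BasicAnsatz Φ)
    (hpos : PositiveAtCutoff Φ) (hy₀ : 0 < y₀) : StrictAntiOn y (Ici 0) := by
  refine strictAntiOn_of_deriv_neg (convex_Ici 0) h.smooth.continuousOn fun r hr => ?_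
  rw [interior_Ici] at hr
  have hr : 0 < r := hr
  rw [(h.y_deriv hr).deriv, neg_lt_zero]
  have h1 := h.mass_pos hΦ hpos hy₀ hr
  have h2 := isoPressure_nonneg hΦ (y r)
  have h3 := h.one_sub_pos hr
  have := Real.pi_pos
  positivity

/-- `y` passes from `y₀ > 0` to the limit `log E₀ < 0`; its zero is the boundary of the matter. -/
lemma exists_radius (h : IsRegularSolution Φ 0 0 y₀ E₀ y) (hy₀ : 0 < y₀) :
    ∃ R, 0 < R ∧ y R = 0 := by
  have hlog : Real.log E₀ < 0 := Real.log_neg h.cutoff_pos h.cutoff_lt_one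
  obtain ⟨x, hx1, hx2⟩ := ((h.limit.eventually (gt_mem_nhds hlog)).and
    (Filter.eventually_gt_atTop 0)).exists
  obtain ⟨R, hR, hyR⟩ := intermediate_value_Ioo' hx2.le
    (h.smooth.continuousOn.mono fun t ht => ht.1)
    (show (0 : ℝ) ∈ Ioo (y x) (y 0) from ⟨hx1, by rwa [h.initial]⟩)
  exact ⟨R, hR.1, hyR⟩

lemma isotropicBall (h : IsRegularSolution Φ 0 0 y₀ E₀ y) (hΦ : BasicAnsatz Φ)
    (hpos : PositiveAtCutoff Φ) (hy₀ : 0 < y₀)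
    (hcomp : ∀ r : ℝ, 0 < r → 2 * regularMass Φ 0 0 y r / r ≤ 1 / 3) {R : ℝ} (hR : 0 < R)
    (hyR : y R = 0) :
    IsotropicBall R y (regularMass Φ 0 0 y) (fun r => isoDensity Φ (y r))
      (fun r => isoPressure Φ (y r)) (fun r =>
        (regularMass Φ 0 0 y r / r + 4 * Real.pi * r ^ 2 * isoPressure Φ (y r)) /
          (1 - 2 * (regularMass Φ 0 0 y r / r))) := by
  have hyc : ContinuousOn y (Icc 0 R) := h.smooth.continuousOn.mono fun x hx => hx.1
  have hρc : ContinuousOn (fun r => isoDensity Φ (y r)) (Icc 0 R) :=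
    (continuous_isoDensity hΦ).comp_continuousOn hyc
  refine ⟨hR, fun _ _ => rfl, fun r hr => h.y_deriv hr, fun r hr => h.mass_deriv hΦ hr,
    fun r hr => ?_, fun r hr => ?_, fun r hr => h.mass_pos hΦ hpos hy₀ hr,
    fun r => isoPressure_nonneg hΦ _, hρc, fun r hr => ?_, isoDensity_eq_zero hyR.le,
    isoPressure_eq_zero hyR.le, ?_, ?_⟩
  · refine ((hasDerivAt_isoPressure hΦ (y r)).comp r (h.y_deriv hr)).congr_deriv ?_
    ring
  · have := hcomp r hr
    rw [mul_div_assoc] at this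
    linarith
  · refine isoDensity_pos hΦ hpos ?_
    rw [← hyR]
    exact h.strictAntiOn hΦ hpos hy₀ hr.1 hR.le hr.2
  · have hpc : ContinuousOn (fun r => isoPressure Φ (y r)) (Icc 0 R) :=
      (continuous_iff_continuousAt.2 fun v =>
        (hasDerivAt_isoPressure hΦ v).continuousAt).comp_continuousOn hyc
    obtain ⟨K, hK⟩ := isCompact_Icc.exists_bound_of_continuousOn hpc
    exact ⟨K, fun r hr => (le_abs_self _).trans (hK r ⟨hr.1.le, hr.2⟩)⟩
  · obtain ⟨K, hK⟩ := isCompact_Icc.exists_bound_of_continuousOn hρc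
    refine ⟨4 * Real.pi * K, fun r hr => ?_⟩
    have hb : ‖∫ s in (0 : ℝ)..r, s ^ 2 * isoDensity Φ (y s)‖ ≤ r ^ 2 * K * |r - 0| := by
      refine intervalIntegral.norm_integral_le_of_norm_le_const fun s hs => ?_
      rw [uIoc_of_le hr.1.le] at hs
      rw [norm_mul, Real.norm_of_nonneg (sq_nonneg s)]
      exact mul_le_mul (pow_le_pow_left₀ hs.1.le hs.2 2) (hK s ⟨hs.1.le, hs.2.trans hr.2⟩)
        (norm_nonneg _) (sq_nonneg r)
    rw [sub_zero, abs_of_pos hr.1] at hb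
    have hb := (le_abs_self _).trans hb
    rw [regularMass_iso, div_le_iff₀ hr.1]
    calc _ ≤ 4 * Real.pi * (r ^ 2 * K * r) := mul_le_mul_of_nonneg_left hb (by positivity)
      _ = _ := by ring

end IsRegularSolution

lemma exp_log_sub {E₀ : ℝ} (hE₀ : 0 < E₀) (v : ℝ) :
    Real.exp (Real.log E₀ - v) = E₀ * Real.exp (-v) := by
  rw [sub_eq_add_neg, Real.exp_add, Real.exp_log hE₀]

/-- With weight `(r e^y / E₀)²` the slope function is `1 - ε² N`, so the bounds on `N'` serve all `L
> 0` and all energies at once. The left end `a` of the well depends on `L` and tends to `0` with it,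
but enters none of the constants. -/
theorem regularState_conclusion {Φ y : ℝ → ℝ} {y₀ E₀ : ℝ} (hΦ : BasicAnsatz Φ)
    (hpos : PositiveAtCutoff Φ) (hy₀ : 0 < y₀) (h : IsRegularSolution Φ 0 0 y₀ E₀ y)
    (hcomp : ∀ r : ℝ, 0 < r → 2 * regularMass Φ 0 0 y r / r ≤ 1 / 3) :
    (regularState Φ 0 0 E₀ y).SingleWell ∧ (regularState Φ 0 0 E₀ y).PeriodWellDefined ∧
      (regularState Φ 0 0 E₀ y).PeriodBounded := by
  obtain ⟨R, hR, hyR⟩ := h.exists_radius hy₀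
  have hE₀ := h.cutoff_pos
  have B := h.isotropicBall hΦ hpos hy₀ hcomp hR hyR
  have hanti := h.strictAntiOn hΦ hpos hy₀
  have hy_le : ∀ r, 0 ≤ r → y r ≤ y₀ := fun r hr => by
    rw [← h.initial]; exact hanti.antitoneOn self_mem_Ici hr hr
  have hy_pos : ∀ r, 0 < r → (0 < y r ↔ r < R) := fun r hr => by
    rw [← hyR]; exact hanti.lt_iff_gt hR.le hr.le
  obtain ⟨c, C, N', hc, hC, hN⟩ := B.exists_N_bounds (y₀ := y₀)
    fun r hr => ⟨((hy_pos r hr.1).2 hr.2).le, hy_le r hr.1.le⟩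
  set S := regularState Φ 0 0 E₀ y with hS
  have hμ : ∀ r, Real.exp (S.μ r) = E₀ * Real.exp (-y r) := fun r => exp_log_sub hE₀ _
  have hΨ : ∀ L r, S.effPot L r = E₀ * Real.exp (-y r) * √(1 + L / r ^ 2) := fun L r => by
    unfold StaticData.effPot; rw [hμ]
  have hΨ_lt : ∀ L r, 0 < L → (S.effPot L r < E₀ ↔ 1 + L / r ^ 2 < Real.exp (2 * y r)) := by
    intro L r hL
    rw [hΨ, mul_assoc, mul_lt_iff_lt_one_right hE₀, exp_neg_mul_sqrt_lt_one_iff (by positivity)]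
  have hwell : ∀ L r, 0 < L → (r ∈ S.wellSet L ↔ 0 < r ∧ S.effPot L r < E₀) := by
    intro L r hL
    have e : r ∈ S.wellSet L ↔ 2 * 0 < r ∧ S.effPot L r < E₀ ∧ 0 < densityG Φ 0 0 r (y r) :=
      Iff.rfl
    rw [e, mul_zero]
    refine ⟨fun hr => ⟨hr.1, hr.2.1⟩, fun hr => ⟨hr.1, hr.2, ?_⟩⟩
    rw [densityG_iso]
    refine isoDensity_pos hΦ hpos ?_
    have h1 := (hΨ_lt L r hL).1 hr.2
    have h2 : 0 < L / r ^ 2 := div_pos hL (pow_pos hr.1 2)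
    have h3 : 0 < 2 * y r := Real.one_lt_exp_iff.1 (by linarith)
    linarith
  -- The weighted integrand is `e^λ e^(2y) ε / E₀ · r`. The constants come from `e^(-y₀) ≤ ε ≤ 1`,
  -- from `0 ≤ y ≤ y₀` inside the matter, and from `1 ≤ e^λ ≤ (2/3)^(-1/2)`, a consequence of `2m/r
  -- ≤ 1/3`.
  refine S.conclusion_of_isWell (Real.exp (-(2 * y₀)) * c) C 2 2 (Real.exp (-y₀) / E₀)
    (Real.exp (-(1 / 2) * Real.log (2 / 3)) * Real.exp (2 * y₀) / E₀) hC two_pos (by positivity)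
    ?_ ?_
  · rintro E L ⟨r, w, L', ⟨hr, -, hf⟩, hL, -, heq⟩
    obtain ⟨rfl, rfl⟩ := Prod.mk.inj heq
    have hr : 0 < r := by
      have : 2 * (0 : ℝ) < r := hr
      linarith
    have hf : 0 < microState Φ 0 0 E₀ (particleEnergy S.μ r w L) L := hf
    have hE : particleEnergy S.μ r w L < E₀ := by
      by_contra! hcon
      have : 1 - particleEnergy S.μ r w L / E₀ ≤ 0 := by
        rw [sub_nonpos, one_le_div hE₀]; exact hcon
      rw [microState, hΦ.vanish _ this, zero_mul] at hf
      exact lt_irrefl _ hf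
    refine ⟨hL.le, hE, r, (hwell L r hL).2 ⟨hr, lt_of_le_of_lt ?_ hE⟩⟩
    unfold StaticData.effPot particleEnergy
    refine mul_le_mul_of_nonneg_left (Real.sqrt_le_sqrt ?_) (Real.exp_pos _).le
    linarith [sq_nonneg w]
  · intro L hL _ _
    have hsq : 0 < √L := Real.sqrt_pos.2 hL
    -- For `r ≤ √L e^(-y₀)` the centrifugal term satisfies `L/r² ≥ e^(2y₀) ≥ e^(2y)`, so `Ψ_L ≥ E₀`.
    -- The entry `R/2` only ensures `a < R`.
    set a := min (R / 2) (√L * Real.exp (-y₀)) with ha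
    have ha0 : 0 < a := lt_min (by linarith) (by positivity)
    have haR : a < R := (min_le_left _ _).trans_lt (by linarith)
    have hbarrier : ∀ r, 0 < r → r ≤ a → E₀ ≤ S.effPot L r := by
      intro r hr hra
      by_contra! hcon
      have h1 := (hΨ_lt L r hL).1 hcon
      have h2 : r ^ 2 ≤ L * Real.exp (-(2 * y₀)) := by
        have := pow_le_pow_left₀ hr.le (hra.trans (min_le_right _ _)) 2
        have e : ((2 : ℕ) : ℝ) * -y₀ = -(2 * y₀) := by push_cast; ring
        rwa [mul_pow, Real.sq_sqrt hL.le, ← Real.exp_nat_mul, e] at this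
      have h3 : Real.exp (2 * y r) ≤ Real.exp (2 * y₀) :=
        Real.exp_le_exp.2 (by linarith [hy_le r hr.le])
      have h4 : Real.exp (2 * y₀) ≤ L / r ^ 2 := by
        rw [le_div_iff₀ (pow_pos hr 2)]
        calc _ ≤ Real.exp (2 * y₀) * (L * Real.exp (-(2 * y₀))) :=
              mul_le_mul_of_nonneg_left h2 (Real.exp_pos _).le
          _ = L * (Real.exp (2 * y₀) * Real.exp (-(2 * y₀))) := by ring
          _ = L := by rw [← Real.exp_add]; simp
      linarith
    have hyd : ∀ r, 0 < r → HasDerivAt y _ r := fun r hr => B.y_deriv r hr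
    have hμd : ∀ r, 0 < r → DifferentiableAt ℝ S.μ r := fun r hr =>
      ((hyd r hr).const_sub (Real.log E₀)).differentiableAt
    have hv : ∀ r, 0 < r → 2 / 3 ≤ 1 - 2 / r * regularMass Φ 0 0 y r := by
      intro r hr
      have := hcomp r hr
      rw [mul_div_right_comm] at this
      linarith
    have hv1 : ∀ r, 0 < r → 1 - 2 / r * regularMass Φ 0 0 y r ≤ 1 := by
      intro r hr
      have := h.mass_pos hΦ hpos hy₀ hr
      linarith [mul_pos (div_pos two_pos hr) this]
    refine ⟨a, R, ha0, haR, fun r => ?_, hbarrier a ha0 le_rfl, ?_, ?_, ?_, ?_, ?_⟩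
    · rw [hwell L r hL]
      refine ⟨fun hr => ⟨⟨?_, ?_⟩, hr.2⟩, fun hr => ⟨ha0.trans hr.1.1, hr.2⟩⟩
      · by_contra! hcon
        exact absurd hr.2 (not_lt.2 (hbarrier r hr.1 hcon))
      · rw [← hy_pos r hr.1]
        have h1 := (hΨ_lt L r hL).1 hr.2
        have h2 : 0 < L / r ^ 2 := div_pos hL (pow_pos hr.1 2)
        have h3 : 0 < 2 * y r := Real.one_lt_exp_iff.1 (by linarith)
        linarith
    · by_contra! hcon
      have h1 := (hΨ_lt L R hL).1 hcon
      rw [hyR, mul_zero, Real.exp_zero] at h1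
      linarith [div_pos hL (pow_pos hR 2)]
    · exact fun r hr => (hμd r (ha0.trans_le hr.1)).continuousAt.continuousWithinAt
    · intro r hr
      have hr0 := ha0.trans_le hr.1
      have hmc : ContinuousAt (regularMass Φ 0 0 y) r := (B.m_deriv r hr0).continuousAt
      have h1 : ContinuousAt (fun r : ℝ => 2 / r) r := continuousAt_const.div continuousAt_id hr0.ne'
      have h2 : ContinuousAt (fun r => 1 - 2 / r * regularMass Φ 0 0 y r) r :=
        continuousAt_const.sub (h1.mul hmc)
      exact (continuousAt_const.mul
        (h2.log (by linarith [hv r hr0] : (0 : ℝ) < _).ne')).continuousWithinAt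
    · exact fun r hr => hμd r (ha0.trans hr.1)
    · rintro E hE ⟨r₁, hr₁, hr₁E⟩
      -- Energies that are reached in the well are at least the central value `E₀ e^(-y₀)` of `e^μ`;
      -- this keeps `ε` away from zero.
      have hElow : E₀ * Real.exp (-y₀) ≤ E := by
        refine le_trans ?_ hr₁E
        rw [hΨ]
        have h1 : Real.exp (-y₀) ≤ Real.exp (-y r₁) :=
          Real.exp_le_exp.2 (neg_le_neg (hy_le r₁ (ha0.trans hr₁.1).le))
        have h2 : 1 ≤ √(1 + L / r₁ ^ 2) := by
          rw [Real.one_le_sqrt]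
          linarith [div_pos hL (pow_pos (ha0.trans hr₁.1) 2)]
        calc E₀ * Real.exp (-y₀) ≤ E₀ * Real.exp (-y r₁) := mul_le_mul_of_nonneg_left h1 hE₀.le
          _ ≤ _ := le_mul_of_one_le_right (by positivity) h2
      have hEpos : 0 < E := lt_of_lt_of_le (by positivity) hElow
      set ε := E / E₀ with hε
      have hε0 : 0 < ε := div_pos hEpos hE₀
      have hε1 : ε ≤ 1 := (div_le_one hE₀).2 hE.le
      have hε2 : Real.exp (-y₀) ≤ ε := by rw [hε, le_div_iff₀ hE₀, mul_comm]; exact hElow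
      have hε3 : Real.exp (-(2 * y₀)) ≤ ε ^ 2 := by
        have e : -(2 * y₀) = ((2 : ℕ) : ℝ) * -y₀ := by push_cast; ring
        rw [e, Real.exp_nat_mul]
        exact pow_le_pow_left₀ (Real.exp_pos _).le hε2 2
      have hD : ∀ r, 0 < r → r ^ 2 * (Real.exp (y r) / E₀) ^ 2 * (E ^ 2 - S.effPot L r ^ 2) =
          ε ^ 2 * (r ^ 2 * Real.exp (2 * y r)) - r ^ 2 - L := by
        intro r hr
        have e1 : Real.exp (2 * y r) = Real.exp (y r) ^ 2 := by
          rw [← Real.exp_nat_mul]; norm_num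
        have e2 := (Real.exp_pos (y r)).ne'
        rw [S.effPot_sq hL, hμ, e1, hε, Real.exp_neg]
        field_simp
        ring
      have hDd : ∀ r, 0 < r → HasDerivAt (fun r => r ^ 2 * (Real.exp (y r) / E₀) ^ 2 *
          (E ^ 2 - S.effPot L r ^ 2)) (-(r * 2 * (1 - ε ^ 2 * (Real.exp (2 * y r) *
            (1 - (regularMass Φ 0 0 y r / r + 4 * Real.pi * r ^ 2 * isoPressure Φ (y r)) /
              (1 - 2 * (regularMass Φ 0 0 y r / r))))))) r := by
        intro r hr
        have h1 := ((((hasDerivAt_pow 2 r).fun_mul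
          ((hyd r hr).const_mul 2).exp).const_mul (ε ^ 2)).fun_sub (hasDerivAt_pow 2 r)).sub_const L
        refine (h1.congr_of_eventuallyEq ?_).congr_deriv ?_
        · filter_upwards [Ioi_mem_nhds hr] with x hx using hD x hx
        · generalize (regularMass Φ 0 0 y r / r + 4 * Real.pi * r ^ 2 * isoPressure Φ (y r)) /
              (1 - 2 * (regularMass Φ 0 0 y r / r)) = A
          field_simp
          norm_num
          ring
      refine ⟨fun r => r ^ 2 * (Real.exp (y r) / E₀) ^ 2, fun _ => 2,
        fun r => 1 - ε ^ 2 * (Real.exp (2 * y r) *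
            (1 - (regularMass Φ 0 0 y r / r + 4 * Real.pi * r ^ 2 * isoPressure Φ (y r)) /
              (1 - 2 * (regularMass Φ 0 0 y r / r)))), fun r => ε ^ 2 * N' r,
        fun r hr => ?_, fun r hr => ?_, ?_, fun r hr => ?_⟩
      · have := ha0.trans_le hr.1
        positivity
      · exact (differentiableAt_pow 2).fun_mul
          (((hyd r (ha0.trans hr.1)).differentiableAt.exp.div_const E₀).fun_pow 2)
      · refine ⟨ha0, haR, by positivity, two_pos, fun r hr =>
          (hDd r (ha0.trans_le hr.1)).continuousAt.continuousWithinAt,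
          fun r hr => hDd r (ha0.trans hr.1), fun _ _ => ⟨le_rfl, le_rfl⟩, fun r hr => ?_,
          fun r hr => ?_⟩
        · refine (((hN r ⟨ha0.trans hr.1, hr.2⟩).1.const_mul (ε ^ 2)).const_sub 1).congr_deriv ?_
          ring
        · have hr0 := ha0.trans hr.1
          obtain ⟨-, h1, h2⟩ := hN r ⟨hr0, hr.2⟩
          have h3 : 0 ≤ N' r := le_trans (by positivity) h1
          constructor
          · rw [mul_assoc]
            exact mul_le_mul hε3 h1 (by positivity) (sq_nonneg _)
          · exact (mul_le_of_le_one_left h3 (pow_le_one₀ hε0.le hε1)).trans h2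
      · have hr0 := ha0.trans hr.1
        have hyr0 : 0 ≤ y r := ((hy_pos r hr0).2 hr.2).le
        have hsqrt : √(r ^ 2 * (Real.exp (y r) / E₀) ^ 2) = r * (Real.exp (y r) / E₀) := by
          rw [← mul_pow]
          exact Real.sqrt_sq (by positivity)
        have hlam : S.lam r = -(1 / 2) * Real.log (1 - 2 / r * regularMass Φ 0 0 y r) := rfl
        have hlog1 : Real.log (1 - 2 / r * regularMass Φ 0 0 y r) ≤ 0 :=
          Real.log_nonpos (by linarith [hv r hr0]) (hv1 r hr0)
        have hlog2 : Real.log (2 / 3) ≤ Real.log (1 - 2 / r * regularMass Φ 0 0 y r) :=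
          Real.log_le_log (by norm_num) (hv r hr0)
        have hl1 : 1 ≤ Real.exp (S.lam r) := Real.one_le_exp (by rw [hlam]; linarith)
        have hl2 : Real.exp (S.lam r) ≤ Real.exp (-(1 / 2) * Real.log (2 / 3)) :=
          Real.exp_le_exp.2 (by rw [hlam]; linarith)
        have hw : Real.exp (S.lam r - S.μ r) * E * √(r ^ 2 * (Real.exp (y r) / E₀) ^ 2) =
            Real.exp (S.lam r) * Real.exp (2 * y r) * ε / E₀ * r := by
          have e1 : Real.exp (2 * y r) = Real.exp (y r) ^ 2 := by
            rw [← Real.exp_nat_mul]; norm_num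
          rw [hsqrt, Real.exp_sub, hμ, Real.exp_neg, e1, hε]
          have := (Real.exp_pos (y r)).ne'
          field_simp
        rw [hw]
        have hy1 : 1 ≤ Real.exp (2 * y r) := Real.one_le_exp (by linarith)
        have hy2 : Real.exp (2 * y r) ≤ Real.exp (2 * y₀) :=
          Real.exp_le_exp.2 (by linarith [hy_le r hr0.le])
        constructor
        · refine mul_le_mul_of_nonneg_right (div_le_div_of_nonneg_right ?_ hE₀.le) hr0.le
          have : 1 ≤ Real.exp (S.lam r) * Real.exp (2 * y r) := one_le_mul_of_one_le_of_one_le hl1 hy1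
          exact hε2.trans (le_mul_of_one_le_left hε0.le this)
        · refine mul_le_mul_of_nonneg_right (div_le_div_of_nonneg_right ?_ hE₀.le) hr0.le
          refine (mul_le_of_le_one_right (by positivity) hε1).trans ?_
          exact mul_le_mul hl2 hy2 (Real.exp_pos _).le (Real.exp_pos _).le

/-! ### The Schwarzschild effective potential -/

lemma one_sub_two_mul_div_pos {M r : ℝ} (hM : 0 < M) (hr : 2 * M < r) : 0 < 1 - 2 * M / r := by
  rw [sub_pos, div_lt_one (by linarith)]
  exact hr

lemma schwarzschildPot_sq {M L r : ℝ} (hM : 0 < M) (hL : 0 ≤ L) (hr : 2 * M < r) :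
    schwarzschildPot M L r ^ 2 = (1 - 2 * M / r) * (1 + L / r ^ 2) := by
  unfold schwarzschildPot
  rw [mul_pow, Real.sq_sqrt (one_sub_two_mul_div_pos hM hr).le, Real.sq_sqrt (by positivity)]

lemma schwarzschildPot_nonneg (M L r : ℝ) : 0 ≤ schwarzschildPot M L r :=
  mul_nonneg (Real.sqrt_nonneg _) (Real.sqrt_nonneg _)

lemma hasDerivAt_const_div {c r : ℝ} (hr : r ≠ 0) :
    HasDerivAt (fun r => c / r) (-(c / r ^ 2)) r := by
  refine ((hasDerivAt_const r c).fun_div (hasDerivAt_id r) hr).congr_deriv ?_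
  simp only [id]
  ring

lemma hasDerivAt_const_div_sq {c r : ℝ} (hr : r ≠ 0) :
    HasDerivAt (fun r => c / r ^ 2) (-(2 * c / r ^ 3)) r := by
  refine ((hasDerivAt_const r c).fun_div (hasDerivAt_pow 2 r) (pow_ne_zero 2 hr)).congr_deriv ?_
  field_simp
  norm_num
  ring

lemma hasDerivAt_schwarzschildPot_sq {M L r : ℝ} (hM : 0 < M) (hL : 0 ≤ L) (hr : 2 * M < r) :
    HasDerivAt (fun r => schwarzschildPot M L r ^ 2)
      (2 / r ^ 4 * (M * r ^ 2 - L * r + 3 * M * L)) r := by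
  have hr0 : r ≠ 0 := by linarith
  have h := ((hasDerivAt_const_div (c := 2 * M) hr0).const_sub 1).fun_mul
    ((hasDerivAt_const_div_sq (c := L) hr0).const_add 1)
  refine (h.congr_of_eventuallyEq ?_).congr_deriv ?_
  · filter_upwards [Ioi_mem_nhds hr] with x hx using schwarzschildPot_sq hM hL hx
  · field_simp
    ring

lemma crit_schwarzschildPot {M L r : ℝ} (hM : 0 < M) (hL : 0 ≤ L) (hr : 2 * M < r)
    (h : HasDerivAt (schwarzschildPot M L) 0 r) : M * r ^ 2 - L * r + 3 * M * L = 0 := by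
  have h1 := (h.fun_pow 2).unique (hasDerivAt_schwarzschildPot_sq hM hL hr)
  rw [mul_zero, zero_eq_mul] at h1
  refine h1.resolve_left (div_ne_zero two_ne_zero (pow_ne_zero 4 (by linarith)))

namespace ShellParameters

variable {M L₀ r₀ rL e₀ Rmin η₀ : ℝ} {χ : ℝ → ℝ}

lemma L₀_pos (P : ShellParameters M L₀ r₀ rL e₀ Rmin η₀ χ) : 0 < L₀ :=
  lt_trans (by have := P.mass_pos; positivity) P.L₀_large

lemma e₀_pos (P : ShellParameters M L₀ r₀ rL e₀ Rmin η₀ χ) : 0 < e₀ :=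
  (schwarzschildPot_nonneg _ _ _).trans_lt P.e₀_lower

lemma e₀_lt_one (P : ShellParameters M L₀ r₀ rL e₀ Rmin η₀ χ) : e₀ < 1 :=
  P.e₀_upper.trans_le (min_le_left _ _)

lemma two_M_lt_Rmin (P : ShellParameters M L₀ r₀ rL e₀ Rmin η₀ χ) : 2 * M < Rmin :=
  P.r₀_outside.trans P.r₀_lt_Rmin

lemma r₀_root (P : ShellParameters M L₀ r₀ rL e₀ Rmin η₀ χ) :
    M * r₀ ^ 2 - L₀ * r₀ + 3 * M * L₀ = 0 :=
  crit_schwarzschildPot P.mass_pos P.L₀_pos.le P.r₀_outside P.r₀_crit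

/-- The root equation says `L₀ (r₀ - 3M) = M r₀² > 0`. The sign of `r₀ - 3M` decides how the slope
of the potential changes as `L` grows beyond `L₀`. -/
lemma three_M_lt_r₀ (P : ShellParameters M L₀ r₀ rL e₀ Rmin η₀ χ) : 3 * M < r₀ := by
  have h := P.r₀_root
  have h1 : 0 < M * r₀ ^ 2 := by
    have := P.mass_pos
    have : 0 < r₀ := by linarith [P.r₀_outside]
    positivity
  have h2 : 0 < L₀ * (r₀ - 3 * M) := by linarith
  linarith [(mul_pos_iff_of_pos_left P.L₀_pos).1 h2]

lemma e₀_sq_lt_one (P : ShellParameters M L₀ r₀ rL e₀ Rmin η₀ χ) : 0 < 1 - e₀ ^ 2 := by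
  nlinarith [P.e₀_pos, P.e₀_lt_one]

/-- `2M/(1 - e₀²)` is where `1 - 2M/r = e₀²`. At `Rmin` this factor is still below `e₀²`, since its
product with `1 + L₀/Rmin² > 1` equals `e₀²`. -/
lemma Rmin_lt_Rmax (P : ShellParameters M L₀ r₀ rL e₀ Rmin η₀ χ) :
    Rmin < 2 * M / (1 - e₀ ^ 2) := by
  have h := schwarzschildPot_sq P.mass_pos P.L₀_pos.le P.two_M_lt_Rmin
  have hM := P.mass_pos
  have hR : 0 < Rmin := by linarith [P.two_M_lt_Rmin]
  have h1 := one_sub_two_mul_div_pos hM P.two_M_lt_Rmin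
  have h2 : 0 < L₀ / Rmin ^ 2 := div_pos P.L₀_pos (pow_pos hR 2)
  rw [P.Rmin_energy] at h
  have h3 : 1 - 2 * M / Rmin < e₀ ^ 2 := by nlinarith [mul_pos h1 h2]
  rw [lt_div_iff₀ P.e₀_sq_lt_one]
  have h4 : 1 - e₀ ^ 2 < 2 * M / Rmin := by linarith
  rw [lt_div_iff₀ hR] at h4
  linarith

/-- Outside `r₀`, the sublevel set of the Schwarzschild potential is bounded away from `r₀` and
from infinity. -/
lemma mem_Ioo_of_pot_lt (P : ShellParameters M L₀ r₀ rL e₀ Rmin η₀ χ) {r : ℝ} (hr : r₀ < r)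
    (h : (1 - 2 * M / r) * (1 + L₀ / r ^ 2) < e₀ ^ 2) :
    r ∈ Ioo Rmin (2 * M / (1 - e₀ ^ 2)) := by
  have hM := P.mass_pos
  have hr2 : 2 * M < r := P.r₀_outside.trans hr
  have hr0 : 0 < r := by linarith
  constructor
  · by_contra! hcon
    have hroot := P.r₀_root
    have hroot' := crit_schwarzschildPot hM P.L₀_pos.le (P.r₀_outside.trans P.r₀_lt_rL) P.rL_crit
    -- Vieta's formula for the roots `r₀ ≠ rL`. The quadratic is thus `M (x - r₀) (x - rL)`, and the
    -- squared potential is nonincreasing between the roots.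
    have hsum : M * (r₀ + rL) = L₀ := by
      have : (rL - r₀) * (M * (r₀ + rL) - L₀) = 0 := by linarith
      rcases mul_eq_zero.1 this with h | h
      · linarith [P.r₀_lt_rL]
      · linarith
    have hanti : AntitoneOn (fun r => schwarzschildPot M L₀ r ^ 2) (Icc r₀ rL) := by
      have hd : ∀ x ∈ Icc r₀ rL, HasDerivAt (fun r => schwarzschildPot M L₀ r ^ 2) _ x :=
        fun x hx => hasDerivAt_schwarzschildPot_sq hM P.L₀_pos.le (P.r₀_outside.trans_le hx.1)
      refine antitoneOn_of_deriv_nonpos (convex_Icc _ _)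
        (fun x hx => (hd x hx).continuousAt.continuousWithinAt)
        (fun x hx => (hd x (interior_subset hx)).differentiableAt.differentiableWithinAt)
        fun x hx => ?_
      have hx := interior_subset hx
      rw [(hd x hx).deriv]
      refine mul_nonpos_of_nonneg_of_nonpos (by positivity) ?_
      have e : M * x ^ 2 - L₀ * x + 3 * M * L₀ = -(M * ((x - r₀) * (rL - x))) := by
        have : 3 * M * L₀ = L₀ * r₀ - M * r₀ ^ 2 := by linarith
        rw [this, ← hsum]; ring
      rw [e, neg_nonpos]
      exact mul_nonneg hM.le (mul_nonneg (by linarith [hx.1]) (by linarith [hx.2]))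
    have h1 := hanti ⟨hr.le, hcon.trans P.Rmin_lt_rL.le⟩ ⟨P.r₀_lt_Rmin.le, P.Rmin_lt_rL.le⟩ hcon
    simp only [P.Rmin_energy, schwarzschildPot_sq hM P.L₀_pos.le hr2] at h1
    linarith
  · by_contra! hcon
    rw [div_le_iff₀ P.e₀_sq_lt_one] at hcon
    have h1 : 2 * M / r ≤ 1 - e₀ ^ 2 := by rw [div_le_iff₀ hr0]; linarith
    have h2 : 0 ≤ L₀ / r ^ 2 := (div_pos P.L₀_pos (pow_pos hr0 2)).le
    nlinarith [mul_nonneg (one_sub_two_mul_div_pos hM hr2).le h2]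

end ShellParameters

/-! ### A priori estimates for shell solutions -/

/-- A shell solution together with the standing assumptions on the data. -/
structure ShellSetting (M l L₀ r₀ rL e₀ Rmin η₀ : ℝ) (χ Φ : ℝ → ℝ) (δ Eδ : ℝ) (y : ℝ → ℝ) :
    Prop where
  l_gt : -(1 / 2) < l
  ansatz : BasicAnsatz Φ
  params : ShellParameters M L₀ r₀ rL e₀ Rmin η₀ χ
  δ_pos : 0 < δ
  sol : IsShellSolution M Φ l L₀ r₀ e₀ χ δ Eδ y

namespace ShellSetting

variable {M l L₀ r₀ rL e₀ Rmin η₀ : ℝ} {χ Φ : ℝ → ℝ} {δ Eδ : ℝ} {y : ℝ → ℝ}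

lemma density_of_le (S : ShellSetting M l L₀ r₀ rL e₀ Rmin η₀ χ Φ δ Eδ y) {r : ℝ} (hr : r ≤ r₀) :
    shellDensity Φ l L₀ r₀ χ δ y r = 0 := by
  rw [shellDensity, S.params.χ_zero _ (by linarith), mul_zero, zero_mul]

lemma pressure_of_le (S : ShellSetting M l L₀ r₀ rL e₀ Rmin η₀ χ Φ δ Eδ y) {r : ℝ} (hr : r ≤ r₀) :
    shellPressure Φ l L₀ r₀ χ δ y r = 0 := by
  rw [shellPressure, S.params.χ_zero _ (by linarith), mul_zero, zero_mul]

lemma r₀_pos (S : ShellSetting M l L₀ r₀ rL e₀ Rmin η₀ χ Φ δ Eδ y) : 0 < r₀ := by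
  linarith [S.params.mass_pos, S.params.r₀_outside]

lemma density_nonneg (S : ShellSetting M l L₀ r₀ rL e₀ Rmin η₀ χ Φ δ Eδ y) (r : ℝ) :
    0 ≤ shellDensity Φ l L₀ r₀ χ δ y r := by
  rcases le_total r r₀ with h | h
  · rw [S.density_of_le h]
  · exact mul_nonneg (mul_nonneg S.δ_pos.le (S.params.χ_nonneg _))
      (densityG_nonneg S.ansatz S.l_gt S.params.L₀_pos.le (S.r₀_pos.le.trans h) _)

lemma pressure_nonneg (S : ShellSetting M l L₀ r₀ rL e₀ Rmin η₀ χ Φ δ Eδ y) (r : ℝ) :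
    0 ≤ shellPressure Φ l L₀ r₀ χ δ y r := by
  rcases le_total r r₀ with h | h
  · rw [S.pressure_of_le h]
  · exact mul_nonneg (mul_nonneg S.δ_pos.le (S.params.χ_nonneg _))
      (pressureH_nonneg S.ansatz S.l_gt S.params.L₀_pos.le (S.r₀_pos.le.trans h) _)

lemma y_differentiableAt (S : ShellSetting M l L₀ r₀ rL e₀ Rmin η₀ χ Φ δ Eδ y) {r : ℝ}
    (hr : 2 * M < r) : DifferentiableAt ℝ y r :=
  (S.sol.ode r hr).differentiableAt

/-- The cut-off annihilates everything to the left of `r₀`, including the singularity at the origin,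
so continuity holds on the whole line. -/
lemma continuous_density (S : ShellSetting M l L₀ r₀ rL e₀ Rmin η₀ χ Φ δ Eδ y) :
    Continuous (shellDensity Φ l L₀ r₀ χ δ y) := by
  rw [continuous_iff_continuousAt]
  intro r
  rcases lt_or_ge r r₀ with h | h
  · refine (continuousAt_const (y := (0 : ℝ))).congr ?_
    filter_upwards [Iio_mem_nhds h] with x hx
    rw [S.density_of_le (le_of_lt hx)]
  · have hr : 2 * M < r := S.params.r₀_outside.trans_le h
    have hr0 : r ≠ 0 := (S.r₀_pos.trans_le h).ne'
    have hy : ContinuousAt y r := (S.y_differentiableAt hr).continuousAt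
    have hχ : ContinuousAt χ (r - r₀) := S.params.χ_smooth.continuous.continuousAt
    have h1 : ContinuousAt (fun r => δ * χ (r - r₀)) r :=
      continuousAt_const.mul (ContinuousAt.comp (f := fun r => r - r₀) hχ (by fun_prop))
    have h2 : ContinuousAt (fun r => densityG Φ l L₀ r (y r)) r := by
      rw [funext fun r => densityG_eq S.ansatz S.l_gt S.params.L₀_pos.le r (y r)]
      refine ((continuousAt_const.mul (continuousAt_id.rpow_const (Or.inl hr0))).mul
        (continuousAt_const.mul hy).rexp).mul ?_
      exact continuousAt_powerMoment S.ansatz.intervalIntegrable_mul_sq (by linarith [S.l_gt])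
        (continuousAt_const.mul hy).rexp
        (continuousAt_const.add (continuousAt_const.div (continuousAt_id.pow 2)
          (pow_ne_zero 2 hr0)))
    exact h1.mul h2

lemma mass_deriv (S : ShellSetting M l L₀ r₀ rL e₀ Rmin η₀ χ Φ δ Eδ y) (r : ℝ) :
    HasDerivAt (shellMass M Φ l L₀ r₀ χ δ y)
      (4 * Real.pi * r ^ 2 * shellDensity Φ l L₀ r₀ χ δ y r) r := by
  have hc : Continuous fun s => s ^ 2 * shellDensity Φ l L₀ r₀ χ δ y s :=
    (continuous_id.pow 2).mul S.continuous_density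
  refine (((intervalIntegral.integral_hasDerivAt_right (hc.intervalIntegrable _ _)
    (hc.stronglyMeasurableAtFilter _ _) hc.continuousAt).const_mul
    (4 * Real.pi)).const_add M).congr_deriv (by ring)

lemma M_le_mass (S : ShellSetting M l L₀ r₀ rL e₀ Rmin η₀ χ Φ δ Eδ y) {r : ℝ} (hr : 2 * M < r) :
    M ≤ shellMass M Φ l L₀ r₀ χ δ y r := by
  have : 0 ≤ ∫ s in (2 * M)..r, s ^ 2 * shellDensity Φ l L₀ r₀ χ δ y s :=
    intervalIntegral.integral_nonneg hr.le fun s _ =>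
      mul_nonneg (sq_nonneg s) (S.density_nonneg s)
  have := mul_nonneg (by positivity : 0 ≤ 4 * Real.pi) this
  unfold shellMass
  linarith

lemma one_sub_pos (S : ShellSetting M l L₀ r₀ rL e₀ Rmin η₀ χ Φ δ Eδ y) {r : ℝ} (hr : 2 * M < r) :
    0 < 1 - 2 / r * shellMass M Φ l L₀ r₀ χ δ y r := by
  have hr0 : 0 < r := by linarith [S.params.mass_pos]
  rw [sub_pos, div_mul_eq_mul_div, div_lt_one hr0]
  exact S.sol.noHorizon r hr

/-- The metric coefficient of the shell is dominated by the vacuum one. -/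
lemma exp_two_mul_le (S : ShellSetting M l L₀ r₀ rL e₀ Rmin η₀ χ Φ δ Eδ y) {r : ℝ}
    (hr : 2 * M < r) : Real.exp (2 * y r) * (1 - 2 * M / r) ≤ e₀ ^ 2 := by
  have hM := S.params.mass_pos
  have hy : y r ≤ Real.log e₀ - 1 / 2 * Real.log (1 - 2 * M / r) := by
    rcases le_or_gt r (4 * M) with h | h
    · exact (S.sol.inner r ⟨hr, h⟩).le
    · have hd : ∀ x, 2 * M < x → HasDerivAt
          (fun r => y r + 1 / 2 * Real.log (1 - 2 * M / r)) _ x := fun x hx =>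
        (S.sol.ode x hx).fun_add ((((hasDerivAt_const_div (c := 2 * M)
          (by linarith : x ≠ 0)).const_sub 1).log
            (one_sub_two_mul_div_pos hM hx).ne').const_mul (1 / 2))
      -- Extra mass and nonnegative pressure only make `y` decrease faster than the vacuum solution,
      -- with which it agrees at `4M`.
      have hanti : AntitoneOn (fun r => y r + 1 / 2 * Real.log (1 - 2 * M / r)) (Ici (4 * M)) := by
        have h4 : ∀ x ∈ Ici (4 * M), 2 * M < x := fun x hx => by
          have : 4 * M ≤ x := hx
          linarith
        refine antitoneOn_of_deriv_nonpos (convex_Ici _)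
          (fun x hx => (hd x (h4 x hx)).continuousAt.continuousWithinAt)
          (fun x hx => (hd x (h4 x (interior_subset hx))).differentiableAt.differentiableWithinAt)
          fun x hx => ?_
        have hx := h4 x (interior_subset hx)
        have hx0 : 0 < x := by linarith
        rw [(hd x hx).deriv]
        have h1 := S.one_sub_pos hx
        have h2 := S.M_le_mass hx
        have h3 := S.pressure_nonneg x
        have h5 := one_sub_two_mul_div_pos hM hx
        have h6 : 1 / (1 - 2 * M / x) ≤ 1 / (1 - 2 / x * shellMass M Φ l L₀ r₀ χ δ y x) := by
          refine one_div_le_one_div_of_le h1 ?_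
          have : 2 / x * M ≤ 2 / x * shellMass M Φ l L₀ r₀ χ δ y x :=
            mul_le_mul_of_nonneg_left h2 (by positivity)
          have e : 2 * M / x = 2 / x * M := by ring
          linarith
        have h7 : M / x ^ 2 ≤ shellMass M Φ l L₀ r₀ χ δ y x / x ^ 2 +
            4 * Real.pi * x * shellPressure Φ l L₀ r₀ χ δ y x := by
          have := div_le_div_of_nonneg_right h2 (sq_nonneg x)
          have : 0 ≤ 4 * Real.pi * x * shellPressure Φ l L₀ r₀ χ δ y x := by positivity
          linarith
        have h8 := mul_le_mul h6 h7 (by positivity) (by positivity)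
        have e : 1 / 2 * (- -(2 * M / x ^ 2) / (1 - 2 * M / x)) =
            1 / (1 - 2 * M / x) * (M / x ^ 2) := by ring
        rw [e]
        linarith
      have h1 := hanti self_mem_Ici (le_of_lt h : r ∈ Ici (4 * M)) h.le
      simp only [S.sol.inner (4 * M) ⟨by linarith, le_rfl⟩] at h1
      linarith
  have h1 := one_sub_two_mul_div_pos hM hr
  calc Real.exp (2 * y r) * (1 - 2 * M / r)
      ≤ Real.exp (2 * (Real.log e₀ - 1 / 2 * Real.log (1 - 2 * M / r))) * (1 - 2 * M / r) :=
        mul_le_mul_of_nonneg_right (Real.exp_le_exp.2 (by linarith)) h1.le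
    _ = Real.exp (Real.log e₀ + Real.log e₀) := by
        nth_rewrite 2 [← Real.exp_log h1]
        rw [← Real.exp_add]; ring_nf
    _ = e₀ ^ 2 := by rw [Real.exp_add, Real.exp_log S.params.e₀_pos, sq]

/-- Multiplying by `1 - 2M/r` and using the domination by vacuum, the hypothesis becomes a sublevel
condition for the Schwarzschild potential, in which `δ` no longer occurs. -/
lemma mem_Ioo (S : ShellSetting M l L₀ r₀ rL e₀ Rmin η₀ χ Φ δ Eδ y) {r : ℝ} (hr : r₀ < r)
    (h : 1 + L₀ / r ^ 2 < Real.exp (2 * y r)) : r ∈ Ioo Rmin (2 * M / (1 - e₀ ^ 2)) := by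
  have hr2 := S.params.r₀_outside.trans hr
  have h1 := one_sub_two_mul_div_pos S.params.mass_pos hr2
  refine S.params.mem_Ioo_of_pot_lt hr ?_
  have := mul_lt_mul_of_pos_right h h1
  linarith [S.exp_two_mul_le hr2]

lemma χ_eq_one (S : ShellSetting M l L₀ r₀ rL e₀ Rmin η₀ χ Φ δ Eδ y) {r : ℝ}
    (hr : r₀ + η₀ ≤ r) : χ (r - r₀) = 1 :=
  S.params.χ_one _ (by linarith)

/-- Matter is confined to a bounded region that does not depend on `δ`. -/
lemma eq_zero_of_notMem (S : ShellSetting M l L₀ r₀ rL e₀ Rmin η₀ χ Φ δ Eδ y) {r : ℝ}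
    (hr : r ∉ Ioo Rmin (2 * M / (1 - e₀ ^ 2))) :
    shellDensity Φ l L₀ r₀ χ δ y r = 0 ∧ shellPressure Φ l L₀ r₀ χ δ y r = 0 := by
  rcases le_or_gt r r₀ with h | h
  · exact ⟨S.density_of_le h, S.pressure_of_le h⟩
  · have hB : 0 ≤ 1 + L₀ / r ^ 2 := by have := S.params.L₀_pos; positivity
    have h1 : 1 ≤ Real.exp (-y r) * √(1 + L₀ / r ^ 2) := by
      by_contra! hcon
      exact hr (S.mem_Ioo h ((exp_neg_mul_sqrt_lt_one_iff hB).1 hcon))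
    rw [shellDensity, shellPressure, densityG_eq_zero h1, pressureH_eq_zero h1]
    simp

lemma density_pos (S : ShellSetting M l L₀ r₀ rL e₀ Rmin η₀ χ Φ δ Eδ y)
    (hpos : PositiveAtCutoff Φ) {r : ℝ} (hr : Rmin < r)
    (h : 1 + L₀ / r ^ 2 < Real.exp (2 * y r)) : 0 < shellDensity Φ l L₀ r₀ χ δ y r := by
  have hr0 : 0 < r := S.r₀_pos.trans (S.params.r₀_lt_Rmin.trans hr)
  rw [shellDensity, S.χ_eq_one (S.params.η₀_small.trans hr).le, mul_one]
  refine mul_pos S.δ_pos (densityG_pos S.ansatz hpos S.l_gt S.params.L₀_pos.le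
    (Real.rpow_pos_of_pos hr0 _) ?_)
  rwa [exp_neg_mul_sqrt_lt_one_iff (by have := S.params.L₀_pos; positivity)]

end ShellSetting

/-! ### Bounds on the matter quantities of a shell, uniform in the solution -/

namespace ShellSetting

variable {M l L₀ r₀ rL e₀ Rmin η₀ : ℝ} {χ Φ : ℝ → ℝ}

lemma exp_two_mul_le_const {δ Eδ : ℝ} {y : ℝ → ℝ}
    (S : ShellSetting M l L₀ r₀ rL e₀ Rmin η₀ χ Φ δ Eδ y) {r : ℝ} (hr : Rmin ≤ r) :
    Real.exp (2 * y r) ≤ e₀ ^ 2 / (1 - 2 * M / Rmin) := by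
  have hM := S.params.mass_pos
  have h0 := one_sub_two_mul_div_pos hM S.params.two_M_lt_Rmin
  have hR : 0 < Rmin := by linarith [S.params.two_M_lt_Rmin]
  rw [le_div_iff₀ h0]
  refine le_trans (mul_le_mul_of_nonneg_left ?_ (Real.exp_pos _).le)
    (S.exp_two_mul_le (S.params.two_M_lt_Rmin.trans_le hr))
  have : 2 * M / r ≤ 2 * M / Rmin := div_le_div_of_nonneg_left (by positivity) hR hr
  linarith

lemma exp_le_one_add (v : ℝ) : Real.exp v ≤ 1 + Real.exp (2 * v) := by
  have e : Real.exp (2 * v) = Real.exp v ^ 2 := by rw [← Real.exp_nat_mul]; norm_num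
  rw [e]
  nlinarith [sq_nonneg (Real.exp v - 1), sq_nonneg (Real.exp v)]

lemma exists_rpow_bound (P : ShellParameters M L₀ r₀ rL e₀ Rmin η₀ χ) (s : ℝ) :
    ∃ K, 0 < K ∧ ∀ r ∈ Icc Rmin (2 * M / (1 - e₀ ^ 2)), |r ^ s| ≤ K := by
  have hR : 0 < Rmin := by linarith [P.two_M_lt_Rmin, P.mass_pos]
  obtain ⟨K, hK⟩ := (isCompact_Icc (a := Rmin) (b := 2 * M / (1 - e₀ ^ 2))).exists_bound_of_continuousOn
    (f := fun r : ℝ => r ^ s)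
    (fun r hr => (continuousAt_id.rpow_const
      (Or.inl (hR.trans_le hr.1).ne')).continuousWithinAt)
  exact ⟨max K 1, by positivity, fun r hr => (hK r hr).trans (le_max_left _ _)⟩

/-- The matter lives in a fixed compact interval where `e^(2y)` is bounded by the constant `A`, so
each factor of `G` is bounded before `δ` and `y` are chosen. The summand `1` only makes `K`
positive. -/
lemma exists_density_bound (hl : -(1 / 2) < l) (hΦ : BasicAnsatz Φ)
    (P : ShellParameters M L₀ r₀ rL e₀ Rmin η₀ χ) :
    ∃ K, 0 < K ∧ ∀ (δ Eδ : ℝ) (y : ℝ → ℝ),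
      ShellSetting M l L₀ r₀ rL e₀ Rmin η₀ χ Φ δ Eδ y →
        ∀ r, shellDensity Φ l L₀ r₀ χ δ y r ≤ K * δ := by
  obtain ⟨Kr, hKr0, hKr⟩ := exists_rpow_bound P (2 * l)
  set A := e₀ ^ 2 / (1 - 2 * M / Rmin) with hA
  have hA0 : 0 < A := div_pos (pow_pos P.e₀_pos 2)
    (one_sub_two_mul_div_pos P.mass_pos P.two_M_lt_Rmin)
  set I := ∫ α in (0 : ℝ)..1, |Φ α * (1 - α) ^ 2| with hI
  have hI0 : 0 ≤ I := intervalIntegral.integral_nonneg zero_le_one fun _ _ => abs_nonneg _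
  have hc := cConst_pos hl
  refine ⟨2 * Real.pi * cConst l * Kr * (1 + A) ^ 3 * (A ^ (l + 1 / 2) * I) + 1, by positivity,
    fun δ Eδ y S r => ?_⟩
  by_cases hr : r ∈ Ioo Rmin (2 * M / (1 - e₀ ^ 2))
  swap
  · rw [(S.eq_zero_of_notMem hr).1]
    have := S.δ_pos
    positivity
  have hrI := Ioo_subset_Icc_self hr
  have hr0 : 0 < r := S.r₀_pos.trans (S.params.r₀_lt_Rmin.trans hr.1)
  have he := S.exp_two_mul_le_const hrI.1
  rw [shellDensity, S.χ_eq_one (P.η₀_small.trans hr.1).le, mul_one, mul_comm]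
  refine mul_le_mul_of_nonneg_right ?_ S.δ_pos.le
  rw [densityG_eq hΦ hl P.L₀_pos.le]
  have h1 : r ^ (2 * l) ≤ Kr := (le_abs_self _).trans (hKr r hrI)
  have h2 : Real.exp (3 * y r) ≤ (1 + A) ^ 3 := by
    have e : Real.exp (3 * y r) = Real.exp (y r) ^ 3 := by rw [← Real.exp_nat_mul]; norm_num
    rw [e]
    exact pow_le_pow_left₀ (Real.exp_pos _).le ((exp_le_one_add _).trans (by linarith)) 3
  have h3 : powerMoment (fun α => Φ α * (1 - α) ^ 2) (l + 1 / 2) (Real.exp (2 * y r))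
      (1 + L₀ / r ^ 2) ≤ A ^ (l + 1 / 2) * I := by
    refine (le_abs_self _).trans ((abs_powerMoment_le hΦ.intervalIntegrable_mul_sq (by linarith)
      (Real.exp_pos _).le (by have := P.L₀_pos; positivity)).trans ?_)
    exact mul_le_mul_of_nonneg_right (Real.rpow_le_rpow (Real.exp_pos _).le he (by linarith)) hI0
  have h4 : 0 ≤ powerMoment (fun α => Φ α * (1 - α) ^ 2) (l + 1 / 2) (Real.exp (2 * y r))
      (1 + L₀ / r ^ 2) := powerMoment_nonneg
        (fun α => mul_nonneg (hΦ.nonneg α) (sq_nonneg _)) _ _ _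
  have h5 : 0 ≤ r ^ (2 * l) := Real.rpow_nonneg hr0.le _
  refine le_trans ?_ (le_add_of_nonneg_right zero_le_one)
  gcongr

lemma abs_powerMoment_le_of_le {θ : ℝ → ℝ} (hθ : IntervalIntegrable θ volume 0 1) {q A A₁ B : ℝ}
    (hq : 0 ≤ q) (hA : 0 ≤ A) (hA₁ : A ≤ A₁) (hB : 0 ≤ B) :
    |powerMoment θ q A B| ≤ A₁ ^ q * ∫ α in (0 : ℝ)..1, |θ α| :=
  (abs_powerMoment_le hθ hq hA hB).trans (mul_le_mul_of_nonneg_right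
    (Real.rpow_le_rpow hA hA₁ hq)
    (intervalIntegral.integral_nonneg zero_le_one fun _ _ => abs_nonneg _))

lemma exists_pressure_bound (hl : -(1 / 2) < l) (hΦ : BasicAnsatz Φ)
    (P : ShellParameters M L₀ r₀ rL e₀ Rmin η₀ χ) :
    ∃ K, 0 < K ∧ ∀ (δ Eδ : ℝ) (y : ℝ → ℝ),
      ShellSetting M l L₀ r₀ rL e₀ Rmin η₀ χ Φ δ Eδ y →
        ∀ r, shellPressure Φ l L₀ r₀ χ δ y r ≤ K * δ := by
  obtain ⟨Kr, hKr0, hKr⟩ := exists_rpow_bound P (2 * l)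
  set A := e₀ ^ 2 / (1 - 2 * M / Rmin) with hA
  have hA0 : 0 < A := div_pos (pow_pos P.e₀_pos 2)
    (one_sub_two_mul_div_pos P.mass_pos P.two_M_lt_Rmin)
  set I := ∫ α in (0 : ℝ)..1, |Φ α| with hI
  have hI0 : 0 ≤ I := intervalIntegral.integral_nonneg zero_le_one fun _ _ => abs_nonneg _
  have hd := dConst_nonneg l
  refine ⟨2 * Real.pi * dConst l * Kr * (1 + A) * (A ^ (l + 3 / 2) * I) + 1, by positivity,
    fun δ Eδ y S r => ?_⟩
  by_cases hr : r ∈ Ioo Rmin (2 * M / (1 - e₀ ^ 2))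
  swap
  · rw [(S.eq_zero_of_notMem hr).2]
    have := S.δ_pos
    positivity
  have hrI := Ioo_subset_Icc_self hr
  have hr0 : 0 < r := S.r₀_pos.trans (S.params.r₀_lt_Rmin.trans hr.1)
  have he := S.exp_two_mul_le_const hrI.1
  rw [shellPressure, S.χ_eq_one (P.η₀_small.trans hr.1).le, mul_one, mul_comm]
  refine mul_le_mul_of_nonneg_right ?_ S.δ_pos.le
  rw [pressureH_eq hΦ hl P.L₀_pos.le]
  have h1 : r ^ (2 * l) ≤ Kr := (le_abs_self _).trans (hKr r hrI)
  have h2 : Real.exp (y r) ≤ 1 + A := (exp_le_one_add _).trans (by linarith)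
  have h3 := (le_abs_self _).trans (abs_powerMoment_le_of_le hΦ.intervalIntegrable
    (by linarith : 0 ≤ l + 3 / 2) (Real.exp_pos (2 * y r)).le he
    (by have := P.L₀_pos; positivity : 0 ≤ 1 + L₀ / r ^ 2))
  have h4 := powerMoment_nonneg hΦ.nonneg (l + 3 / 2) (Real.exp (2 * y r)) (1 + L₀ / r ^ 2)
  have h5 : 0 ≤ r ^ (2 * l) := Real.rpow_nonneg hr0.le _
  refine le_trans ?_ (le_add_of_nonneg_right zero_le_one)
  gcongr

lemma exists_mass_bound (hl : -(1 / 2) < l) (hΦ : BasicAnsatz Φ)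
    (P : ShellParameters M L₀ r₀ rL e₀ Rmin η₀ χ) :
    ∃ K, 0 < K ∧ ∀ (δ Eδ : ℝ) (y : ℝ → ℝ),
      ShellSetting M l L₀ r₀ rL e₀ Rmin η₀ χ Φ δ Eδ y →
        ∀ r ∈ Icc Rmin (2 * M / (1 - e₀ ^ 2)), shellMass M Φ l L₀ r₀ χ δ y r - M ≤ K * δ := by
  obtain ⟨K, hK0, hK⟩ := exists_density_bound hl hΦ P
  set R := 2 * M / (1 - e₀ ^ 2) with hR
  have hM := P.mass_pos
  have hR0 : 0 < R := by linarith [P.Rmin_lt_Rmax, P.two_M_lt_Rmin]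
  refine ⟨4 * Real.pi * (R ^ 2 * K * R), by positivity, fun δ Eδ y S r hr => ?_⟩
  have hr2 : 2 * M ≤ r := P.two_M_lt_Rmin.le.trans hr.1
  have hb : ‖∫ s in (2 * M)..r, s ^ 2 * shellDensity Φ l L₀ r₀ χ δ y s‖ ≤
      R ^ 2 * (K * δ) * |r - 2 * M| := by
    refine intervalIntegral.norm_integral_le_of_norm_le_const fun s hs => ?_
    rw [uIoc_of_le hr2] at hs
    have hs0 : 0 ≤ s := by linarith [hs.1]
    rw [norm_mul, Real.norm_of_nonneg (sq_nonneg s), Real.norm_of_nonneg (S.density_nonneg s)]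
    exact mul_le_mul (pow_le_pow_left₀ hs0 (hs.2.trans hr.2) 2) (hK δ Eδ y S s)
      (S.density_nonneg s) (sq_nonneg R)
  rw [abs_of_nonneg (by linarith)] at hb
  have hδ := S.δ_pos
  have h1 : R ^ 2 * (K * δ) * (r - 2 * M) ≤ R ^ 2 * (K * δ) * R :=
    mul_le_mul_of_nonneg_left (by linarith [hr.2]) (by positivity)
  have h2 := ((le_abs_self _).trans hb).trans h1
  rw [shellMass, add_sub_cancel_left]
  calc _ ≤ 4 * Real.pi * (R ^ 2 * (K * δ) * R) := mul_le_mul_of_nonneg_left h2 (by positivity)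
    _ = _ := by ring

lemma exists_deriv_bound (hl : -(1 / 2) < l) (hΦ : BasicAnsatz Φ)
    (P : ShellParameters M L₀ r₀ rL e₀ Rmin η₀ χ) :
    ∃ K δ₁, 0 < K ∧ 0 < δ₁ ∧ ∀ (δ Eδ : ℝ) (y : ℝ → ℝ), δ ≤ δ₁ →
      ShellSetting M l L₀ r₀ rL e₀ Rmin η₀ χ Φ δ Eδ y →
        ∀ r ∈ Icc Rmin (2 * M / (1 - e₀ ^ 2)), |deriv y r| ≤ K := by
  obtain ⟨Km, hKm0, hKm⟩ := exists_mass_bound hl hΦ P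
  obtain ⟨Kp, hKp0, hKp⟩ := exists_pressure_bound hl hΦ P
  set R := 2 * M / (1 - e₀ ^ 2) with hR
  have hM := P.mass_pos
  have hRm : 0 < Rmin := by linarith [P.two_M_lt_Rmin]
  have hR0 : 0 < R := hRm.trans P.Rmin_lt_Rmax
  have hv := one_sub_two_mul_div_pos hM P.two_M_lt_Rmin
  set v := 1 - 2 * M / Rmin with hvdef
  -- The threshold gives an added mass `Km δ ≤ v Rmin / 4`, hence `1 - 2 (M + m)/r ≥ v/2`.
  refine ⟨2 / v * (R / Rmin ^ 2 + 4 * Real.pi * R * Kp), min 1 (v * Rmin / (4 * Km)),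
    by positivity, by positivity, fun δ Eδ y hδ S r hr => ?_⟩
  have hr2 : 2 * M < r := P.two_M_lt_Rmin.trans_le hr.1
  have hr0 : 0 < r := by linarith
  have hδ0 := S.δ_pos
  have hδ1 : δ ≤ 1 := hδ.trans (min_le_left _ _)
  have hδ2 : Km * δ ≤ v * Rmin / 4 := by
    have := hδ.trans (min_le_right _ _)
    rw [le_div_iff₀ (by positivity)] at this
    linarith
  have hm := hKm δ Eδ y S r hr
  have hmM := S.M_le_mass hr2
  have hp := hKp δ Eδ y S r
  have hp0 := S.pressure_nonneg r
  have h1 : v / 2 ≤ 1 - 2 / r * shellMass M Φ l L₀ r₀ χ δ y r := by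
    have e1 : 2 / r * shellMass M Φ l L₀ r₀ χ δ y r ≤ 2 * (M + v * Rmin / 4) / Rmin := by
      rw [div_mul_eq_mul_div]
      exact div_le_div₀ (by positivity) (by linarith) hRm hr.1
    have e2 : 2 * (M + v * Rmin / 4) / Rmin = 2 * M / Rmin + v / 2 := by
      field_simp
      ring
    linarith
  have h2 : shellMass M Φ l L₀ r₀ χ δ y r ≤ R := by
    have := S.sol.noHorizon r hr2
    linarith [hr.2]
  rw [(S.sol.ode r hr2).deriv, neg_mul, abs_neg, abs_of_nonneg]
  · have h3 : 1 / (1 - 2 / r * shellMass M Φ l L₀ r₀ χ δ y r) ≤ 2 / v := by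
      rw [← one_div_div v 2]
      exact one_div_le_one_div_of_le (by positivity) h1
    have h4 : shellMass M Φ l L₀ r₀ χ δ y r / r ^ 2 ≤ R / Rmin ^ 2 :=
      div_le_div₀ hR0.le h2 (by positivity) (pow_le_pow_left₀ hRm.le hr.1 2)
    have h5 : 4 * Real.pi * r * shellPressure Φ l L₀ r₀ χ δ y r ≤ 4 * Real.pi * R * Kp := by
      refine mul_le_mul (mul_le_mul_of_nonneg_left hr.2 (by positivity))
        (hp.trans (mul_le_of_le_one_right hKp0.le hδ1)) hp0 (by positivity)
    have h6 : 0 ≤ shellMass M Φ l L₀ r₀ χ δ y r := hM.le.trans hmM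
    exact mul_le_mul h3 (add_le_add h4 h5) (by positivity) (by positivity)
  · have h6 : 0 ≤ shellMass M Φ l L₀ r₀ χ δ y r := hM.le.trans hmM
    have h7 := S.one_sub_pos hr2
    positivity

/-- Since `l + 3/2 > 1`, the pressure moment is differentiable for merely bounded `Φ`; its
derivative involves only moments of exponent `l + 1/2` and `y'`, all bounded independently of `δ`.
-/
lemma exists_pressure_deriv_bound (hl : -(1 / 2) < l) (hΦ : BasicAnsatz Φ)
    (P : ShellParameters M L₀ r₀ rL e₀ Rmin η₀ χ) :
    ∃ K δ₁, 0 < K ∧ 0 < δ₁ ∧ ∀ (δ Eδ : ℝ) (y : ℝ → ℝ), δ ≤ δ₁ →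
      ShellSetting M l L₀ r₀ rL e₀ Rmin η₀ χ Φ δ Eδ y →
        ∀ r ∈ Icc Rmin (2 * M / (1 - e₀ ^ 2)),
          ∃ p', HasDerivAt (shellPressure Φ l L₀ r₀ χ δ y) p' r ∧ |p'| ≤ K * δ := by
  obtain ⟨Ky, δ₁, hKy0, hδ₁, hKy⟩ := exists_deriv_bound hl hΦ P
  obtain ⟨Kr, hKr0, hKr⟩ := exists_rpow_bound P (2 * l)
  obtain ⟨Kr', hKr0', hKr'⟩ := exists_rpow_bound P (2 * l - 1)
  set R := 2 * M / (1 - e₀ ^ 2) with hR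
  have hM := P.mass_pos
  have hL₀ := P.L₀_pos
  have hRm : 0 < Rmin := by linarith [P.two_M_lt_Rmin]
  set A := e₀ ^ 2 / (1 - 2 * M / Rmin) with hA
  have hA0 : 0 < A := div_pos (pow_pos P.e₀_pos 2)
    (one_sub_two_mul_div_pos P.mass_pos P.two_M_lt_Rmin)
  set I := ∫ α in (0 : ℝ)..1, |Φ α| with hI
  have hI0 : 0 ≤ I := intervalIntegral.integral_nonneg zero_le_one fun _ _ => abs_nonneg _
  set I' := ∫ α in (0 : ℝ)..1, |Φ α * (1 - α) ^ 2| with hI'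
  have hI0' : 0 ≤ I' := intervalIntegral.integral_nonneg zero_le_one fun _ _ => abs_nonneg _
  have hd := dConst_nonneg l
  have hq : 0 < l + 3 / 2 := by linarith
  set J := A ^ (l + 3 / 2) * I with hJ
  set J' := (l + 3 / 2) * (2 * Ky * A * (A ^ (l + 3 / 2 - 1) * I') +
    2 * L₀ / Rmin ^ 3 * (A ^ (l + 3 / 2 - 1) * I)) with hJ'
  have hJ0 : 0 ≤ J := by positivity
  have hJ0' : 0 ≤ J' := by positivity
  refine ⟨2 * Real.pi * dConst l * ((|2 * l| * Kr' * (1 + A) + Kr * ((1 + A) * Ky)) * J +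
    Kr * (1 + A) * J') + 1, δ₁, by positivity, hδ₁, fun δ Eδ y hδ S r hr => ?_⟩
  have hr2 : 2 * M < r := P.two_M_lt_Rmin.trans_le hr.1
  have hr0 : 0 < r := by linarith
  have hnhds : ∀ᶠ x in nhds r, 2 * M < x := Ioi_mem_nhds hr2
  have hyd : ∀ x, 2 * M < x → HasDerivAt y (deriv y x) x := fun x hx =>
    (S.y_differentiableAt hx).hasDerivAt
  have hyc : ContinuousAt y r := (hyd r hr2).continuousAt
  have hy'c : ContinuousAt (deriv y) r :=
    (S.sol.smooth.continuousOn_deriv_of_isOpen isOpen_Ioi le_rfl).continuousAt (Ioi_mem_nhds hr2)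
  have hmom := hasDerivAt_powerMoment (q := l + 3 / 2) hΦ.intervalIntegrable (by linarith)
    (A := fun r => Real.exp (2 * y r)) (B := fun r => 1 + L₀ / r ^ 2)
    (A' := fun r => Real.exp (2 * y r) * (2 * deriv y r)) (B' := fun r => -(2 * L₀ / r ^ 3))
    (r := r) (hnhds.mono fun x hx => ((hyd x hx).const_mul 2).exp)
    (hnhds.mono fun x hx => (hasDerivAt_const_div_sq (by linarith)).const_add 1)
    ((continuousAt_const.mul hyc).rexp.mul (continuousAt_const.mul hy'c))
    ((continuousAt_const.div (continuousAt_id.pow 3) (pow_ne_zero 3 hr0.ne')).neg)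
  have hrp : HasDerivAt (fun r : ℝ => r ^ (2 * l)) (2 * l * r ^ (2 * l - 1)) r :=
    Real.hasDerivAt_rpow_const (Or.inl hr0.ne')
  have hpH := (((hrp.fun_mul (hyd r hr2).exp).fun_mul hmom).const_mul
    (2 * Real.pi * dConst l)).const_mul δ
  refine ⟨_, hpH.congr_of_eventuallyEq ?_, ?_⟩
  -- Because `r₀ + η₀ < Rmin`, the cut-off equals `1` on a full neighbourhood of `r`, even for `r =
  -- Rmin`, and contributes no derivative.
  · filter_upwards [Ioi_mem_nhds (P.η₀_small.trans_le hr.1)] with x hx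
    rw [shellPressure, S.χ_eq_one (le_of_lt hx), mul_one, pressureH_eq hΦ hl hL₀.le]
    ring
  · have he := S.exp_two_mul_le_const hr.1
    have hB : 0 ≤ 1 + L₀ / r ^ 2 := by positivity
    have hy' := hKy δ Eδ y hδ S r hr
    have hE : Real.exp (y r) ≤ 1 + A := (exp_le_one_add _).trans (by linarith)
    have b1 := abs_powerMoment_le_of_le hΦ.intervalIntegrable hq.le
      (Real.exp_pos (2 * y r)).le he hB
    have b2 := abs_powerMoment_le_of_le hΦ.intervalIntegrable (by linarith : 0 ≤ l + 3 / 2 - 1)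
      (Real.exp_pos (2 * y r)).le he hB
    have b3 := abs_powerMoment_le_of_le hΦ.intervalIntegrable_mul_sq
      (by linarith : 0 ≤ l + 3 / 2 - 1) (Real.exp_pos (2 * y r)).le he hB
    have c1 := hKr r hr
    have c2 := hKr' r hr
    have b4 : |(l + 3 / 2) * (Real.exp (2 * y r) * (2 * deriv y r) *
        powerMoment (fun α => Φ α * (1 - α) ^ 2) (l + 3 / 2 - 1) (Real.exp (2 * y r))
          (1 + L₀ / r ^ 2) - -(2 * L₀ / r ^ 3) *
        powerMoment Φ (l + 3 / 2 - 1) (Real.exp (2 * y r)) (1 + L₀ / r ^ 2))| ≤ J' := by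
      rw [abs_mul, abs_of_pos hq, hJ']
      refine mul_le_mul_of_nonneg_left ((abs_sub _ _).trans (add_le_add ?_ ?_)) hq.le
      · rw [abs_mul, abs_mul, abs_mul, abs_two, Real.abs_exp]
        refine mul_le_mul ?_ b3 (abs_nonneg _) (by positivity)
        calc _ ≤ A * (2 * Ky) := by gcongr
          _ = _ := by ring
      · rw [abs_mul, abs_neg, abs_of_pos (by positivity : 0 < 2 * L₀ / r ^ 3)]
        refine mul_le_mul ?_ b2 (abs_nonneg _) (by positivity)
        exact div_le_div_of_nonneg_left (by positivity) (by positivity)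
          (pow_le_pow_left₀ hRm.le hr.1 3)
    rw [abs_mul, abs_of_pos S.δ_pos, mul_comm]
    refine mul_le_mul_of_nonneg_right ?_ S.δ_pos.le
    refine le_trans ?_ (le_add_of_nonneg_right zero_le_one)
    rw [abs_mul, abs_of_nonneg (by positivity : 0 ≤ 2 * Real.pi * dConst l)]
    refine mul_le_mul_of_nonneg_left ((abs_add_le _ _).trans (add_le_add ?_ ?_)) (by positivity)
    · rw [abs_mul]
      refine mul_le_mul ((abs_add_le _ _).trans (add_le_add ?_ ?_)) b1 (abs_nonneg _)
        (by positivity)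
      · rw [abs_mul, abs_mul, Real.abs_exp]
        gcongr
      · rw [abs_mul, abs_mul, Real.abs_exp]
        gcongr
    · rw [abs_mul, abs_mul, Real.abs_exp]
      refine mul_le_mul ?_ b4 (abs_nonneg _) (by positivity)
      gcongr

end ShellSetting

/-! ### The normalized slope of the effective potential of a shell -/

/-- A positive multiple of the derivative of the effective potential of a shell, written as a
perturbation of the vacuum expression. -/
noncomputable def wellSlope (M r₀ L : ℝ) (m p : ℝ → ℝ) (r : ℝ) : ℝ :=
  M * (r + r₀) - L + (M * r₀ ^ 2 - L * (r₀ - 3 * M)) / (r - r₀) +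
    ((m r - M) * (r ^ 2 + 3 * L) + 4 * Real.pi * r ^ 3 * p r * (r ^ 2 + L)) / (r - r₀)

lemma hasDerivAt_wellSlope {M r₀ L r m' p' : ℝ} {m p : ℝ → ℝ} (hr : r₀ < r)
    (hm : HasDerivAt m m' r) (hp : HasDerivAt p p' r) :
    HasDerivAt (wellSlope M r₀ L m p)
      (M - (M * r₀ ^ 2 - L * (r₀ - 3 * M)) / (r - r₀) ^ 2 +
        ((m' * (r ^ 2 + 3 * L) + (m r - M) * (2 * r) +
          (12 * Real.pi * r ^ 2 * p r + 4 * Real.pi * r ^ 3 * p') * (r ^ 2 + L) +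
          4 * Real.pi * r ^ 3 * p r * (2 * r)) / (r - r₀) -
        ((m r - M) * (r ^ 2 + 3 * L) + 4 * Real.pi * r ^ 3 * p r * (r ^ 2 + L)) /
          (r - r₀) ^ 2)) r := by
  have hne : r - r₀ ≠ 0 := (sub_pos.2 hr).ne'
  have hid : HasDerivAt (fun r => r - r₀) 1 r := (hasDerivAt_id r).sub_const r₀
  have h1 : HasDerivAt (fun r => M * (r + r₀) - L) M r := by
    simpa using (((hasDerivAt_id r).add_const r₀).const_mul M).sub_const L
  have h2 := (hasDerivAt_const r (M * r₀ ^ 2 - L * (r₀ - 3 * M))).fun_div hid hne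
  have hZ1 := (hm.sub_const M).fun_mul ((hasDerivAt_pow 2 r).add_const (3 * L))
  have hZ2 := ((((hasDerivAt_pow 3 r).const_mul (4 * Real.pi)).fun_mul hp).fun_mul
    ((hasDerivAt_pow 2 r).add_const L))
  have h3 := (hZ1.fun_add hZ2).fun_div hid hne
  refine ((h1.fun_add h2).fun_add h3).congr_deriv ?_
  field_simp
  norm_num
  ring

namespace ShellSetting

variable {M l L₀ r₀ rL e₀ Rmin η₀ : ℝ} {χ Φ : ℝ → ℝ}

/-- For small `δ` the normalized slope of the effective potential is strictly increasing. -/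
lemma exists_wellSlope_bounds (hl : -(1 / 2) < l) (hΦ : BasicAnsatz Φ)
    (P : ShellParameters M L₀ r₀ rL e₀ Rmin η₀ χ) (Λ : ℝ) :
    ∃ δ₀ C, 0 < δ₀ ∧ 0 < C ∧ ∀ (δ Eδ : ℝ) (y : ℝ → ℝ), δ ≤ δ₀ →
      ShellSetting M l L₀ r₀ rL e₀ Rmin η₀ χ Φ δ Eδ y → ∀ L, L₀ ≤ L → L ≤ Λ →
        ∀ r ∈ Icc Rmin (2 * M / (1 - e₀ ^ 2)), ∃ W',
          HasDerivAt (wellSlope M r₀ L (shellMass M Φ l L₀ r₀ χ δ y)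
            (shellPressure Φ l L₀ r₀ χ δ y)) W' r ∧ M / 2 ≤ W' ∧ W' ≤ C := by
  obtain ⟨Kρ, hKρ0, hKρ⟩ := exists_density_bound hl hΦ P
  obtain ⟨Kp, hKp0, hKp⟩ := exists_pressure_bound hl hΦ P
  obtain ⟨Km, hKm0, hKm⟩ := exists_mass_bound hl hΦ P
  obtain ⟨Kp', δ₁, hKp0', hδ₁, hKp'⟩ := exists_pressure_deriv_bound hl hΦ P
  set R := 2 * M / (1 - e₀ ^ 2) with hR
  have hM := P.mass_pos
  have hL₀ := P.L₀_pos
  have hRm : 0 < Rmin := by linarith [P.two_M_lt_Rmin]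
  have hR0 : 0 < R := hRm.trans P.Rmin_lt_Rmax
  have hr₀ : 0 < r₀ := by linarith [P.r₀_outside]
  set d := Rmin - r₀ with hd
  have hd0 : 0 < d := sub_pos.2 P.r₀_lt_Rmin
  by_cases hΛ : L₀ ≤ Λ
  swap
  · exact ⟨1, 1, one_pos, one_pos, fun δ Eδ y _ _ L h1 h2 => absurd (h1.trans h2) hΛ⟩
  have hΛ0 : 0 < Λ := hL₀.trans_le hΛ
  -- `K₁ δ` bounds the numerator of the matter term in `wellSlope`, and `K₂ δ` bounds the derivative
  -- of that numerator.
  set K₁ := Km * (R ^ 2 + 3 * Λ) + 4 * Real.pi * R ^ 3 * Kp * (R ^ 2 + Λ) with hK₁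
  set K₂ := 4 * Real.pi * R ^ 2 * Kρ * (R ^ 2 + 3 * Λ) + Km * (2 * R) +
    (12 * Real.pi * R ^ 2 * Kp + 4 * Real.pi * R ^ 3 * Kp') * (R ^ 2 + Λ) +
    4 * Real.pi * R ^ 3 * Kp * (2 * R) with hK₂
  have hK₁0 : 0 < K₁ := by positivity
  have hK₂0 : 0 < K₂ := by positivity
  -- By the quotient rule the matter changes the derivative of the slope by at most `(K₂/d + K₁/d²)
  -- δ`, which is to be at most `M/2`; here `r - r₀ ≥ d`.
  refine ⟨min δ₁ (M / 2 / (K₂ / d + K₁ / d ^ 2)),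
    M + Λ * r₀ / d ^ 2 + M / 2, by positivity, by positivity, fun δ Eδ y hδ S L hL hLΛ r hr => ?_⟩
  obtain ⟨p', hpd, hp'⟩ := hKp' δ Eδ y (hδ.trans (min_le_left _ _)) S r hr
  have hr2 : 2 * M < r := P.two_M_lt_Rmin.trans_le hr.1
  have hr0 : 0 < r := by linarith
  have hrr : r₀ < r := P.r₀_lt_Rmin.trans_le hr.1
  have hrd : d ≤ r - r₀ := by linarith [hr.1]
  have hL0 : 0 < L := hL₀.trans_le hL
  have hδ0 := S.δ_pos
  have hδ2 : (K₂ / d + K₁ / d ^ 2) * δ ≤ M / 2 := by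
    have := hδ.trans (min_le_right _ _)
    rwa [le_div_iff₀ (by positivity), mul_comm] at this
  have hρ0 := S.density_nonneg r
  have hρ1 := hKρ δ Eδ y S r
  have hp0 := S.pressure_nonneg r
  have hp1 := hKp δ Eδ y S r
  have hm0 := sub_nonneg.2 (S.M_le_mass hr2)
  have hm1 := hKm δ Eδ y S r hr
  refine ⟨_, hasDerivAt_wellSlope hrr (S.mass_deriv r) hpd, ?_⟩
  generalize shellDensity Φ l L₀ r₀ χ δ y r = ρ at *
  generalize shellPressure Φ l L₀ r₀ χ δ y r = p at *
  generalize shellMass M Φ l L₀ r₀ χ δ y r - M = m at *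
  have hrR := hr.2
  have b1 : |m * (r ^ 2 + 3 * L) + 4 * Real.pi * r ^ 3 * p * (r ^ 2 + L)| ≤ K₁ * δ := by
    rw [abs_of_nonneg (by positivity)]
    calc _ ≤ Km * δ * (R ^ 2 + 3 * Λ) + 4 * Real.pi * R ^ 3 * (Kp * δ) * (R ^ 2 + Λ) := by gcongr
      _ = _ := by rw [hK₁]; ring
  have b2 : |4 * Real.pi * r ^ 2 * ρ * (r ^ 2 + 3 * L) + m * (2 * r) +
      (12 * Real.pi * r ^ 2 * p + 4 * Real.pi * r ^ 3 * p') * (r ^ 2 + L) +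
      4 * Real.pi * r ^ 3 * p * (2 * r)| ≤ K₂ * δ := by
    have e : |12 * Real.pi * r ^ 2 * p + 4 * Real.pi * r ^ 3 * p'| ≤
        12 * Real.pi * R ^ 2 * (Kp * δ) + 4 * Real.pi * R ^ 3 * (Kp' * δ) := by
      refine (abs_add_le _ _).trans (add_le_add ?_ ?_)
      · rw [abs_of_nonneg (by positivity)]
        gcongr
      · rw [abs_mul, abs_of_nonneg (by positivity : 0 ≤ 4 * Real.pi * r ^ 3)]
        gcongr
    calc _ ≤ |4 * Real.pi * r ^ 2 * ρ * (r ^ 2 + 3 * L)| + |m * (2 * r)| +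
          |(12 * Real.pi * r ^ 2 * p + 4 * Real.pi * r ^ 3 * p') * (r ^ 2 + L)| +
          |4 * Real.pi * r ^ 3 * p * (2 * r)| :=
          (abs_add_le _ _).trans (add_le_add ((abs_add_le _ _).trans
            (add_le_add (abs_add_le _ _) le_rfl)) le_rfl)
      _ = 4 * Real.pi * r ^ 2 * ρ * (r ^ 2 + 3 * L) + m * (2 * r) +
          |12 * Real.pi * r ^ 2 * p + 4 * Real.pi * r ^ 3 * p'| * (r ^ 2 + L) +
          4 * Real.pi * r ^ 3 * p * (2 * r) := by
          rw [abs_of_nonneg (by positivity : 0 ≤ 4 * Real.pi * r ^ 2 * ρ * (r ^ 2 + 3 * L)),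
            abs_of_nonneg (by positivity : 0 ≤ m * (2 * r)), abs_mul,
            abs_of_nonneg (by positivity : 0 ≤ r ^ 2 + L),
            abs_of_nonneg (by positivity : 0 ≤ 4 * Real.pi * r ^ 3 * p * (2 * r))]
      _ ≤ 4 * Real.pi * R ^ 2 * (Kρ * δ) * (R ^ 2 + 3 * Λ) + Km * δ * (2 * R) +
          (12 * Real.pi * R ^ 2 * (Kp * δ) + 4 * Real.pi * R ^ 3 * (Kp' * δ)) * (R ^ 2 + Λ) +
          4 * Real.pi * R ^ 3 * (Kp * δ) * (2 * R) := by gcongr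
      _ = _ := by rw [hK₂]; ring
  generalize 4 * Real.pi * r ^ 2 * ρ * (r ^ 2 + 3 * L) + m * (2 * r) +
      (12 * Real.pi * r ^ 2 * p + 4 * Real.pi * r ^ 3 * p') * (r ^ 2 + L) +
      4 * Real.pi * r ^ 3 * p * (2 * r) = Z' at *
  generalize m * (r ^ 2 + 3 * L) + 4 * Real.pi * r ^ 3 * p * (r ^ 2 + L) = Z at *
  have b3 : |Z' / (r - r₀) - Z / (r - r₀) ^ 2| ≤ M / 2 := by
    refine le_trans ((abs_sub _ _).trans (add_le_add ?_ ?_)) (b := K₂ * δ / d + K₁ * δ / d ^ 2) ?_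
    · rw [abs_div, abs_of_pos (hd0.trans_le hrd)]
      exact div_le_div₀ (by positivity) b2 hd0 hrd
    · rw [abs_div, abs_of_pos (pow_pos (hd0.trans_le hrd) 2)]
      exact div_le_div₀ (by positivity) b1 (by positivity) (pow_le_pow_left₀ hd0.le hrd 2)
    · refine le_trans (le_of_eq ?_) hδ2
      ring
  -- The coefficient of `1/(r - r₀)` vanishes for `L = L₀`, because `r₀` is a root, and decreases in
  -- `L`, because `r₀ > 3M`. This is why division by `r - r₀` makes the vacuum slope increase at
  -- rate at least `M` for all `L ≥ L₀`.
  have b4 : M * r₀ ^ 2 - L * (r₀ - 3 * M) ≤ 0 := by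
    have h1 := P.r₀_root
    have h2 := mul_le_mul_of_nonneg_right hL (sub_pos.2 P.three_M_lt_r₀).le
    linarith
  have b5 : -(M * r₀ ^ 2 - L * (r₀ - 3 * M)) ≤ Λ * r₀ := by
    have h1 : L * (r₀ - 3 * M) ≤ Λ * r₀ :=
      mul_le_mul hLΛ (by linarith) (sub_pos.2 P.three_M_lt_r₀).le hΛ0.le
    have h2 : 0 ≤ M * r₀ ^ 2 := by positivity
    linarith
  have b6 : 0 ≤ -((M * r₀ ^ 2 - L * (r₀ - 3 * M)) / (r - r₀) ^ 2) := by
    rw [← neg_div]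
    exact div_nonneg (by linarith) (sq_nonneg _)
  have b7 : -((M * r₀ ^ 2 - L * (r₀ - 3 * M)) / (r - r₀) ^ 2) ≤ Λ * r₀ / d ^ 2 := by
    rw [← neg_div]
    exact div_le_div₀ (by positivity) b5 (by positivity) (pow_le_pow_left₀ hd0.le hrd 2)
  obtain ⟨b8, b9⟩ := abs_le.1 b3
  constructor <;> linarith

end ShellSetting

/-! ### Conclusion for shells -/

lemma exists_pos_bounds {a b : ℝ} (hab : a ≤ b) {f : ℝ → ℝ} (hf : ContinuousOn f (Icc a b))
    (hpos : ∀ r ∈ Icc a b, 0 < f r) :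
    ∃ c C, 0 < c ∧ 0 < C ∧ ∀ r ∈ Icc a b, c ≤ f r ∧ f r ≤ C := by
  obtain ⟨x, hx, hmin⟩ := isCompact_Icc.exists_isMinOn (nonempty_Icc.2 hab) hf
  obtain ⟨z, hz, hmax⟩ := isCompact_Icc.exists_isMaxOn (nonempty_Icc.2 hab) hf
  exact ⟨f x, f z, hpos x hx, hpos z hz, fun r hr => ⟨hmin hr, hmax hr⟩⟩

/-- All wells have the same end points `Rmin` and `2M/(1 - e₀²)`, which stay away from `r₀` and from
infinity. Hence the factors multiplying the slope function are bounded by compactness, and no weight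
is needed. -/
theorem shellState_conclusion {M l L₀ r₀ rL e₀ Rmin η₀ : ℝ} {χ Φ : ℝ → ℝ} (hl : -(1 / 2) < l)
    (hΦ : BasicAnsatz Φ) (hpos : PositiveAtCutoff Φ)
    (P : ShellParameters M L₀ r₀ rL e₀ Rmin η₀ χ) :
    ∃ δ₀ : ℝ, 0 < δ₀ ∧ ∀ δ : ℝ, 0 < δ → δ ≤ δ₀ → ∀ (Eδ : ℝ) (y : ℝ → ℝ),
      IsShellSolution M Φ l L₀ r₀ e₀ χ δ Eδ y →
        (shellState M Φ l L₀ r₀ χ δ Eδ y).SingleWell ∧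
        (shellState M Φ l L₀ r₀ χ δ Eδ y).PeriodWellDefined ∧
        (shellState M Φ l L₀ r₀ χ δ Eδ y).PeriodBounded := by
  have hM := P.mass_pos
  have hL₀ := P.L₀_pos
  have hRm : 0 < Rmin := by linarith [P.two_M_lt_Rmin]
  have hRR := P.Rmin_lt_Rmax
  -- The last argument bounds every `L` with a nonempty well: there `L/r² < e^(2y) ≤ e₀²/(1 -
  -- 2M/Rmin)` with `r < 2M/(1 - e₀²)`. It is independent of `δ`, so `δ₀` can be fixed in advance.
  obtain ⟨δ₀, CW, hδ₀, hCW, hslope⟩ := ShellSetting.exists_wellSlope_bounds hl hΦ P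
    ((2 * M / (1 - e₀ ^ 2)) ^ 2 * (e₀ ^ 2 / (1 - 2 * M / Rmin)))
  refine ⟨δ₀, hδ₀, fun δ hδ hδ' Eδ y hsol => ?_⟩
  have T : ShellSetting M l L₀ r₀ rL e₀ Rmin η₀ χ Φ δ Eδ y := ⟨hl, hΦ, P, hδ, hsol⟩
  have hE := hsol.cutoff_pos
  have hslope := hslope δ Eδ y hδ' T
  set R := 2 * M / (1 - e₀ ^ 2) with hR
  set S := shellState M Φ l L₀ r₀ χ δ Eδ y with hS
  set m := shellMass M Φ l L₀ r₀ χ δ y with hm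
  set p := shellPressure Φ l L₀ r₀ χ δ y with hp
  have hR0 : 0 < R := hRm.trans hRR
  have h2M : ∀ r ∈ Icc Rmin R, 2 * M < r := fun r hr => P.two_M_lt_Rmin.trans_le hr.1
  have h0 : ∀ r ∈ Icc Rmin R, 0 < r := fun r hr => hRm.trans_le hr.1
  have hμ : ∀ r, Real.exp (S.μ r) = Eδ * Real.exp (-y r) := fun r => exp_log_sub hE _
  have hyc : ContinuousOn y (Icc Rmin R) := fun r hr =>
    (T.y_differentiableAt (h2M r hr)).continuousAt.continuousWithinAt
  have hμc : ContinuousOn S.μ (Icc Rmin R) := continuousOn_const.sub hyc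
  have hmc : ContinuousOn m (Icc Rmin R) := fun r _ =>
    (T.mass_deriv r).continuousAt.continuousWithinAt
  have hlamc : ContinuousOn S.lam (Icc Rmin R) :=
    continuousOn_const.mul ((continuousOn_const.sub ((continuousOn_const.div continuousOn_id
      fun r hr => (h0 r hr).ne').mul hmc)).log fun r hr => (T.one_sub_pos (h2M r hr)).ne')
  have hΨ_lt : ∀ L r, 0 < L → (S.effPot L r < Eδ ↔ 1 + L / r ^ 2 < Real.exp (2 * y r)) := by
    intro L r hL
    unfold StaticData.effPot
    rw [hμ, mul_assoc, mul_lt_iff_lt_one_right hE, exp_neg_mul_sqrt_lt_one_iff (by positivity)]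
  have hdown : ∀ L r, L₀ ≤ L → 1 + L / r ^ 2 < Real.exp (2 * y r) →
      1 + L₀ / r ^ 2 < Real.exp (2 * y r) := fun L r hL h =>
    lt_of_le_of_lt (by gcongr) h
  have hwell : ∀ L r, L₀ ≤ L → (r ∈ S.wellSet L ↔ r ∈ Ioo Rmin R ∧ S.effPot L r < Eδ) := by
    intro L r hL
    have e : r ∈ S.wellSet L ↔
        2 * M < r ∧ S.effPot L r < Eδ ∧ 0 < shellDensity Φ l L₀ r₀ χ δ y r := Iff.rfl
    rw [e]
    constructor
    · rintro ⟨-, h2, h3⟩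
      refine ⟨?_, h2⟩
      by_contra hcon
      exact h3.ne' (T.eq_zero_of_notMem hcon).1
    · rintro ⟨h1, h2⟩
      exact ⟨h2M r (Ioo_subset_Icc_self h1), h2, T.density_pos hpos h1.1
        (hdown L r hL ((hΨ_lt L r (hL₀.trans_le hL)).1 h2))⟩
  -- This is the factor `h` in `(E² - Ψ_L²)' = -r h W` with `W` the function `wellSlope`; it
  -- contains neither `E` nor `L`.
  have hhc : ContinuousOn (fun r => 2 * Eδ ^ 2 * Real.exp (-(2 * y r)) * (r - r₀) /
      (r ^ 4 * (r - 2 * m r))) (Icc Rmin R) := by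
    refine ((continuousOn_const.mul (continuousOn_const.mul hyc).neg.rexp).mul
      (continuousOn_id.sub continuousOn_const)).div ((continuousOn_id.pow 4).mul
      (continuousOn_id.sub (continuousOn_const.mul hmc))) fun r hr => ?_
    exact mul_ne_zero (pow_ne_zero 4 (h0 r hr).ne')
      (sub_pos.2 (hsol.noHorizon r (h2M r hr))).ne'
  obtain ⟨h₁, h₂, hh₁, hh₂, hh⟩ := exists_pos_bounds hRR.le hhc fun r hr => by
    have i1 := h0 r hr
    have i2 := sub_pos.2 (hsol.noHorizon r (h2M r hr))
    have i3 : 0 < r - r₀ := sub_pos.2 (P.r₀_lt_Rmin.trans_le hr.1)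
    positivity
  obtain ⟨f₁, f₂, hf₁, hf₂, hf⟩ := exists_pos_bounds hRR.le
    (f := fun r => Real.exp (S.lam r - S.μ r) / r)
    ((hlamc.sub hμc).rexp.div continuousOn_id fun r hr => (h0 r hr).ne') fun r hr => by
      have i1 := h0 r hr
      positivity
  obtain ⟨μ₁, μ₂, hμ₁, -, hμb⟩ := exists_pos_bounds hRR.le hμc.rexp fun r _ => Real.exp_pos _
  -- On `[Rmin, R]` the constant bounds `M/2 ≤ W' ≤ CW` become multiples of `r` after division by
  -- `R` and `Rmin`; the weight bounds use `μ₁ ≤ E ≤ Eδ`.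
  refine S.conclusion_of_isWell (M / 2 / R) (CW / Rmin) h₁ h₂ (f₁ * μ₁) (f₂ * Eδ)
    (by positivity) hh₂ (by positivity) ?_ ?_
  · rintro E L ⟨r, w, L', ⟨hr, -, hf⟩, hL, -, heq⟩
    obtain ⟨rfl, rfl⟩ := Prod.mk.inj heq
    have hr : 2 * M < r := hr
    have hf : 0 < δ * χ (r - r₀) * microState Φ l L₀ Eδ (particleEnergy S.μ r w L) L := hf
    have hχ : r₀ < r := by
      by_contra! hcon
      rw [P.χ_zero _ (by linarith)] at hf
      simp at hf
    have hLL : L₀ < L := by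
      by_contra! hcon
      rw [microState, if_neg (not_lt.2 hcon)] at hf
      simp at hf
    have hEE : particleEnergy S.μ r w L < Eδ := by
      by_contra! hcon
      have : 1 - particleEnergy S.μ r w L / Eδ ≤ 0 := by
        rw [sub_nonpos, one_le_div hE]; exact hcon
      rw [microState, hΦ.vanish _ this] at hf
      simp at hf
    have hle : S.effPot L r ≤ particleEnergy S.μ r w L := by
      unfold StaticData.effPot particleEnergy
      refine mul_le_mul_of_nonneg_left (Real.sqrt_le_sqrt ?_) (Real.exp_pos _).le
      linarith [sq_nonneg w]
    have hlt := hle.trans_lt hEE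
    exact ⟨hLL.le, hEE, r, (hwell L r hLL.le).2
      ⟨T.mem_Ioo hχ (hdown L r hLL.le ((hΨ_lt L r hL).1 hlt)), hlt⟩⟩
  · intro L hL hLL hne
    have hLL : L₀ ≤ L := hLL
    have hLΛ : L ≤ R ^ 2 * (e₀ ^ 2 / (1 - 2 * M / Rmin)) := by
      obtain ⟨r, hr⟩ := hne
      obtain ⟨hrI, hrE⟩ := (hwell L r hLL).1 hr
      have hr0 := h0 r (Ioo_subset_Icc_self hrI)
      have i1 := (hΨ_lt L r hL).1 hrE
      have i2 := T.exp_two_mul_le_const hrI.1.le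
      have i3 : L / r ^ 2 ≤ e₀ ^ 2 / (1 - 2 * M / Rmin) := by linarith
      rw [div_le_iff₀ (pow_pos hr0 2)] at i3
      refine i3.trans ?_
      rw [mul_comm]
      have := hrI.2.le
      have : 0 ≤ e₀ ^ 2 / (1 - 2 * M / Rmin) :=
        div_nonneg (sq_nonneg _) (one_sub_two_mul_div_pos hM P.two_M_lt_Rmin).le
      gcongr
    have hW : ∀ r ∈ Icc Rmin R, HasDerivAt (wellSlope M r₀ L m p)
        (deriv (wellSlope M r₀ L m p) r) r ∧ M / 2 ≤ deriv (wellSlope M r₀ L m p) r ∧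
          deriv (wellSlope M r₀ L m p) r ≤ CW := by
      intro r hr
      obtain ⟨W', i1, i2, i3⟩ := hslope L hLL hLΛ r hr
      rw [i1.deriv]
      exact ⟨i1, i2, i3⟩
    have hend : ∀ r, r₀ < r → r ∉ Ioo Rmin R → Eδ ≤ S.effPot L r := by
      intro r hr hn
      by_contra! hcon
      exact hn (T.mem_Ioo hr (hdown L r hLL ((hΨ_lt L r hL).1 hcon)))
    refine ⟨Rmin, R, hRm, hRR, fun r => hwell L r hLL,
      hend Rmin P.r₀_lt_Rmin fun h => lt_irrefl _ h.1,
      hend R (P.r₀_lt_Rmin.trans hRR) fun h => lt_irrefl _ h.2, hμc, hlamc,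
      fun r hr => (T.y_differentiableAt (h2M r (Ioo_subset_Icc_self hr))).const_sub _, ?_⟩
    rintro E hEE ⟨r₁, hr₁, hr₁E⟩
    have hEE : E < Eδ := hEE
    -- An energy reached in the well is at least the minimum of `e^μ`, since `√(1 + L/r²) ≥ 1`.
    have hElow : μ₁ ≤ E := by
      refine (hμb r₁ (Ioo_subset_Icc_self hr₁)).1.trans (le_trans ?_ hr₁E)
      refine le_mul_of_one_le_right (Real.exp_pos _).le ?_
      rw [Real.one_le_sqrt]
      linarith [div_pos hL (pow_pos (h0 r₁ (Ioo_subset_Icc_self hr₁)) 2)]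
    have hDd : ∀ r ∈ Icc Rmin R, HasDerivAt (fun r => 1 * (E ^ 2 - S.effPot L r ^ 2))
        (-(r * (2 * Eδ ^ 2 * Real.exp (-(2 * y r)) * (r - r₀) / (r ^ 4 * (r - 2 * m r))) *
          wellSlope M r₀ L m p r)) r := by
      intro r hr
      have hr0 := h0 r hr
      have hv := sub_pos.2 (hsol.noHorizon r (h2M r hr))
      have hΨ : ∀ x, S.effPot L x ^ 2 = Eδ ^ 2 * (Real.exp (-(2 * y x)) * (1 + L / x ^ 2)) := by
        intro x
        have e : Real.exp (-(2 * y x)) = Real.exp (-y x) ^ 2 := by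
          rw [← Real.exp_nat_mul]; congr 1; push_cast; ring
        rw [S.effPot_sq hL, hμ, e]
        ring
      simp only [hΨ]
      have i1 := ((((hsol.ode r (h2M r hr)).const_mul 2).fun_neg.exp.fun_mul
        ((hasDerivAt_const_div_sq (c := L) hr0.ne').const_add 1)).const_mul
          (Eδ ^ 2)).const_sub (E ^ 2) |>.const_mul 1
      refine i1.congr_deriv ?_
      have hrr : r - r₀ ≠ 0 := (sub_pos.2 (P.r₀_lt_Rmin.trans_le hr.1)).ne'
      unfold wellSlope
      rw [← hm, ← hp]
      have hv' : r - 2 * m r ≠ 0 := hv.ne'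
      have e : 1 - 2 / r * m r = (r - 2 * m r) / r := by field_simp
      rw [e]
      generalize Real.exp (-(2 * y r)) = X
      generalize p r = q
      generalize m r = n at *
      field_simp
      ring
    refine ⟨fun _ => 1, _, wellSlope M r₀ L m p, deriv (wellSlope M r₀ L m p),
      fun _ _ => one_pos, fun _ _ => differentiableAt_const _,
      ⟨hRm, hRR, by positivity, hh₁,
        fun r hr => (hDd r hr).continuousAt.continuousWithinAt,
        fun r hr => hDd r (Ioo_subset_Icc_self hr),
        fun r hr => hh r (Ioo_subset_Icc_self hr),
        fun r hr => (hW r (Ioo_subset_Icc_self hr)).1, fun r hr => ?_⟩, fun r hr => ?_⟩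
    · obtain ⟨-, i1, i2⟩ := hW r (Ioo_subset_Icc_self hr)
      have hr0 := h0 r (Ioo_subset_Icc_self hr)
      constructor
      · refine le_trans ?_ i1
        rw [div_mul_eq_mul_div, div_le_iff₀ hR0]
        exact mul_le_mul_of_nonneg_left hr.2.le (by positivity)
      · refine i2.trans ?_
        rw [div_mul_eq_mul_div, le_div_iff₀ hRm]
        exact mul_le_mul_of_nonneg_left hr.1.le hCW.le
    · have hr0 := h0 r (Ioo_subset_Icc_self hr)
      obtain ⟨i1, i2⟩ := hf r (Ioo_subset_Icc_self hr)
      rw [le_div_iff₀ hr0] at i1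
      rw [div_le_iff₀ hr0] at i2
      rw [Real.sqrt_one, mul_one]
      constructor
      · calc f₁ * μ₁ * r = f₁ * r * μ₁ := by ring
          _ ≤ _ := mul_le_mul i1 hElow hμ₁.le (Real.exp_pos _).le
      · calc _ ≤ f₂ * r * Eδ := mul_le_mul i2 hEE.le (hμ₁.le.trans hElow) (by positivity)
          _ = _ := by ring

end EinsteinVlasov

theorem mainTheorem6 :
    -- Small shells around a Schwarzschild black hole.
    (∀ (M l L₀ r₀ rL e₀ Rmin η₀ : ℝ) (χ Φ : ℝ → ℝ),
      -(1 / 2) < l →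
      EinsteinVlasov.BasicAnsatz Φ →
      EinsteinVlasov.PositiveAtCutoff Φ →
      EinsteinVlasov.ShellParameters M L₀ r₀ rL e₀ Rmin η₀ χ →
      ∃ δ₀ : ℝ, 0 < δ₀ ∧ ∀ δ : ℝ, 0 < δ → δ ≤ δ₀ → ∀ (Eδ : ℝ) (y : ℝ → ℝ),
        EinsteinVlasov.IsShellSolution M Φ l L₀ r₀ e₀ χ δ Eδ y →
        (EinsteinVlasov.shellState M Φ l L₀ r₀ χ δ Eδ y).SingleWell ∧
        (EinsteinVlasov.shellState M Φ l L₀ r₀ χ δ Eδ y).PeriodWellDefined ∧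
        (EinsteinVlasov.shellState M Φ l L₀ r₀ χ δ Eδ y).PeriodBounded) ∧
    -- Isotropic (l = 0, L₀ = 0) singularity-free steady states with 2m/r ≤ 1/3.
    (∀ (y₀ E₀ : ℝ) (Φ y : ℝ → ℝ),
      EinsteinVlasov.BasicAnsatz Φ →
      EinsteinVlasov.PowerLike Φ 0 →
      0 < y₀ →
      EinsteinVlasov.IsRegularSolution Φ 0 0 y₀ E₀ y →
      (∀ r : ℝ, 0 < r → 2 * EinsteinVlasov.regularMass Φ 0 0 y r / r ≤ 1 / 3) →
      (EinsteinVlasov.regularState Φ 0 0 E₀ y).SingleWell ∧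
      (EinsteinVlasov.regularState Φ 0 0 E₀ y).PeriodWellDefined ∧
      (EinsteinVlasov.regularState Φ 0 0 E₀ y).PeriodBounded) :=
  ⟨fun _ _ _ _ _ _ _ _ _ _ hl hΦ hpos P => EinsteinVlasov.shellState_conclusion hl hΦ hpos P,
    fun _ _ _ _ hΦ hk hy₀ h hcomp =>
      EinsteinVlasov.regularState_conclusion hΦ hk.positiveAtCutoff hy₀ h hcomp⟩
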